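/- **Conventions.** On $V=\mathbb R^6$ with orthonormal basis $e_1,\dots,e_6$ and dual basis $e^1,\dots,e^6$ let $J_0e_p=e_{p+3}$, $J_0e_{p+3}=-e_p$ $(p=1,2,3)$, $\Omega_0=e^{14}+e^{25}+e^{36}$, $\Upsilon_0=(e^1+ie^4)\wedge(e^2+ie^5)\wedge(e^3+ie^6)$. For $\theta\in\mathbb R$ put $v_p(\theta)=\cos\frac\theta3\,e_p+\sin\frac\theta3\,e_{p+3}$ and $w_p(\theta)=-\sin\frac\theta3\,e_p+\cos\frac\theta3\,e_{p+3}$. Let $\mathsf T=\langle e^1,e^2,e^3\rangle$, $\mathsf N=\langle e^4,e^5,e^6\rangle$, $W_\theta=\langle w_1(\theta),w_2(\theta),w_3(\theta)\rangle$, and for a covector $\alpha$ let $\alpha=\alpha_{\mathsf T}+\alpha_{\mathsf N}$ be its decomposition in $V^*=\mathsf T\oplus\mathsf N$ and $J\alpha:=\alpha\circ J_0$ (so $Je^4=e^1$). An $SU(3)$-structure on a smooth $6$-manifold $M$ is a pair of smooth forms $\Omega\in\Omega^2(M)$, $\Upsilon\in\Omega^3(M;\mathbb C)$ such that at each $x$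 there is a linear isomorphism (an $SU(3)$-coframe) $u:T_xM\to V$ with $\Omega_x=u^*\Omega_0$, $\Upsilon_x=u^*\Upsilon_0$; it induces a Riemannian metric $g$ and an almost complex structure $J$, corresponding to the Euclidean metric and $J_0$ under every such $u$. Let $\Lambda^2_8=\{\beta:\beta\wedge\mathrm{Re}\Upsilon=0,\ \beta\wedge\Omega^2=0\}$ and $\Lambda^3_{12}=\{\gamma:\gamma\wedge\Omega=0,\ \gamma\wedge\mathrm{Re}\Upsilon=\gamma\wedge\mathrm{Im}\Upsilon=0\}$. The torsion forms $\tau_0,\hat\tau_0\in\mathbb R$, $\tau_2,\hat\tau_2\in\Lambda^2_8$, $\tau_3\in\Lambda^3_{12}$, $\tau_4,\tau_5\in\Lambda^1$ at a point are defined by $$d\Omega=3\tau_0\mathrm{Re}\Upsilon+3\hat\tau_0\mathrm{Im}\Upsilon+\tau_3+\tau_4\wedge\Omega,$$ $$d\,\mathrm{Re}\Upsilon=2\hat\tau_0\Omega^2+\tau_5\wedge\mathrm{Re}\Upsilon+\tau_2\wedge\Omega,\qquad d\,\mathrm{Im}\Upsilon=-2\tau_0\Omega^2+(\tau_5\circ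 J)\wedge\mathrm{Re}\Upsilon+\hat\tau_2\wedge\Omega .$$ A torsion class is a direct sum of some of the seven summands $X_0^+,X_0^-,X_2^+,X_2^-,X_3,X_4,X_5$, which contain $\tau_0,\hat\tau_0,\tau_2,\hat\tau_2,\tau_3,\tau_4,\tau_5$ respectively; an $SU(3)$-structure belongs to it if its torsion forms in the other summands vanish identically. Let $\rho(h)$ be the $2$-form $\frac12\sum_{i,j,k}h_{ik}\Omega_{kj}e^{ij}$ on $V$, where $\Omega_0=\frac12\Omega_{ij}e^{ij}$, and let $$(\Lambda^2_8)_1=\left\{\rho\begin{pmatrix}0&h\\-h&0\end{pmatrix}:h^T=-h\right\},\qquad (\Lambda^2_8)_2=\left\{\rho\begin{pmatrix}h&0\\0&h\end{pmatrix}:h^T=h,\ \mathrm{tr}\,h=0\right\},$$ so that $\Lambda^2_8(V^*)=(\Lambda^2_8)_1\oplus(\Lambda^2_8)_2$; write $\beta=(\beta)_1+(\beta)_2$. Let $\S:\mathsf T\to W_\theta$, $\alpha^\S=-\sin\frac\theta3\,\alpha^\sharp+\cos\frac\theta3\,J_0\alpha^\sharp$, and let $\natural:(\Lambda^2_8)_1\to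 W_\theta$ be the inverse of $$\sum_p a_pw_p(\theta)\mapsto\tfrac1{\sqrt2}\,\rho\begin{pmatrix}0&h\\-h&0\end{pmatrix},\qquad h=\begin{pmatrix}0&a_3&-a_2\\-a_3&0&a_1\\a_2&-a_1&0\end{pmatrix}.$$ An immersed special Lagrangian $3$-fold of phase $\theta$ is a smooth immersion $f:\Sigma^3\to M$ with $f^*\Omega=0$ and $f^*\mathrm{Im}(e^{-i\theta}\Upsilon)=0$. An $SU(3)$-coframe $u$ at $f(p)$ is adapted if $u(df(T_p\Sigma))=\langle v_1(\theta),v_2(\theta),v_3(\theta)\rangle$. The mean curvature vector $H$ is the trace of the second fundamental form with respect to $g$. **Theorem.** (a) Every $SU(3)$-structure has, at each point, exactly one system of torsion forms. For every $\theta$, $\S$ and $\natural$ are isometric isomorphisms (for the norms in which the $e^i$, respectively the $e^{ij}$ with $i<j$, are orthonormal). (b) Let $f:\Sigma\to M$ be an immersed special Lagrangian $3$-fold of phase $\theta$ in a $6$-manifold with an arbitrary $SU(3)$-structure. At every $p\in\Sigma$ adapted coframes exist, and, if $T_{f(p)}M$ is identified with $V$ by any adapted coframe, $$H=-\tfrac1{\sqrt2}\cos\theta\,[(\tau_2)_1]^\natural-\tfrac1{\sqrt2}\sin\theta\,[(\hat\tau_2)_1]^\natural+\sin\tfrac\theta3\,[(\tau_5)_{\mathsf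 T}]^\S-\cos\tfrac\theta3\,[J(\tau_5)_{\mathsf N}]^\S .$$ (c) Among the torsion classes $C$ such that, for every $SU(3)$-structure of class $C$ on any $6$-manifold, every special Lagrangian $3$-fold of every phase is minimal ($H=0$), the largest is $X_0^+\oplus X_0^-\oplus X_3\oplus X_4$ (that is, $\tau_2=\hat\tau_2=\tau_5=0$). -/

import Mathlib

open scoped Manifold ContDiff

universe u v

noncomputable section

/-! ### Linear algebra of the model space -/

/-- The model space `ℝ⁶ = ℝ³ ⊕ ℝ³`, with its Euclidean inner product. The index `inl p` stands for
`p` and the index `inr p` for `p + 3`, where `p = 1, 2, 3`. -/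
abbrev ModelV : Type := EuclideanSpace ℝ (Fin 3 ⊕ Fin 3)

/-- The standard basis vector `e_i` of the model space. -/
def basisVec (i : Fin 3 ⊕ Fin 3) : ModelV := EuclideanSpace.single i 1

/-- The dual basis covector `e^i` of the model space. -/
def dualVec (i : Fin 3 ⊕ Fin 3) : ModelV →L[ℝ] ℝ := EuclideanSpace.proj i

/-- The standard complex structure, as a function of coordinates: `J₀ e_p = e_{p+3}` and
`J₀ e_{p+3} = - e_p`. -/
def modelJ : ModelV →L[ℝ] ModelV :=
  ∑ p : Fin 3, ((dualVec (Sum.inl p)).smulRight (basisVec (Sum.inr p)) -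
    (dualVec (Sum.inr p)).smulRight (basisVec (Sum.inl p)))

/-- The determinant as a continuous alternating map in the rows of a matrix. -/
def detForm (𝕜 : Type) [RCLike 𝕜] (k : ℕ) : (Fin k → 𝕜) [⋀^Fin k]→L[𝕜] 𝕜 :=
  { (Matrix.detRowAlternating : (Fin k → 𝕜) [⋀^Fin k]→ₗ[𝕜] 𝕜) with
    cont := by
      change Continuous fun M : Fin k → Fin k → 𝕜 => Matrix.det (Matrix.of M)
      exact Continuous.matrix_det continuous_id }

/-- The form `e^i ∧ e^j`. -/
def dualVec₂ (i j : Fin 3 ⊕ Fin 3) : ModelV [⋀^Fin 2]→L[ℝ] ℝ :=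
  (detForm ℝ 2).compContinuousLinearMap (ContinuousLinearMap.pi ![dualVec i, dualVec j])

/-- `Ω₀ = e^{14} + e^{25} + e^{36}`. -/
def modelOmega : ModelV [⋀^Fin 2]→L[ℝ] ℝ := ∑ p : Fin 3, dualVec₂ (Sum.inl p) (Sum.inr p)

/-- The complex covector `e^p + i e^{p+3}`. -/
def complexCovec (p : Fin 3) : ModelV →L[ℝ] ℂ :=
  Complex.ofRealCLM.comp (dualVec (Sum.inl p)) +
    Complex.I • Complex.ofRealCLM.comp (dualVec (Sum.inr p))

/-- `Υ₀ = (e^1 + i e^4) ∧ (e^2 + i e^5) ∧ (e^3 + i e^6)`. -/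
def modelUpsilon : ModelV [⋀^Fin 3]→L[ℝ] ℂ :=
  ((detForm ℂ 3).restrictScalars ℝ).compContinuousLinearMap (ContinuousLinearMap.pi complexCovec)

/-- The vectors `v_p(θ) = cos(θ/3) e_p + sin(θ/3) e_{p+3}`. -/
def vVec (θ : ℝ) (p : Fin 3) : ModelV :=
  Real.cos (θ / 3) • basisVec (Sum.inl p) + Real.sin (θ / 3) • basisVec (Sum.inr p)

/-- The vectors `w_p(θ) = - sin(θ/3) e_p + cos(θ/3) e_{p+3}`. -/
def wVec (θ : ℝ) (p : Fin 3) : ModelV :=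
  -Real.sin (θ / 3) • basisVec (Sum.inl p) + Real.cos (θ / 3) • basisVec (Sum.inr p)

/-- The plane `e^{iθ/3} · N♯`, spanned by `w_1(θ), w_2(θ), w_3(θ)`. -/
def rotatedNormal (θ : ℝ) : Submodule ℝ ModelV := Submodule.span ℝ (Set.range (wVec θ))

/-! ### One-forms on the model space -/

/-- The space `T = ⟨e^1, e^2, e^3⟩` of covectors. -/
def covecT : Submodule ℝ (ModelV →L[ℝ] ℝ) :=
  Submodule.span ℝ (Set.range fun p : Fin 3 => dualVec (Sum.inl p))

/-- The `T`-component of a covector, for the splitting of the dual space as `T ⊕ N`, where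
`N = ⟨e^4, e^5, e^6⟩`. -/
def partT (α : ModelV →L[ℝ] ℝ) : ModelV →L[ℝ] ℝ :=
  ∑ p : Fin 3, α (basisVec (Sum.inl p)) • dualVec (Sum.inl p)

/-- The `N`-component of a covector. -/
def partN (α : ModelV →L[ℝ] ℝ) : ModelV →L[ℝ] ℝ :=
  ∑ p : Fin 3, α (basisVec (Sum.inr p)) • dualVec (Sum.inr p)

/-- The map `α ↦ α^§ = - sin(θ/3) α♯ + cos(θ/3) J₀ (α♯)`; it takes `e^p` to `w_p(θ)`. -/
def sectionMap (θ : ℝ) (α : ModelV →L[ℝ] ℝ) : ModelV :=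
  -Real.sin (θ / 3) • (InnerProductSpace.toDual ℝ ModelV).symm α +
    Real.cos (θ / 3) • modelJ ((InnerProductSpace.toDual ℝ ModelV).symm α)

/-! ### Two-forms on the model space -/

/-- The skew matrix `(Ω_{ij})` with `Ω₀ = ½ Ω_{ij} e^{ij}`. -/
def omegaMatrix : Matrix (Fin 3 ⊕ Fin 3) (Fin 3 ⊕ Fin 3) ℝ := Matrix.fromBlocks 0 1 (-1) 0

/-- The map `ρ` from matrices to two-forms: `ρ(h)` is the two-form with coefficient matrix
`(h_{ik} Ω_{kj})`, that is `ρ(h) = ½ h_{ik} Ω_{kj} e^{ij}`. -/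
def rho : Matrix (Fin 3 ⊕ Fin 3) (Fin 3 ⊕ Fin 3) ℝ →ₗ[ℝ] (ModelV [⋀^Fin 2]→ₗ[ℝ] ℝ) where
  toFun h := ((1 / 2 : ℝ) • ∑ i, ∑ j, (h * omegaMatrix) i j • dualVec₂ i j).toAlternatingMap
  map_add' h h' := by
    simp only [Matrix.add_mul, Matrix.add_apply, add_smul, Finset.sum_add_distrib, smul_add]
    rfl
  map_smul' c h := by
    simp only [Matrix.smul_mul, Matrix.smul_apply, smul_eq_mul, mul_smul, ← Finset.smul_sum,
      RingHom.id_apply]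
    rw [smul_comm]
    rfl

/-- `(Λ²₈)₁`: the image under `ρ` of the matrices `[0, h; -h, 0]` with `h` skew. -/
def lambdaEightOne : Set (ModelV [⋀^Fin 2]→ₗ[ℝ] ℝ) :=
  rho '' {s | ∃ h : Matrix (Fin 3) (Fin 3) ℝ, h.transpose = -h ∧ s = Matrix.fromBlocks 0 h (-h) 0}

/-- `(Λ²₈)₂`: the image under `ρ` of the matrices `[h, 0; 0, h]` with `h` symmetric and
trace-free. -/
def lambdaEightTwo : Set (ModelV [⋀^Fin 2]→ₗ[ℝ] ℝ) :=
  rho '' {s | ∃ h : Matrix (Fin 3) (Fin 3) ℝ, h.transpose = h ∧ h.trace = 0 ∧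
    s = Matrix.fromBlocks h 0 0 h}

/-- The component in `(Λ²₈)₁` of a two-form in `Λ²₈ = (Λ²₈)₁ ⊕ (Λ²₈)₂`. If `b` and `c` are the
diagonal blocks of the coefficient matrix of the form, it is `ρ [0, k; -k, 0]` with
`k = - ½ (b + c)`; see `partOne_of_mem_lambdaEightOne` and `partOne_of_mem_lambdaEightTwo`. -/
def partOne (β : ModelV [⋀^Fin 2]→ₗ[ℝ] ℝ) : ModelV [⋀^Fin 2]→ₗ[ℝ] ℝ :=
  let k : Matrix (Fin 3) (Fin 3) ℝ := Matrix.of fun p q =>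
    -(1 / 2) * (β ![basisVec (Sum.inl p), basisVec (Sum.inl q)] +
      β ![basisVec (Sum.inr p), basisVec (Sum.inr q)])
  rho (Matrix.fromBlocks 0 k (-k) 0)

/-- The skew matrix attached to `(a_1, a_2, a_3)`. -/
def skewOfVec (a : Fin 3 → ℝ) : Matrix (Fin 3) (Fin 3) ℝ :=
  !![0, a 2, -a 1; -a 2, 0, a 0; a 1, -a 0, 0]

/-- The map `a_p w_p(θ) ↦ (1/√2) ρ [0, h; -h, 0]` from `e^{iθ/3} · N♯` to `(Λ²₈)₁`, where `h` is the
skew matrix attached to `a`; the coordinate `a_p` of a vector `X` is `⟨w_p(θ), X⟩`. -/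
def naturalInv (θ : ℝ) (X : ModelV) : ModelV [⋀^Fin 2]→ₗ[ℝ] ℝ :=
  let h := skewOfVec fun p => inner ℝ (wVec θ p) X
  (1 / Real.sqrt 2) • rho (Matrix.fromBlocks 0 h (-h) 0)

/-- The map `β ↦ β^♮` from `(Λ²₈)₁` to `e^{iθ/3} · N♯`: the inverse of `naturalInv θ`. -/
def naturalMap (θ : ℝ) : (ModelV [⋀^Fin 2]→ₗ[ℝ] ℝ) → ModelV :=
  Function.invFunOn (naturalInv θ) (rotatedNormal θ : Set ModelV)

/-- The squared norm `∑_{i<j} β(e_i, e_j)²` of a two-form, written as half of the sum over all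
`i, j`. -/
def twoFormNormSq (β : ModelV [⋀^Fin 2]→ₗ[ℝ] ℝ) : ℝ :=
  (1 / 2) * ∑ i, ∑ j, (β ![basisVec i, basisVec j]) ^ 2

theorem dualVec₂_apply (i j : Fin 3 ⊕ Fin 3) (X Y : ModelV) :
    dualVec₂ i j ![X, Y] = X i * Y j - X j * Y i := by
  change Matrix.det (Matrix.of fun a b : Fin 2 =>
    (![dualVec i, dualVec j] : Fin 2 → ModelV →L[ℝ] ℝ) b ((![X, Y] : Fin 2 → ModelV) a)) = _
  rw [Matrix.det_fin_two]
  simp [dualVec]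

theorem rho_basisVec (h : Matrix (Fin 3 ⊕ Fin 3) (Fin 3 ⊕ Fin 3) ℝ) (k l : Fin 3 ⊕ Fin 3) :
    rho h ![basisVec k, basisVec l] =
      (1 / 2) * ((h * omegaMatrix) k l - (h * omegaMatrix) l k) := by
  change ((1 / 2 : ℝ) • ∑ i, ∑ j, (h * omegaMatrix) i j • dualVec₂ i j)
    ![basisVec k, basisVec l] = _
  simp only [ContinuousAlternatingMap.smul_apply, ContinuousAlternatingMap.sum_apply,
    dualVec₂_apply, basisVec, PiLp.single_apply, smul_eq_mul, mul_sub, Finset.sum_sub_distrib]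
  simp

theorem partOne_of_mem_lambdaEightOne {β : ModelV [⋀^Fin 2]→ₗ[ℝ] ℝ} (hβ : β ∈ lambdaEightOne) :
    partOne β = β := by
  obtain ⟨s, ⟨h, hh, rfl⟩, rfl⟩ := hβ
  have hh' : ∀ p q, h q p = -h p q := fun p q => congrFun (congrFun hh p) q
  unfold partOne
  simp only [rho_basisVec, omegaMatrix, Matrix.fromBlocks_multiply]
  congr 2
  · ext p q; simp [hh' p q]; ring
  · ext p q; simp [hh' p q]; ring

theorem partOne_of_mem_lambdaEightTwo {β : ModelV [⋀^Fin 2]→ₗ[ℝ] ℝ} (hβ : β ∈ lambdaEightTwo) :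
    partOne β = 0 := by
  obtain ⟨s, ⟨h, hh, -, rfl⟩, rfl⟩ := hβ
  unfold partOne
  simp only [rho_basisVec, omegaMatrix, Matrix.fromBlocks_multiply]
  rw [← map_zero rho]
  congr 1
  ext i j
  rcases i with i | i <;> rcases j with j | j <;> simp

theorem modelJ_apply (X : ModelV) (i : Fin 3 ⊕ Fin 3) :
    modelJ X i = Sum.elim (fun p => -X (Sum.inr p)) (fun p => X (Sum.inl p)) i := by
  rcases i with p | p <;> fin_cases p <;>
    simp [modelJ, dualVec, basisVec, Fin.sum_univ_three]

theorem modelUpsilon_apply (X : Fin 3 → ModelV) : modelUpsilon X =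
    Matrix.det (Matrix.of fun a b : Fin 3 =>
      (X a (Sum.inl b) : ℂ) + Complex.I * (X a (Sum.inr b) : ℂ)) := rfl

theorem modelUpsilon_modelJ (X Y Z : ModelV) :
    modelUpsilon ![modelJ X, Y, Z] = Complex.I * modelUpsilon ![X, Y, Z] := by
  simp only [modelUpsilon_apply, Matrix.det_fin_three, Matrix.of_apply, Matrix.cons_val_zero,
    Matrix.cons_val_one, Matrix.cons_val, modelJ_apply, Sum.elim_inl, Sum.elim_inr]
  push_cast
  ring_nf
  simp only [Complex.I_sq, Complex.I_pow_three, Complex.I_pow_four]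
  ring

theorem modelOmega_modelJ (X Y : ModelV) : modelOmega ![X, modelJ Y] = inner ℝ X Y := by
  have h : ∀ p : Fin 3, dualVec₂ (Sum.inl p) (Sum.inr p) ![X, modelJ Y] =
      X (Sum.inl p) * Y (Sum.inl p) + X (Sum.inr p) * Y (Sum.inr p) := by
    intro p
    simp [dualVec₂_apply, modelJ_apply]
  have h' : modelOmega ![X, modelJ Y] =
      ∑ p : Fin 3, dualVec₂ (Sum.inl p) (Sum.inr p) ![X, modelJ Y] := by
    simp only [modelOmega, ContinuousAlternatingMap.sum_apply]
  rw [h', Finset.sum_congr rfl fun p _ => h p, PiLp.inner_apply, Fintype.sum_sum_type,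
    Finset.sum_add_distrib]
  simp [mul_comm]

theorem eq_zero_of_modelUpsilon (X : ModelV) (h : ∀ Y Z, modelUpsilon ![X, Y, Z] = 0) : X = 0 := by
  have h1 := h (basisVec (Sum.inl 1)) (basisVec (Sum.inl 2))
  have h2 := h (basisVec (Sum.inl 2)) (basisVec (Sum.inl 0))
  have h3 := h (basisVec (Sum.inl 0)) (basisVec (Sum.inl 1))
  simp [modelUpsilon_apply, Matrix.det_fin_three, basisVec, Complex.ext_iff] at h1 h2 h3
  ext i
  rcases i with p | p <;> fin_cases p <;> simp [h1, h2, h3]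

/-! ### Exterior algebra -/

/-- The wedge product of real alternating forms, with
`(α ∧ β)(v) = ∑ sign(σ) α(v_{σ 1}, …, v_{σ k}) β(v_{σ (k+1)}, …, v_{σ (k+l)})` over shuffles. -/
def wedge {E : Type*} [AddCommGroup E] [Module ℝ E] {k l : ℕ}
    (α : E [⋀^Fin k]→ₗ[ℝ] ℝ) (β : E [⋀^Fin l]→ₗ[ℝ] ℝ) : E [⋀^Fin (k + l)]→ₗ[ℝ] ℝ :=
  ((LinearMap.mul' ℝ ℝ).compAlternatingMap (α.domCoprod β)).domDomCongr finSumFinEquiv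

/-- A covector, regarded as an alternating one-form. -/
def oneForm {E : Type*} [AddCommGroup E] [Module ℝ E] [TopologicalSpace E] (α : E →L[ℝ] ℝ) :
    E [⋀^Fin 1]→ₗ[ℝ] ℝ :=
  AlternatingMap.ofSubsingleton ℝ E ℝ (0 : Fin 1) α.toLinearMap

/-! ### Differential forms on a manifold -/

section Forms

variable {n : ℕ} {M : Type*} [TopologicalSpace M] [ChartedSpace (EuclideanSpace ℝ (Fin n)) M]
variable {F : Type*} [NormedAddCommGroup F] [NormedSpace ℝ F] {k : ℕ}

/-- A differential form (with no smoothness condition) with values in `F`. -/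
abbrev RoughForm (n : ℕ) (M : Type*) [TopologicalSpace M]
    [ChartedSpace (EuclideanSpace ℝ (Fin n)) M] (F : Type*) [NormedAddCommGroup F]
    [NormedSpace ℝ F] (k : ℕ) : Type _ :=
  (x : M) → TangentSpace (𝓡 n) x [⋀^Fin k]→L[ℝ] F

/-- The coordinate expression of a form in the preferred chart at `x₀`. -/
def formInChart (η : RoughForm n M F k) (x₀ : M) (y : EuclideanSpace ℝ (Fin n)) :
    EuclideanSpace ℝ (Fin n) [⋀^Fin k]→L[ℝ] F :=
  (η ((extChartAt (𝓡 n) x₀).symm y)).compContinuousLinearMap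
    (mfderiv 𝓘(ℝ, EuclideanSpace ℝ (Fin n)) (𝓡 n) (extChartAt (𝓡 n) x₀).symm y)

/-- A form is smooth if its coordinate expressions are. -/
def IsSmoothForm (η : RoughForm n M F k) : Prop :=
  ∀ x₀ : M, ContDiffOn ℝ ∞ (formInChart η x₀) (extChartAt (𝓡 n) x₀).target

/-- The exterior derivative of a form at `x`, computed in the preferred chart at `x`. -/
def formD (η : RoughForm n M F k) (x : M) : TangentSpace (𝓡 n) x [⋀^Fin (k + 1)]→L[ℝ] F :=
  (extDeriv (formInChart η x) (extChartAt (𝓡 n) x x)).compContinuousLinearMap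
    (mfderiv (𝓡 n) 𝓘(ℝ, EuclideanSpace ℝ (Fin n)) (extChartAt (𝓡 n) x) x)

end Forms

/-! ### Mean curvature of an immersion -/

/-- The `i`-th standard basis vector of `ℝⁿ`. -/
def stdVec {n : ℕ} (i : Fin n) : EuclideanSpace ℝ (Fin n) := EuclideanSpace.single i 1

/-- The Christoffel symbols `Γ^k_{ij}` of the metric `(G_{ij})` on (a part of) `ℝⁿ`. -/
def christoffel {n : ℕ} (G : EuclideanSpace ℝ (Fin n) → Matrix (Fin n) (Fin n) ℝ)
    (y : EuclideanSpace ℝ (Fin n)) (k i j : Fin n) : ℝ :=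
  (1 / 2) * ∑ l, (G y)⁻¹ k l * (fderiv ℝ (fun z => G z j l) y (stdVec i) +
    fderiv ℝ (fun z => G z i l) y (stdVec j) - fderiv ℝ (fun z => G z i j) y (stdVec l))

section CoordMeanCurvature

variable {m n : ℕ} (G : EuclideanSpace ℝ (Fin n) → Matrix (Fin n) (Fin n) ℝ)
  (Φ : EuclideanSpace ℝ (Fin m) → EuclideanSpace ℝ (Fin n)) (y : EuclideanSpace ℝ (Fin m))

/-- The first fundamental form `h_{ab} = G(∂_a Φ, ∂_b Φ)`. -/
def inducedMetric : Matrix (Fin m) (Fin m) ℝ := Matrix.of fun a b =>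
  ∑ i, ∑ j, G (Φ y) i j * fderiv ℝ Φ y (stdVec a) i * fderiv ℝ Φ y (stdVec b) j

/-- The components of the covariant derivative
`∇_a ∂_b Φ = ∂_a ∂_b Φ + Γ(∂_a Φ, ∂_b Φ)` for the Levi-Civita connection of `G`. -/
def covHessian (a b : Fin m) (k : Fin n) : ℝ :=
  fderiv ℝ (fun z => fderiv ℝ Φ z (stdVec b)) y (stdVec a) k +
    ∑ i, ∑ j, christoffel G (Φ y) k i j * fderiv ℝ Φ y (stdVec a) i * fderiv ℝ Φ y (stdVec b) j

/-- The normal part of a vector `Z` at `Φ y`. -/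
def normalPart (Z : Fin n → ℝ) (k : Fin n) : ℝ :=
  Z k - ∑ a, ∑ b, (inducedMetric G Φ y)⁻¹ a b *
    (∑ i, ∑ j, G (Φ y) i j * Z i * fderiv ℝ Φ y (stdVec a) j) * fderiv ℝ Φ y (stdVec b) k

/-- The mean curvature vector of `Φ`: the trace `h^{ab} (∇_a ∂_b Φ)^⊥` of the second fundamental
form. -/
def coordMeanCurvature : EuclideanSpace ℝ (Fin n) :=
  WithLp.toLp 2 fun k => ∑ a, ∑ b, (inducedMetric G Φ y)⁻¹ a b *
    normalPart G Φ y (fun k => covHessian G Φ y a b k) k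

end CoordMeanCurvature

section MeanCurvature

variable (m : ℕ) {n : ℕ} {M : Type*} [TopologicalSpace M] [ChartedSpace (EuclideanSpace ℝ (Fin n)) M]
  {L : Type*} [TopologicalSpace L] [ChartedSpace (EuclideanSpace ℝ (Fin m)) L]

/-- The components `G_{ij}` of a metric in the preferred chart at `x₀`. -/
def metricInChart (g : (x : M) → TangentSpace (𝓡 n) x → TangentSpace (𝓡 n) x → ℝ) (x₀ : M)
    (y : EuclideanSpace ℝ (Fin n)) : Matrix (Fin n) (Fin n) ℝ := Matrix.of fun i j =>
  g ((extChartAt (𝓡 n) x₀).symm y)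
    (mfderiv 𝓘(ℝ, EuclideanSpace ℝ (Fin n)) (𝓡 n) (extChartAt (𝓡 n) x₀).symm y (stdVec i))
    (mfderiv 𝓘(ℝ, EuclideanSpace ℝ (Fin n)) (𝓡 n) (extChartAt (𝓡 n) x₀).symm y (stdVec j))

/-- The mean curvature vector (the trace of the second fundamental form) at `p` of an immersion `f`
into a manifold with Riemannian metric `g`, computed in the preferred charts at `p` and `f p`. -/
def meanCurvature (g : (x : M) → TangentSpace (𝓡 n) x → TangentSpace (𝓡 n) x → ℝ) (f : L → M)
    (p : L) : TangentSpace (𝓡 n) (f p) :=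
  (mfderiv 𝓘(ℝ, EuclideanSpace ℝ (Fin n)) (𝓡 n) (extChartAt (𝓡 n) (f p)).symm
      (extChartAt (𝓡 n) (f p) (f p)) :
      EuclideanSpace ℝ (Fin n) →L[ℝ] EuclideanSpace ℝ (Fin n))
    (coordMeanCurvature (metricInChart g (f p))
      (extChartAt (𝓡 n) (f p) ∘ f ∘ (extChartAt (𝓡 m) p).symm) (extChartAt (𝓡 m) p p))

end MeanCurvature

/-! ### SU(3)-structures -/

/-- An `SU(3)`-structure on a smooth six-manifold: smooth forms `Ω` and `Υ` that are at each point
identified with `Ω₀` and `Υ₀` by some linear coframe. -/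
structure SU3Structure (M : Type*) [TopologicalSpace M]
    [ChartedSpace (EuclideanSpace ℝ (Fin 6)) M] where
  Omega : RoughForm 6 M ℝ 2
  Upsilon : RoughForm 6 M ℂ 3
  smooth_Omega : IsSmoothForm Omega
  smooth_Upsilon : IsSmoothForm Upsilon
  exists_coframe : ∀ x : M, ∃ c : TangentSpace (𝓡 6) x ≃L[ℝ] ModelV,
    Omega x = modelOmega.compContinuousLinearMap (c : TangentSpace (𝓡 6) x →L[ℝ] ModelV) ∧
    Upsilon x = modelUpsilon.compContinuousLinearMap (c : TangentSpace (𝓡 6) x →L[ℝ] ModelV)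

/-- The seven torsion forms at a point with tangent space `T`; `τ0'` and `τ2'` are the hatted ones. -/
structure TorsionForms (T : Type*) [AddCommGroup T] [Module ℝ T] [TopologicalSpace T] where
  τ0 : ℝ
  τ0' : ℝ
  τ2 : T [⋀^Fin 2]→ₗ[ℝ] ℝ
  τ2' : T [⋀^Fin 2]→ₗ[ℝ] ℝ
  τ3 : T [⋀^Fin 3]→ₗ[ℝ] ℝ
  τ4 : T →L[ℝ] ℝ
  τ5 : T →L[ℝ] ℝ

/-- The labels of the seven summands `X₀⁺, X₀⁻, X₂⁺, X₂⁻, X₃, X₄, X₅` of the torsion bundle. -/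
inductive TorsionLabel where
  | X0plus | X0minus | X2plus | X2minus | X3 | X4 | X5

/-- The vanishing of the component with a given label. -/
def TorsionForms.Vanishes {T : Type*} [AddCommGroup T] [Module ℝ T] [TopologicalSpace T]
    (τ : TorsionForms T) : TorsionLabel → Prop
  | .X0plus => τ.τ0 = 0
  | .X0minus => τ.τ0' = 0
  | .X2plus => τ.τ2 = 0
  | .X2minus => τ.τ2' = 0
  | .X3 => τ.τ3 = 0
  | .X4 => τ.τ4 = 0
  | .X5 => τ.τ5 = 0

namespace SU3Structure

variable {M : Type*} [TopologicalSpace M] [ChartedSpace (EuclideanSpace ℝ (Fin 6)) M]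
  (S : SU3Structure M)

/-- An `SU(3)`-coframe at `x`. -/
def IsCoframe (x : M) (c : TangentSpace (𝓡 6) x ≃L[ℝ] ModelV) : Prop :=
  S.Omega x = modelOmega.compContinuousLinearMap (c : TangentSpace (𝓡 6) x →L[ℝ] ModelV) ∧
  S.Upsilon x = modelUpsilon.compContinuousLinearMap (c : TangentSpace (𝓡 6) x →L[ℝ] ModelV)

/-- Some `SU(3)`-coframe at `x`. -/
def coframe (x : M) : TangentSpace (𝓡 6) x ≃L[ℝ] ModelV := (S.exists_coframe x).choose

theorem isCoframe_coframe (x : M) : S.IsCoframe x (S.coframe x) := (S.exists_coframe x).choose_spec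

/-- The almost complex structure. It corresponds to `J₀` under every `SU(3)`-coframe: see
`J_eq_of_isCoframe`. -/
def J (x : M) : TangentSpace (𝓡 6) x →L[ℝ] TangentSpace (𝓡 6) x :=
  ((S.coframe x).symm : ModelV →L[ℝ] TangentSpace (𝓡 6) x).comp
    (modelJ.comp (S.coframe x : TangentSpace (𝓡 6) x →L[ℝ] ModelV))

/-- The Riemannian metric. It corresponds to the Euclidean inner product under every
`SU(3)`-coframe: see `metric_eq_of_isCoframe`. -/
def metric (x : M) (X Y : TangentSpace (𝓡 6) x) : ℝ := inner ℝ (S.coframe x X) (S.coframe x Y)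

variable {S} in
theorem J_eq_of_isCoframe {x : M} {c : TangentSpace (𝓡 6) x ≃L[ℝ] ModelV} (hc : S.IsCoframe x c)
    (X : TangentSpace (𝓡 6) x) : S.J x X = c.symm (modelJ (c X)) := by
  have key : ∀ (c : TangentSpace (𝓡 6) x ≃L[ℝ] ModelV), S.IsCoframe x c → ∀ X Y Z,
      S.Upsilon x ![X, Y, Z] = modelUpsilon ![c X, c Y, c Z] := by
    intro c hc X Y Z
    rw [hc.2]
    change modelUpsilon _ = _
    congr 1
    ext a : 1
    fin_cases a <;> rfl
  have key2 : ∀ (c : TangentSpace (𝓡 6) x ≃L[ℝ] ModelV), S.IsCoframe x c → ∀ X Y Z,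
      S.Upsilon x ![c.symm (modelJ (c X)), Y, Z] = Complex.I * S.Upsilon x ![X, Y, Z] := by
    intro c hc X Y Z
    rw [key c hc, key c hc, c.apply_symm_apply, modelUpsilon_modelJ]
  have h0 := S.isCoframe_coframe x
  have hJ : S.J x X = (S.coframe x).symm (modelJ (S.coframe x X)) := rfl
  rw [← sub_eq_zero, ← c.map_eq_zero_iff]
  refine eq_zero_of_modelUpsilon _ fun Y Z => ?_
  have e := key c hc (S.J x X - c.symm (modelJ (c X))) (c.symm Y) (c.symm Z)
  rw [c.apply_symm_apply, c.apply_symm_apply] at e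
  rw [← e]
  have lin : ∀ A B : TangentSpace (𝓡 6) x, S.Upsilon x ![A - B, c.symm Y, c.symm Z] =
      S.Upsilon x ![A, c.symm Y, c.symm Z] - S.Upsilon x ![B, c.symm Y, c.symm Z] := by
    intro A B
    have h := (S.Upsilon x).map_update_sub ![A, c.symm Y, c.symm Z] 0 A B
    have u : ∀ D : TangentSpace (𝓡 6) x, Function.update ![A, c.symm Y, c.symm Z] 0 D =
        ![D, c.symm Y, c.symm Z] := by
      intro D
      ext a : 1
      fin_cases a <;> simp
    rwa [u, u, u] at h
  rw [lin, hJ, key2 _ h0, key2 _ hc, sub_self]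

variable {S} in
theorem metric_eq_of_isCoframe {x : M} {c : TangentSpace (𝓡 6) x ≃L[ℝ] ModelV}
    (hc : S.IsCoframe x c) (X Y : TangentSpace (𝓡 6) x) :
    S.metric x X Y = inner ℝ (c X) (c Y) := by
  have key : ∀ (c : TangentSpace (𝓡 6) x ≃L[ℝ] ModelV), S.IsCoframe x c → ∀ X Y,
      S.Omega x ![X, S.J x Y] = inner ℝ (c X) (c Y) := by
    intro c hc X Y
    rw [← modelOmega_modelJ, hc.1, J_eq_of_isCoframe hc]
    change modelOmega _ = _
    congr 1
    ext a : 1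
    fin_cases a
    · rfl
    · exact c.apply_symm_apply _
  rw [← key c hc, key _ (S.isCoframe_coframe x)]
  rfl

/-- The form `Re Υ`. -/
def reUpsilon : RoughForm 6 M ℝ 3 := fun x =>
  Complex.reCLM.compContinuousAlternatingMap (S.Upsilon x)

/-- The form `Im Υ`. -/
def imUpsilon : RoughForm 6 M ℝ 3 := fun x =>
  Complex.imCLM.compContinuousAlternatingMap (S.Upsilon x)

/-- `Λ²₈`, the primitive `(1,1)`-forms: `β ∧ Re Υ = 0` and `β ∧ Ω ∧ Ω = 0`. -/
def IsLambdaTwoEight (x : M) (β : TangentSpace (𝓡 6) x [⋀^Fin 2]→ₗ[ℝ] ℝ) : Prop :=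
  wedge β (S.reUpsilon x).toAlternatingMap = 0 ∧
  wedge (wedge β (S.Omega x).toAlternatingMap) (S.Omega x).toAlternatingMap = 0

/-- `Λ³₁₂`: the forms `γ` with `γ ∧ Ω = 0`, `γ ∧ Re Υ = 0` and `γ ∧ Im Υ = 0`. -/
def IsLambdaThreeTwelve (x : M) (γ : TangentSpace (𝓡 6) x [⋀^Fin 3]→ₗ[ℝ] ℝ) : Prop :=
  wedge γ (S.Omega x).toAlternatingMap = 0 ∧
  wedge γ (S.reUpsilon x).toAlternatingMap = 0 ∧
  wedge γ (S.imUpsilon x).toAlternatingMap = 0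

/-- The defining equations of the torsion forms at `x`:
`dΩ = 3 τ0 Re Υ + 3 τ0' Im Υ + τ3 + τ4 ∧ Ω`,
`d Re Υ = 2 τ0' Ω² + τ5 ∧ Re Υ + τ2 ∧ Ω` and
`d Im Υ = -2 τ0 Ω² + (τ5 ∘ J) ∧ Re Υ + τ2' ∧ Ω`,
with `τ2, τ2'` in `Λ²₈` and `τ3` in `Λ³₁₂`. -/
structure IsTorsion (x : M) (τ : TorsionForms (TangentSpace (𝓡 6) x)) : Prop where
  mem_τ2 : S.IsLambdaTwoEight x τ.τ2
  mem_τ2' : S.IsLambdaTwoEight x τ.τ2'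
  mem_τ3 : S.IsLambdaThreeTwelve x τ.τ3
  d_Omega : (formD S.Omega x).toAlternatingMap =
    (3 * τ.τ0) • (S.reUpsilon x).toAlternatingMap + (3 * τ.τ0') • (S.imUpsilon x).toAlternatingMap +
      τ.τ3 + wedge (oneForm τ.τ4) (S.Omega x).toAlternatingMap
  d_re : (formD S.reUpsilon x).toAlternatingMap =
    (2 * τ.τ0') • wedge (S.Omega x).toAlternatingMap (S.Omega x).toAlternatingMap +
      wedge (oneForm τ.τ5) (S.reUpsilon x).toAlternatingMap +
      wedge τ.τ2 (S.Omega x).toAlternatingMap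
  d_im : (formD S.imUpsilon x).toAlternatingMap =
    (-2 * τ.τ0) • wedge (S.Omega x).toAlternatingMap (S.Omega x).toAlternatingMap +
      wedge (oneForm (τ.τ5.comp (S.J x))) (S.reUpsilon x).toAlternatingMap +
      wedge τ.τ2' (S.Omega x).toAlternatingMap

/-- An `SU(3)`-structure belongs to the torsion class `C`, a direct sum of some of the seven
summands, if all other components of its torsion vanish identically. -/
def InClass (C : Set TorsionLabel) : Prop :=
  ∀ x : M, ∃ τ : TorsionForms (TangentSpace (𝓡 6) x), S.IsTorsion x τ ∧ ∀ l ∉ C, τ.Vanishes l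

section Immersions

variable {L : Type*} [TopologicalSpace L] [ChartedSpace (EuclideanSpace ℝ (Fin 3)) L]

/-- `f : L → M` is an immersed special Lagrangian three-fold of phase `θ`: a smooth immersion such
that `Ω` and `Im (e^{-iθ} Υ)` vanish on the tangent spaces of `L`. -/
structure IsSpecialLagrangian (θ : ℝ) (f : L → M) : Prop where
  smooth : ContMDiff (𝓡 3) (𝓡 6) ∞ f
  immersion : ∀ p : L, Function.Injective (mfderiv (𝓡 3) (𝓡 6) f p)
  lagrangian : ∀ (p : L) (X : Fin 2 → TangentSpace (𝓡 3) p),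
    S.Omega (f p) (fun i => mfderiv (𝓡 3) (𝓡 6) f p (X i)) = 0
  phase : ∀ (p : L) (X : Fin 3 → TangentSpace (𝓡 3) p),
    (Complex.exp (-(θ * Complex.I)) *
      S.Upsilon (f p) (fun i => mfderiv (𝓡 3) (𝓡 6) f p (X i))).im = 0

/-- An `SU(3)`-coframe at `f p` that is adapted to `L`: it takes the tangent space of `L` to
`span(v_1(θ), v_2(θ), v_3(θ))`. -/
def IsAdaptedCoframe (θ : ℝ) (f : L → M) (p : L) (c : TangentSpace (𝓡 6) (f p) ≃L[ℝ] ModelV) :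
    Prop :=
  S.IsCoframe (f p) c ∧
    Set.range (fun X : TangentSpace (𝓡 3) p => c (mfderiv (𝓡 3) (𝓡 6) f p X)) =
      (Submodule.span ℝ (Set.range (vVec θ)) : Set ModelV)

end Immersions

end SU3Structure

/-- The property of a torsion class `C`: for all `SU(3)`-structures of class `C`, on all
six-manifolds, all special Lagrangian three-folds, of all phases, are minimal. -/
def IsMinimalClass (C : Set TorsionLabel) : Prop :=
  ∀ (M : Type) [TopologicalSpace M] [ChartedSpace (EuclideanSpace ℝ (Fin 6)) M]
    [IsManifold (𝓡 6) ∞ M] [T2Space M] [SecondCountableTopology M]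
    (L : Type) [TopologicalSpace L] [ChartedSpace (EuclideanSpace ℝ (Fin 3)) L]
    [IsManifold (𝓡 3) ∞ L] [T2Space L] [SecondCountableTopology L]
    (S : SU3Structure M) (θ : ℝ) (f : L → M),
    S.InClass C → S.IsSpecialLagrangian θ f → ∀ p : L, meanCurvature 3 S.metric f p = 0

end

/-! Everything reduces to first-order identities at one point, read in an `SU(3)`-coframe.

Torsion forms. On the model space the defining equations are linear in 1+1+8+8+12+6+6 = 42 unknowns,
and each unknown is a linear functional of dΩ, d Re Υ, d Im Υ, so there is at most one solution
(`IsModelTorsion.eq_modelTorsion`). The derivatives have 20+15+15 = 50 components, and a solution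
exists as soon as eight scalar relations hold (`TorsionRelations.isModelTorsion`). Two of them come
from differentiating Ω ∧ Re Υ = 0 and Ω ∧ Im Υ = 0. The other six say that dΥ has no part of type
(1,3); this follows by differentiating the Plücker relations, which hold because Υ is decomposable
(`extDeriv_upsilon_type`).

Mean curvature. The form φ = Re(e^{-iθ}Υ) satisfies φ(ξ)² ≤ det⟨ξ_a, ξ_b⟩ for every triple ξ, with
equality on special Lagrangian planes. As φ need not be closed, a calibrated submanifold need not be
minimal; what remains of the classical argument is ⟨H, X⟩ φ(ξ) = -dφ(X, ξ_1, ξ_2, ξ_3) for X normal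
and ξ a tangent frame. Two pieces of information give it
(`bilinOf_coordMeanCurvature_of_calibrated`). Along Σ the equality, polarized in one argument, can
be differentiated; second derivatives of the immersion cancel on the side of φ, because they are
symmetric and φ is alternating. Across Σ the function det - φ² is nonnegative and vanishes at the
point, so its derivative vanishes. The metric is differentiable in a chart because it is recovered
from Ω and Υ (`differentiableAt_inner_of_pullback`). It remains to evaluate cos θ d Re Υ + sin θ d
Im Υ on (w_q, v_1, v_2, v_3), where Ω² contributes nothing and only τ2, τ̂2, τ5 survive
(`IsModelTorsion.apply_wVec_vVec`). Adapted coframes exist because SU(3) acts transitively on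
special Lagrangian planes of a given phase (`exists_frameEquiv`).

Largest class. If τ2, τ̂2, τ5 vanish, the formula gives H = 0. Conversely, keep Ω constant on ℝ⁶ and
pull Υ₀ back by symplectic maps A(λ(z)), where A is a one-parameter family and λ a covector. Then dΩ
= 0 and dΥ = λ ∧ D with D the logarithmic derivative of the pulled back form, and a linear special
Lagrangian plane in λ = 0 on which D has nonzero component of the given phase is not minimal
(`ShearData.not_isMinimalClass`). A unipotent family gives examples whose only torsion is τ2 or τ̂2,
according to the choice of λ, and a diagonal family gives one whose only torsion is τ5. -/

noncomputable section

/-! ### Wedge products as explicit signed sums over shuffles. -/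

section Wedge

open Equiv

variable {E E' : Type*} [AddCommGroup E] [Module ℝ E] [AddCommGroup E'] [Module ℝ E'] {k l : ℕ}

theorem wedge_eq_sum_quotient (α : E [⋀^Fin k]→ₗ[ℝ] ℝ) (β : E [⋀^Fin l]→ₗ[ℝ] ℝ)
    (v : Fin (k + l) → E) : wedge α β v = ∑ σ : Perm.ModSumCongr (Fin k) (Fin l),
      LinearMap.mul' ℝ ℝ (AlternatingMap.domCoprod.summand α β σ (v ∘ finSumFinEquiv)) := by
  change LinearMap.mul' ℝ ℝ ((∑ σ : Perm.ModSumCongr (Fin k) (Fin l),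
    AlternatingMap.domCoprod.summand α β σ) (v ∘ finSumFinEquiv)) = _
  rw [sum_apply, map_sum]

/-- The permutation with given values and given values of the inverse. -/
def permOf {n : ℕ} (f g : Fin n → Fin n) (h : ∀ i, g (f i) = i) (h' : ∀ i, f (g i) = i) :
    Perm (Fin n) := ⟨f, g, h, h'⟩

/-- The wedge product as a sum over a system of representatives `f` of the shuffles, with inverses
`g` and signs `ε`. -/
theorem wedge_eq_sum {N : ℕ} (f g : Fin N → Fin (k + l) → Fin (k + l)) (ε : Fin N → ℤˣ)
    (h : ∀ i j, g i (f i j) = j) (h' : ∀ i j, f i (g i j) = j)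
    (hε : ∀ i, Perm.sign (permOf (f i) (g i) (h i) (h' i)) = ε i)
    (hN : N * (k.factorial * l.factorial) = (k + l).factorial)
    (hp : ∀ i j, (∀ a : Fin k, ∃ b : Fin k, f j (Fin.castAdd l a) = f i (Fin.castAdd l b)) → i = j)
    (α : E [⋀^Fin k]→ₗ[ℝ] ℝ) (β : E [⋀^Fin l]→ₗ[ℝ] ℝ) (v : Fin (k + l) → E) :
    wedge α β v = ∑ i, ((ε i : ℤ) : ℝ) *
      (α (fun a => v (f i (Fin.castAdd l a))) * β (fun a => v (f i (Fin.natAdd k a)))) := by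
  let r : Fin N → Perm.ModSumCongr (Fin k) (Fin l) := fun i =>
    Quotient.mk'' (finSumFinEquiv.symm.permCongr (permOf (f i) (g i) (h i) (h' i)))
  -- Two representatives lie in the same coset of S_k × S_l only if they agree up to a permutation
  -- inside the blocks, so their first blocks are equal as sets; `hp` excludes this for distinct
  -- indices.
  have hr : Function.Injective r := by
    intro i j hij
    obtain ⟨⟨sl, sr⟩, hs⟩ := QuotientGroup.leftRel_apply.mp (Quotient.exact' hij)
    refine hp i j fun a => ⟨sl a, ?_⟩
    have hs := Equiv.congr_fun (inv_mul_eq_iff_eq_mul.mp hs.symm) (Sum.inl a)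
    simpa [Equiv.permCongr_apply, permOf] using hs
  -- By Lagrange's theorem there are (k+l)!/(k! l!) cosets, which is N by `hN`. An injection between
  -- sets of equal size is a bijection, so nothing has to be checked about exhausting the shuffles.
  have hcard : Fintype.card (Fin N) = Fintype.card (Perm.ModSumCongr (Fin k) (Fin l)) := by
    have h1 := Subgroup.card_eq_card_quotient_mul_card_subgroup
      (Equiv.Perm.sumCongrHom (Fin k) (Fin l)).range
    have h2 : Nat.card (Equiv.Perm.sumCongrHom (Fin k) (Fin l)).range =
        k.factorial * l.factorial := by
      rw [Nat.card_eq_fintype_card, Equiv.Perm.sumCongrHom.card_range, Fintype.card_prod,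
        Fintype.card_perm, Fintype.card_perm, Fintype.card_fin, Fintype.card_fin]
    rw [h2, Nat.card_eq_fintype_card, Fintype.card_perm, Fintype.card_sum, Fintype.card_fin,
      Fintype.card_fin, ← hN, Nat.card_eq_fintype_card] at h1
    rw [Fintype.card_fin]
    exact Nat.eq_of_mul_eq_mul_right (by positivity) h1
  have hb : Function.Bijective r := (Fintype.bijective_iff_injective_and_card r).mpr ⟨hr, hcard⟩
  rw [wedge_eq_sum_quotient, ← hb.sum_comp]
  refine Finset.sum_congr rfl fun i _ => ?_
  simp only [r]
  rw [AlternatingMap.domCoprod.summand_mk'', smul_apply, MultilinearMap.domDomCongr_apply,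
    Units.smul_def, map_zsmul, Equiv.Perm.sign_permCongr, hε, zsmul_eq_mul]
  simp [MultilinearMap.domCoprod_apply, Equiv.permCongr_apply, permOf]

/-- Pullback acts on each shuffle term separately. This is what transports all wedge equations
between a tangent space and the model space. -/
theorem wedge_compLinearMap (f : E' →ₗ[ℝ] E) (α : E [⋀^Fin k]→ₗ[ℝ] ℝ) (β : E [⋀^Fin l]→ₗ[ℝ] ℝ) :
    wedge (α.compLinearMap f) (β.compLinearMap f) = (wedge α β).compLinearMap f := by
  ext v
  rw [AlternatingMap.compLinearMap_apply, wedge_eq_sum_quotient, wedge_eq_sum_quotient]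
  refine Finset.sum_congr rfl fun σ _ => ?_
  induction σ using Quotient.inductionOn' with | _ σ
  rfl


theorem comp_eq_vec_one {X Y : Type*} (v : X → Y) (p : Fin 1 → X) :
    (fun a => v (p a)) = ![v (p 0)] := by
  funext a; fin_cases a; rfl

theorem comp_eq_vec_two {X Y : Type*} (v : X → Y) (p : Fin 2 → X) :
    (fun a => v (p a)) = ![v (p 0), v (p 1)] := by
  funext a; fin_cases a <;> rfl

theorem comp_eq_vec_three {X Y : Type*} (v : X → Y) (p : Fin 3 → X) :
    (fun a => v (p a)) = ![v (p 0), v (p 1), v (p 2)] := by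
  funext a; fin_cases a <;> rfl

theorem comp_eq_vec_four {X Y : Type*} (v : X → Y) (p : Fin 4 → X) :
    (fun a => v (p a)) = ![v (p 0), v (p 1), v (p 2), v (p 3)] := by
  funext a; fin_cases a <;> rfl

theorem wedge_one_two (α : E [⋀^Fin 1]→ₗ[ℝ] ℝ) (β : E [⋀^Fin 2]→ₗ[ℝ] ℝ) (v : Fin 3 → E) :
    wedge α β v =
      α ![v 0] * β ![v 1, v 2] - α ![v 1] * β ![v 0, v 2] + α ![v 2] * β ![v 0, v 1] := by
  -- The three tables are the shuffles, their inverses and their signs; the side conditions are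
  -- finite and are decided. The same pattern serves the other degrees below.
  have h := wedge_eq_sum (k := 1) (l := 2) (N := 3)
      ![![0, 1, 2], ![1, 0, 2], ![2, 0, 1]]
      ![![0, 1, 2], ![1, 0, 2], ![1, 2, 0]]
      ![1, -1, 1]
      (by decide) (by decide) (by decide +kernel) (by decide) (by decide +kernel) α β v
  rw [h]
  simp only [comp_eq_vec_one v, comp_eq_vec_two v]
  simp [Fin.sum_univ_succ]
  ring

theorem wedge_one_three (α : E [⋀^Fin 1]→ₗ[ℝ] ℝ) (β : E [⋀^Fin 3]→ₗ[ℝ] ℝ) (v : Fin 4 → E) :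
    wedge α β v =
      α ![v 0] * β ![v 1, v 2, v 3] - α ![v 1] * β ![v 0, v 2, v 3]
      + α ![v 2] * β ![v 0, v 1, v 3] - α ![v 3] * β ![v 0, v 1, v 2] := by
  have h := wedge_eq_sum (k := 1) (l := 3) (N := 4)
      ![![0, 1, 2, 3], ![1, 0, 2, 3], ![2, 0, 1, 3], ![3, 0, 1, 2]]
      ![![0, 1, 2, 3], ![1, 0, 2, 3], ![1, 2, 0, 3], ![1, 2, 3, 0]]
      ![1, -1, 1, -1]
      (by decide) (by decide) (by decide +kernel) (by decide) (by decide +kernel) α β v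
  rw [h]
  simp only [comp_eq_vec_one v, comp_eq_vec_three v]
  simp [Fin.sum_univ_succ]
  ring

theorem wedge_two_two (α : E [⋀^Fin 2]→ₗ[ℝ] ℝ) (β : E [⋀^Fin 2]→ₗ[ℝ] ℝ) (v : Fin 4 → E) :
    wedge α β v =
      α ![v 0, v 1] * β ![v 2, v 3] - α ![v 0, v 2] * β ![v 1, v 3]
      + α ![v 0, v 3] * β ![v 1, v 2] + α ![v 1, v 2] * β ![v 0, v 3]
      - α ![v 1, v 3] * β ![v 0, v 2] + α ![v 2, v 3] * β ![v 0, v 1] := by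
  have h := wedge_eq_sum (k := 2) (l := 2) (N := 6)
      ![![0, 1, 2, 3], ![0, 2, 1, 3], ![0, 3, 1, 2], ![1, 2, 0, 3], ![1, 3, 0, 2], ![2, 3, 0, 1]]
      ![![0, 1, 2, 3], ![0, 2, 1, 3], ![0, 2, 3, 1], ![2, 0, 1, 3], ![2, 0, 3, 1], ![2, 3, 0, 1]]
      ![1, -1, 1, 1, -1, 1]
      (by decide) (by decide) (by decide +kernel) (by decide) (by decide +kernel) α β v
  rw [h]
  simp only [comp_eq_vec_two v, comp_eq_vec_two v]
  simp [Fin.sum_univ_succ]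
  ring

theorem wedge_two_three (α : E [⋀^Fin 2]→ₗ[ℝ] ℝ) (β : E [⋀^Fin 3]→ₗ[ℝ] ℝ) (v : Fin 5 → E) :
    wedge α β v =
      α ![v 0, v 1] * β ![v 2, v 3, v 4] - α ![v 0, v 2] * β ![v 1, v 3, v 4]
      + α ![v 0, v 3] * β ![v 1, v 2, v 4] - α ![v 0, v 4] * β ![v 1, v 2, v 3]
      + α ![v 1, v 2] * β ![v 0, v 3, v 4] - α ![v 1, v 3] * β ![v 0, v 2, v 4]
      + α ![v 1, v 4] * β ![v 0, v 2, v 3] + α ![v 2, v 3] * β ![v 0, v 1, v 4]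
      - α ![v 2, v 4] * β ![v 0, v 1, v 3] + α ![v 3, v 4] * β ![v 0, v 1, v 2] := by
  have h := wedge_eq_sum (k := 2) (l := 3) (N := 10)
      ![![0, 1, 2, 3, 4], ![0, 2, 1, 3, 4], ![0, 3, 1, 2, 4], ![0, 4, 1, 2, 3], ![1, 2, 0, 3, 4],
      ![1, 3, 0, 2, 4], ![1, 4, 0, 2, 3], ![2, 3, 0, 1, 4], ![2, 4, 0, 1, 3], ![3, 4, 0, 1, 2]]
      ![![0, 1, 2, 3, 4], ![0, 2, 1, 3, 4], ![0, 2, 3, 1, 4], ![0, 2, 3, 4, 1], ![2, 0, 1, 3, 4],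
      ![2, 0, 3, 1, 4], ![2, 0, 3, 4, 1], ![2, 3, 0, 1, 4], ![2, 3, 0, 4, 1], ![2, 3, 4, 0, 1]]
      ![1, -1, 1, -1, 1, -1, 1, 1, -1, 1]
      (by decide) (by decide) (by decide +kernel) (by decide) (by decide +kernel) α β v
  rw [h]
  simp only [comp_eq_vec_two v, comp_eq_vec_three v]
  simp [Fin.sum_univ_succ]
  ring

theorem wedge_three_two (α : E [⋀^Fin 3]→ₗ[ℝ] ℝ) (β : E [⋀^Fin 2]→ₗ[ℝ] ℝ) (v : Fin 5 → E) :
    wedge α β v =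
      α ![v 0, v 1, v 2] * β ![v 3, v 4] - α ![v 0, v 1, v 3] * β ![v 2, v 4]
      + α ![v 0, v 1, v 4] * β ![v 2, v 3] + α ![v 0, v 2, v 3] * β ![v 1, v 4]
      - α ![v 0, v 2, v 4] * β ![v 1, v 3] + α ![v 0, v 3, v 4] * β ![v 1, v 2]
      - α ![v 1, v 2, v 3] * β ![v 0, v 4] + α ![v 1, v 2, v 4] * β ![v 0, v 3]
      - α ![v 1, v 3, v 4] * β ![v 0, v 2] + α ![v 2, v 3, v 4] * β ![v 0, v 1] := by
  have h := wedge_eq_sum (k := 3) (l := 2) (N := 10)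
      ![![0, 1, 2, 3, 4], ![0, 1, 3, 2, 4], ![0, 1, 4, 2, 3], ![0, 2, 3, 1, 4], ![0, 2, 4, 1, 3],
      ![0, 3, 4, 1, 2], ![1, 2, 3, 0, 4], ![1, 2, 4, 0, 3], ![1, 3, 4, 0, 2], ![2, 3, 4, 0, 1]]
      ![![0, 1, 2, 3, 4], ![0, 1, 3, 2, 4], ![0, 1, 3, 4, 2], ![0, 3, 1, 2, 4], ![0, 3, 1, 4, 2],
      ![0, 3, 4, 1, 2], ![3, 0, 1, 2, 4], ![3, 0, 1, 4, 2], ![3, 0, 4, 1, 2], ![3, 4, 0, 1, 2]]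
      ![1, -1, 1, 1, -1, 1, -1, 1, -1, 1]
      (by decide) (by decide) (by decide +kernel) (by decide) (by decide +kernel) α β v
  rw [h]
  simp only [comp_eq_vec_three v, comp_eq_vec_two v]
  simp [Fin.sum_univ_succ]
  ring

theorem wedge_three_three (α : E [⋀^Fin 3]→ₗ[ℝ] ℝ) (β : E [⋀^Fin 3]→ₗ[ℝ] ℝ) (v : Fin 6 → E) :
    wedge α β v =
      α ![v 0, v 1, v 2] * β ![v 3, v 4, v 5] - α ![v 0, v 1, v 3] * β ![v 2, v 4, v 5]
      + α ![v 0, v 1, v 4] * β ![v 2, v 3, v 5] - α ![v 0, v 1, v 5] * β ![v 2, v 3, v 4]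
      + α ![v 0, v 2, v 3] * β ![v 1, v 4, v 5] - α ![v 0, v 2, v 4] * β ![v 1, v 3, v 5]
      + α ![v 0, v 2, v 5] * β ![v 1, v 3, v 4] + α ![v 0, v 3, v 4] * β ![v 1, v 2, v 5]
      - α ![v 0, v 3, v 5] * β ![v 1, v 2, v 4] + α ![v 0, v 4, v 5] * β ![v 1, v 2, v 3]
      - α ![v 1, v 2, v 3] * β ![v 0, v 4, v 5] + α ![v 1, v 2, v 4] * β ![v 0, v 3, v 5]
      - α ![v 1, v 2, v 5] * β ![v 0, v 3, v 4] - α ![v 1, v 3, v 4] * β ![v 0, v 2, v 5]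
      + α ![v 1, v 3, v 5] * β ![v 0, v 2, v 4] - α ![v 1, v 4, v 5] * β ![v 0, v 2, v 3]
      + α ![v 2, v 3, v 4] * β ![v 0, v 1, v 5] - α ![v 2, v 3, v 5] * β ![v 0, v 1, v 4]
      + α ![v 2, v 4, v 5] * β ![v 0, v 1, v 3] - α ![v 3, v 4, v 5] * β ![v 0, v 1, v 2] := by
  have h := wedge_eq_sum (k := 3) (l := 3) (N := 20)
      ![![0, 1, 2, 3, 4, 5], ![0, 1, 3, 2, 4, 5], ![0, 1, 4, 2, 3, 5], ![0, 1, 5, 2, 3, 4],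
      ![0, 2, 3, 1, 4, 5], ![0, 2, 4, 1, 3, 5], ![0, 2, 5, 1, 3, 4], ![0, 3, 4, 1, 2, 5],
      ![0, 3, 5, 1, 2, 4], ![0, 4, 5, 1, 2, 3], ![1, 2, 3, 0, 4, 5], ![1, 2, 4, 0, 3, 5],
      ![1, 2, 5, 0, 3, 4], ![1, 3, 4, 0, 2, 5], ![1, 3, 5, 0, 2, 4], ![1, 4, 5, 0, 2, 3],
      ![2, 3, 4, 0, 1, 5], ![2, 3, 5, 0, 1, 4], ![2, 4, 5, 0, 1, 3], ![3, 4, 5, 0, 1, 2]]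
      ![![0, 1, 2, 3, 4, 5], ![0, 1, 3, 2, 4, 5], ![0, 1, 3, 4, 2, 5], ![0, 1, 3, 4, 5, 2],
      ![0, 3, 1, 2, 4, 5], ![0, 3, 1, 4, 2, 5], ![0, 3, 1, 4, 5, 2], ![0, 3, 4, 1, 2, 5],
      ![0, 3, 4, 1, 5, 2], ![0, 3, 4, 5, 1, 2], ![3, 0, 1, 2, 4, 5], ![3, 0, 1, 4, 2, 5],
      ![3, 0, 1, 4, 5, 2], ![3, 0, 4, 1, 2, 5], ![3, 0, 4, 1, 5, 2], ![3, 0, 4, 5, 1, 2],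
      ![3, 4, 0, 1, 2, 5], ![3, 4, 0, 1, 5, 2], ![3, 4, 0, 5, 1, 2], ![3, 4, 5, 0, 1, 2]]
      ![1, -1, 1, -1, 1, -1, 1, 1, -1, 1, -1, 1, -1, -1, 1, -1, 1, -1, 1, -1]
      (by decide) (by decide) (by decide +kernel) (by decide) (by decide +kernel) α β v
  rw [h]
  simp only [comp_eq_vec_three v, comp_eq_vec_three v]
  simp [Fin.sum_univ_succ]
  ring

theorem wedge_four_two (α : E [⋀^Fin 4]→ₗ[ℝ] ℝ) (β : E [⋀^Fin 2]→ₗ[ℝ] ℝ) (v : Fin 6 → E) :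
    wedge α β v =
      α ![v 0, v 1, v 2, v 3] * β ![v 4, v 5] - α ![v 0, v 1, v 2, v 4] * β ![v 3, v 5]
      + α ![v 0, v 1, v 2, v 5] * β ![v 3, v 4] + α ![v 0, v 1, v 3, v 4] * β ![v 2, v 5]
      - α ![v 0, v 1, v 3, v 5] * β ![v 2, v 4] + α ![v 0, v 1, v 4, v 5] * β ![v 2, v 3]
      - α ![v 0, v 2, v 3, v 4] * β ![v 1, v 5] + α ![v 0, v 2, v 3, v 5] * β ![v 1, v 4]
      - α ![v 0, v 2, v 4, v 5] * β ![v 1, v 3] + α ![v 0, v 3, v 4, v 5] * β ![v 1, v 2]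
      + α ![v 1, v 2, v 3, v 4] * β ![v 0, v 5] - α ![v 1, v 2, v 3, v 5] * β ![v 0, v 4]
      + α ![v 1, v 2, v 4, v 5] * β ![v 0, v 3] - α ![v 1, v 3, v 4, v 5] * β ![v 0, v 2]
      + α ![v 2, v 3, v 4, v 5] * β ![v 0, v 1] := by
  have h := wedge_eq_sum (k := 4) (l := 2) (N := 15)
      ![![0, 1, 2, 3, 4, 5], ![0, 1, 2, 4, 3, 5], ![0, 1, 2, 5, 3, 4], ![0, 1, 3, 4, 2, 5],
      ![0, 1, 3, 5, 2, 4], ![0, 1, 4, 5, 2, 3], ![0, 2, 3, 4, 1, 5], ![0, 2, 3, 5, 1, 4],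
      ![0, 2, 4, 5, 1, 3], ![0, 3, 4, 5, 1, 2], ![1, 2, 3, 4, 0, 5], ![1, 2, 3, 5, 0, 4],
      ![1, 2, 4, 5, 0, 3], ![1, 3, 4, 5, 0, 2], ![2, 3, 4, 5, 0, 1]]
      ![![0, 1, 2, 3, 4, 5], ![0, 1, 2, 4, 3, 5], ![0, 1, 2, 4, 5, 3], ![0, 1, 4, 2, 3, 5],
      ![0, 1, 4, 2, 5, 3], ![0, 1, 4, 5, 2, 3], ![0, 4, 1, 2, 3, 5], ![0, 4, 1, 2, 5, 3],
      ![0, 4, 1, 5, 2, 3], ![0, 4, 5, 1, 2, 3], ![4, 0, 1, 2, 3, 5], ![4, 0, 1, 2, 5, 3],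
      ![4, 0, 1, 5, 2, 3], ![4, 0, 5, 1, 2, 3], ![4, 5, 0, 1, 2, 3]]
      ![1, -1, 1, 1, -1, 1, -1, 1, -1, 1, 1, -1, 1, -1, 1]
      (by decide) (by decide) (by decide +kernel) (by decide) (by decide +kernel) α β v
  rw [h]
  simp only [comp_eq_vec_four v, comp_eq_vec_two v]
  simp [Fin.sum_univ_succ]
  ring

end Wedge

/-! ### Components of forms in the standard frame. -/

section ModelForms

/-- An alternating map is determined by its values on increasing tuples of basis vectors. -/
theorem AlternatingMap.ext_strictMono {E : Type*} [AddCommGroup E] [Module ℝ E] {n k : ℕ}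
    (e : Module.Basis (Fin n) ℝ E) {f g : E [⋀^Fin k]→ₗ[ℝ] ℝ}
    (h : ∀ v : Fin k → Fin n, StrictMono v → f (fun i => e (v i)) = g (fun i => e (v i))) :
    f = g := by
  refine e.ext_alternating fun v hv => ?_
  have hs : StrictMono (v ∘ Tuple.sort v) :=
    (Tuple.monotone_sort v).strictMono_of_injective (hv.comp (Tuple.sort v).injective)
  have h1 := h _ hs
  have h2 := f.map_perm (fun i => e (v i)) (Tuple.sort v)
  have h3 := g.map_perm (fun i => e (v i)) (Tuple.sort v)
  simp only [Function.comp_def] at h1 h2 h3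
  rw [h2, h3] at h1
  exact smul_left_cancel _ h1

/-- The standard basis of the model space, indexed by `Fin 6`. -/
def stdBasis : Module.Basis (Fin 6) ℝ ModelV :=
  (EuclideanSpace.basisFun (Fin 3 ⊕ Fin 3) ℝ).toBasis.reindex finSumFinEquiv

/-- The standard basis vectors of the model space, indexed by `Fin 6`. -/
def stdFrame : Fin 6 → ModelV :=
  ![basisVec (Sum.inl 0), basisVec (Sum.inl 1), basisVec (Sum.inl 2),
    basisVec (Sum.inr 0), basisVec (Sum.inr 1), basisVec (Sum.inr 2)]

theorem stdBasis_eq (i : Fin 6) : stdBasis i = stdFrame i := by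
  fin_cases i <;> simp [stdBasis, stdFrame, basisVec] <;> rfl

/-- An alternating map on the model space is determined by its values on increasing tuples of
standard basis vectors. -/
theorem ext_stdFrame {k : ℕ} {f g : ModelV [⋀^Fin k]→ₗ[ℝ] ℝ}
    (h : ∀ v : Fin k → Fin 6, StrictMono v →
      f (fun i => stdFrame (v i)) = g (fun i => stdFrame (v i))) : f = g := by
  refine AlternatingMap.ext_strictMono stdBasis fun v hv => ?_
  simpa only [stdBasis_eq] using h v hv

/-- The form `Ω₀`, without its continuity. -/
def omegaForm : ModelV [⋀^Fin 2]→ₗ[ℝ] ℝ := modelOmega.toAlternatingMap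

/-- The form `Re Υ₀`. -/
def reForm : ModelV [⋀^Fin 3]→ₗ[ℝ] ℝ :=
  (Complex.reCLM.compContinuousAlternatingMap modelUpsilon).toAlternatingMap

/-- The form `Im Υ₀`. -/
def imForm : ModelV [⋀^Fin 3]→ₗ[ℝ] ℝ :=
  (Complex.imCLM.compContinuousAlternatingMap modelUpsilon).toAlternatingMap

/-- An explicit list of increasing tuples turns an equality of forms into a finite conjunction of
scalar equations that can be split mechanically; the final decision checks that the list contains
all increasing tuples. -/
theorem ext_twoForm {f g : ModelV [⋀^Fin 2]→ₗ[ℝ] ℝ} (h : ∀ t ∈ (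
     [(0, 1), (0, 2), (0, 3), (0, 4), (0, 5), (1, 2), (1, 3), (1, 4), (1, 5), (2, 3), (2, 4),
      (2, 5), (3, 4), (3, 5), (4, 5)] : List (Fin 6 × Fin 6)),
    f ![stdFrame t.1, stdFrame t.2] =
      g ![stdFrame t.1, stdFrame t.2]) : f = g := by
  refine ext_stdFrame fun v hv => ?_
  have h0 : v 0 < v 1 := hv (by decide)
  have hv' : (fun i => stdFrame (v i)) = ![stdFrame (v 0), stdFrame (v 1)] := by
    funext i; fin_cases i <;> rfl
  rw [hv']
  refine h (v 0, v 1) ?_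
  generalize v 0 = a0 at *
  generalize v 1 = a1 at *
  clear hv hv' h
  revert a0 a1
  decide +kernel

theorem ext_threeForm {f g : ModelV [⋀^Fin 3]→ₗ[ℝ] ℝ} (h : ∀ t ∈ (
     [(0, 1, 2), (0, 1, 3), (0, 1, 4), (0, 1, 5), (0, 2, 3), (0, 2, 4), (0, 2, 5), (0, 3, 4),
      (0, 3, 5), (0, 4, 5), (1, 2, 3), (1, 2, 4), (1, 2, 5), (1, 3, 4), (1, 3, 5), (1, 4, 5),
      (2, 3, 4), (2, 3, 5), (2, 4, 5), (3, 4, 5)] : List (Fin 6 × Fin 6 × Fin 6)),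
    f ![stdFrame t.1, stdFrame t.2.1, stdFrame t.2.2] =
      g ![stdFrame t.1, stdFrame t.2.1, stdFrame t.2.2]) : f = g := by
  refine ext_stdFrame fun v hv => ?_
  have h0 : v 0 < v 1 := hv (by decide)
  have h1 : v 1 < v 2 := hv (by decide)
  have hv' : (fun i => stdFrame (v i)) = ![stdFrame (v 0), stdFrame (v 1), stdFrame (v 2)] := by
    funext i; fin_cases i <;> rfl
  rw [hv']
  refine h (v 0, v 1, v 2) ?_
  generalize v 0 = a0 at *
  generalize v 1 = a1 at *
  generalize v 2 = a2 at *
  clear hv hv' h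
  revert a0 a1 a2
  decide +kernel

theorem ext_fourForm {f g : ModelV [⋀^Fin 4]→ₗ[ℝ] ℝ} (h : ∀ t ∈ (
     [(0, 1, 2, 3), (0, 1, 2, 4), (0, 1, 2, 5), (0, 1, 3, 4), (0, 1, 3, 5), (0, 1, 4, 5),
      (0, 2, 3, 4), (0, 2, 3, 5), (0, 2, 4, 5), (0, 3, 4, 5), (1, 2, 3, 4), (1, 2, 3, 5),
      (1, 2, 4, 5), (1, 3, 4, 5), (2, 3, 4, 5)] : List (Fin 6 × Fin 6 × Fin 6 × Fin 6)),
    f ![stdFrame t.1, stdFrame t.2.1, stdFrame t.2.2.1, stdFrame t.2.2.2] =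
      g ![stdFrame t.1, stdFrame t.2.1, stdFrame t.2.2.1, stdFrame t.2.2.2]) : f = g := by
  refine ext_stdFrame fun v hv => ?_
  have h0 : v 0 < v 1 := hv (by decide)
  have h1 : v 1 < v 2 := hv (by decide)
  have h2 : v 2 < v 3 := hv (by decide)
  have hv' : (fun i => stdFrame (v i)) = ![stdFrame (v 0), stdFrame (v 1), stdFrame (v 2), stdFrame (v 3)] := by
    funext i; fin_cases i <;> rfl
  rw [hv']
  refine h (v 0, v 1, v 2, v 3) ?_
  generalize v 0 = a0 at *
  generalize v 1 = a1 at *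
  generalize v 2 = a2 at *
  generalize v 3 = a3 at *
  clear hv hv' h
  revert a0 a1 a2 a3
  decide +kernel

theorem ext_fiveForm {f g : ModelV [⋀^Fin 5]→ₗ[ℝ] ℝ} (h : ∀ t ∈ (
     [(0, 1, 2, 3, 4), (0, 1, 2, 3, 5), (0, 1, 2, 4, 5), (0, 1, 3, 4, 5), (0, 2, 3, 4, 5),
      (1, 2, 3, 4, 5)] : List (Fin 6 × Fin 6 × Fin 6 × Fin 6 × Fin 6)),
    f ![stdFrame t.1, stdFrame t.2.1, stdFrame t.2.2.1, stdFrame t.2.2.2.1, stdFrame t.2.2.2.2] =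
      g ![stdFrame t.1, stdFrame t.2.1, stdFrame t.2.2.1, stdFrame t.2.2.2.1, stdFrame t.2.2.2.2]) : f = g := by
  refine ext_stdFrame fun v hv => ?_
  have h0 : v 0 < v 1 := hv (by decide)
  have h1 : v 1 < v 2 := hv (by decide)
  have h2 : v 2 < v 3 := hv (by decide)
  have h3 : v 3 < v 4 := hv (by decide)
  have hv' : (fun i => stdFrame (v i)) = ![stdFrame (v 0), stdFrame (v 1), stdFrame (v 2), stdFrame (v 3), stdFrame (v 4)] := by
    funext i; fin_cases i <;> rfl
  rw [hv']
  refine h (v 0, v 1, v 2, v 3, v 4) ?_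
  generalize v 0 = a0 at *
  generalize v 1 = a1 at *
  generalize v 2 = a2 at *
  generalize v 3 = a3 at *
  generalize v 4 = a4 at *
  clear hv hv' h
  revert a0 a1 a2 a3 a4
  decide +kernel

theorem ext_sixForm {f g : ModelV [⋀^Fin 6]→ₗ[ℝ] ℝ} (h : ∀ t ∈ (
     [(0, 1, 2, 3, 4, 5)] : List (Fin 6 × Fin 6 × Fin 6 × Fin 6 × Fin 6 × Fin 6)),
    f ![stdFrame t.1, stdFrame t.2.1, stdFrame t.2.2.1, stdFrame t.2.2.2.1, stdFrame t.2.2.2.2.1, stdFrame t.2.2.2.2.2] =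
      g ![stdFrame t.1, stdFrame t.2.1, stdFrame t.2.2.1, stdFrame t.2.2.2.1, stdFrame t.2.2.2.2.1, stdFrame t.2.2.2.2.2]) : f = g := by
  refine ext_stdFrame fun v hv => ?_
  have h0 : v 0 < v 1 := hv (by decide)
  have h1 : v 1 < v 2 := hv (by decide)
  have h2 : v 2 < v 3 := hv (by decide)
  have h3 : v 3 < v 4 := hv (by decide)
  have h4 : v 4 < v 5 := hv (by decide)
  have hv' : (fun i => stdFrame (v i)) = ![stdFrame (v 0), stdFrame (v 1), stdFrame (v 2), stdFrame (v 3), stdFrame (v 4), stdFrame (v 5)] := by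
    funext i; fin_cases i <;> rfl
  rw [hv']
  refine h (v 0, v 1, v 2, v 3, v 4, v 5) ?_
  generalize v 0 = a0 at *
  generalize v 1 = a1 at *
  generalize v 2 = a2 at *
  generalize v 3 = a3 at *
  generalize v 4 = a4 at *
  generalize v 5 = a5 at *
  clear hv hv' h
  revert a0 a1 a2 a3 a4 a5
  decide +kernel

theorem omegaForm_stdFrame :
    omegaForm ![stdFrame 0, stdFrame 1] = 0 ∧
    omegaForm ![stdFrame 0, stdFrame 2] = 0 ∧
    omegaForm ![stdFrame 0, stdFrame 3] = 1 ∧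
    omegaForm ![stdFrame 0, stdFrame 4] = 0 ∧
    omegaForm ![stdFrame 0, stdFrame 5] = 0 ∧
    omegaForm ![stdFrame 1, stdFrame 2] = 0 ∧
    omegaForm ![stdFrame 1, stdFrame 3] = 0 ∧
    omegaForm ![stdFrame 1, stdFrame 4] = 1 ∧
    omegaForm ![stdFrame 1, stdFrame 5] = 0 ∧
    omegaForm ![stdFrame 2, stdFrame 3] = 0 ∧
    omegaForm ![stdFrame 2, stdFrame 4] = 0 ∧
    omegaForm ![stdFrame 2, stdFrame 5] = 1 ∧
    omegaForm ![stdFrame 3, stdFrame 4] = 0 ∧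
    omegaForm ![stdFrame 3, stdFrame 5] = 0 ∧
    omegaForm ![stdFrame 4, stdFrame 5] = 0 := by
  refine ⟨?_, ?_, ?_, ?_, ?_, ?_, ?_, ?_, ?_, ?_, ?_, ?_, ?_, ?_, ?_⟩ <;>
    simp [omegaForm, stdFrame, basisVec, modelOmega, dualVec₂_apply, Fin.sum_univ_three]

theorem reForm_stdFrame :
    reForm ![stdFrame 0, stdFrame 1, stdFrame 2] = 1 ∧
    reForm ![stdFrame 0, stdFrame 1, stdFrame 3] = 0 ∧
    reForm ![stdFrame 0, stdFrame 1, stdFrame 4] = 0 ∧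
    reForm ![stdFrame 0, stdFrame 1, stdFrame 5] = 0 ∧
    reForm ![stdFrame 0, stdFrame 2, stdFrame 3] = 0 ∧
    reForm ![stdFrame 0, stdFrame 2, stdFrame 4] = 0 ∧
    reForm ![stdFrame 0, stdFrame 2, stdFrame 5] = 0 ∧
    reForm ![stdFrame 0, stdFrame 3, stdFrame 4] = 0 ∧
    reForm ![stdFrame 0, stdFrame 3, stdFrame 5] = 0 ∧
    reForm ![stdFrame 0, stdFrame 4, stdFrame 5] = -1 ∧
    reForm ![stdFrame 1, stdFrame 2, stdFrame 3] = 0 ∧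
    reForm ![stdFrame 1, stdFrame 2, stdFrame 4] = 0 ∧
    reForm ![stdFrame 1, stdFrame 2, stdFrame 5] = 0 ∧
    reForm ![stdFrame 1, stdFrame 3, stdFrame 4] = 0 ∧
    reForm ![stdFrame 1, stdFrame 3, stdFrame 5] = 1 ∧
    reForm ![stdFrame 1, stdFrame 4, stdFrame 5] = 0 ∧
    reForm ![stdFrame 2, stdFrame 3, stdFrame 4] = -1 ∧
    reForm ![stdFrame 2, stdFrame 3, stdFrame 5] = 0 ∧
    reForm ![stdFrame 2, stdFrame 4, stdFrame 5] = 0 ∧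
    reForm ![stdFrame 3, stdFrame 4, stdFrame 5] = 0 := by
  refine ⟨?_, ?_, ?_, ?_, ?_, ?_, ?_, ?_, ?_, ?_, ?_, ?_, ?_, ?_, ?_, ?_, ?_, ?_, ?_, ?_⟩ <;>
    simp [reForm, stdFrame, basisVec, modelUpsilon_apply, Matrix.det_fin_three]

theorem imForm_stdFrame :
    imForm ![stdFrame 0, stdFrame 1, stdFrame 2] = 0 ∧
    imForm ![stdFrame 0, stdFrame 1, stdFrame 3] = 0 ∧
    imForm ![stdFrame 0, stdFrame 1, stdFrame 4] = 0 ∧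
    imForm ![stdFrame 0, stdFrame 1, stdFrame 5] = 1 ∧
    imForm ![stdFrame 0, stdFrame 2, stdFrame 3] = 0 ∧
    imForm ![stdFrame 0, stdFrame 2, stdFrame 4] = -1 ∧
    imForm ![stdFrame 0, stdFrame 2, stdFrame 5] = 0 ∧
    imForm ![stdFrame 0, stdFrame 3, stdFrame 4] = 0 ∧
    imForm ![stdFrame 0, stdFrame 3, stdFrame 5] = 0 ∧
    imForm ![stdFrame 0, stdFrame 4, stdFrame 5] = 0 ∧
    imForm ![stdFrame 1, stdFrame 2, stdFrame 3] = 1 ∧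
    imForm ![stdFrame 1, stdFrame 2, stdFrame 4] = 0 ∧
    imForm ![stdFrame 1, stdFrame 2, stdFrame 5] = 0 ∧
    imForm ![stdFrame 1, stdFrame 3, stdFrame 4] = 0 ∧
    imForm ![stdFrame 1, stdFrame 3, stdFrame 5] = 0 ∧
    imForm ![stdFrame 1, stdFrame 4, stdFrame 5] = 0 ∧
    imForm ![stdFrame 2, stdFrame 3, stdFrame 4] = 0 ∧
    imForm ![stdFrame 2, stdFrame 3, stdFrame 5] = 0 ∧
    imForm ![stdFrame 2, stdFrame 4, stdFrame 5] = 0 ∧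
    imForm ![stdFrame 3, stdFrame 4, stdFrame 5] = -1 := by
  refine ⟨?_, ?_, ?_, ?_, ?_, ?_, ?_, ?_, ?_, ?_, ?_, ?_, ?_, ?_, ?_, ?_, ?_, ?_, ?_, ?_⟩ <;>
    simp [imForm, stdFrame, basisVec, modelUpsilon_apply, Matrix.det_fin_three]

/-- The two-form with given coefficients. -/
def twoFormOf (m : Matrix (Fin 6) (Fin 6) ℝ) : ModelV [⋀^Fin 2]→ₗ[ℝ] ℝ :=
  (∑ i, ∑ j, m i j • dualVec₂ (finSumFinEquiv.symm i) (finSumFinEquiv.symm j)).toAlternatingMap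

theorem stdFrame_apply (i j : Fin 6) :
    stdFrame i (finSumFinEquiv.symm j) = if i = j then 1 else 0 := by
  rw [← stdBasis_eq, stdBasis, Module.Basis.reindex_apply]
  simp [eq_comm]

/-- The sum defining the form runs over all pairs of indices, so the skew part is counted twice; a
strictly upper triangular matrix therefore lists the components for k < l. -/
theorem twoFormOf_stdFrame (m : Matrix (Fin 6) (Fin 6) ℝ) (k l : Fin 6) :
    twoFormOf m ![stdFrame k, stdFrame l] = m k l - m l k := by
  change (∑ i, ∑ j, m i j • dualVec₂ (finSumFinEquiv.symm i) (finSumFinEquiv.symm j))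
    ![stdFrame k, stdFrame l] = _
  simp only [ContinuousAlternatingMap.sum_apply, ContinuousAlternatingMap.smul_apply,
    dualVec₂_apply, stdFrame_apply, smul_eq_mul, mul_sub, Finset.sum_sub_distrib]
  simp

/-- The covector with given coefficients. -/
def covecOf (a : Fin 6 → ℝ) : ModelV →L[ℝ] ℝ := ∑ i, a i • dualVec (finSumFinEquiv.symm i)

theorem covecOf_stdFrame (a : Fin 6 → ℝ) (k : Fin 6) : covecOf a (stdFrame k) = a k := by
  have h : ∀ i, dualVec (finSumFinEquiv.symm i) (stdFrame k) = if k = i then 1 else 0 :=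
    stdFrame_apply k
  simp only [covecOf, sum_apply, smul_apply, h, smul_eq_mul]
  simp

theorem oneForm_apply {E : Type*} [AddCommGroup E] [Module ℝ E] [TopologicalSpace E]
    (α : E →L[ℝ] ℝ) (X : E) : oneForm α ![X] = α X := rfl

theorem ext_covec {α β : ModelV →L[ℝ] ℝ} (h : ∀ i, α (stdFrame i) = β (stdFrame i)) : α = β := by
  refine ContinuousLinearMap.coe_injective (stdBasis.ext fun i => ?_)
  rw [stdBasis_eq]
  exact h i

end ModelForms

/-! ### The torsion equations as linear algebra on the model space. -/

section ModelTorsion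

/-- The form `Λ²₈` of the model space. -/
def IsModelTwoEight (β : ModelV [⋀^Fin 2]→ₗ[ℝ] ℝ) : Prop :=
  wedge β reForm = 0 ∧ wedge (wedge β omegaForm) omegaForm = 0

/-- The form `Λ³₁₂` of the model space. -/
def IsModelThreeTwelve (γ : ModelV [⋀^Fin 3]→ₗ[ℝ] ℝ) : Prop :=
  wedge γ omegaForm = 0 ∧ wedge γ reForm = 0 ∧ wedge γ imForm = 0

/-- The six components of β ∧ Re Υ₀ are the obstructions to J₀-invariance, that is to type (1,1);
the single component of β ∧ Ω₀² is a multiple of the trace of β against Ω₀. -/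
theorem isModelTwoEight_iff (β : ModelV [⋀^Fin 2]→ₗ[ℝ] ℝ) : IsModelTwoEight β ↔
    β ![stdFrame 0, stdFrame 1] = β ![stdFrame 3, stdFrame 4] ∧
    β ![stdFrame 0, stdFrame 2] = β ![stdFrame 3, stdFrame 5] ∧
    β ![stdFrame 1, stdFrame 2] = β ![stdFrame 4, stdFrame 5] ∧
    β ![stdFrame 0, stdFrame 4] = β ![stdFrame 1, stdFrame 3] ∧
    β ![stdFrame 0, stdFrame 5] = β ![stdFrame 2, stdFrame 3] ∧
    β ![stdFrame 1, stdFrame 5] = β ![stdFrame 2, stdFrame 4] ∧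
    β ![stdFrame 0, stdFrame 3] + β ![stdFrame 1, stdFrame 4] + β ![stdFrame 2, stdFrame 5] = 0 := by
  constructor
  · rintro ⟨h1, h2⟩
    have e := fun v => DFunLike.congr_fun h1 v
    have e6 := DFunLike.congr_fun h2 ![stdFrame 0, stdFrame 1, stdFrame 2, stdFrame 3, stdFrame 4,
      stdFrame 5]
    have e0 := e ![stdFrame 0, stdFrame 1, stdFrame 2, stdFrame 3, stdFrame 4]
    have e1 := e ![stdFrame 0, stdFrame 1, stdFrame 2, stdFrame 3, stdFrame 5]
    have e2 := e ![stdFrame 0, stdFrame 1, stdFrame 2, stdFrame 4, stdFrame 5]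
    have e3 := e ![stdFrame 0, stdFrame 1, stdFrame 3, stdFrame 4, stdFrame 5]
    have e4 := e ![stdFrame 0, stdFrame 2, stdFrame 3, stdFrame 4, stdFrame 5]
    have e5 := e ![stdFrame 1, stdFrame 2, stdFrame 3, stdFrame 4, stdFrame 5]
    simp [wedge_two_three, wedge_two_two, wedge_four_two, omegaForm_stdFrame, reForm_stdFrame]
      at e0 e1 e2 e3 e4 e5 e6
    refine ⟨?_, ?_, ?_, ?_, ?_, ?_, ?_⟩ <;> linarith
  · rintro ⟨h1, h2, h3, h4, h5, h6, h7⟩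
    constructor
    · apply ext_fiveForm
      simp only [List.forall_mem_cons]
      refine ⟨?_, ?_, ?_, ?_, ?_, ?_, by simp⟩ <;>
        simp [wedge_two_three, reForm_stdFrame] <;> linarith
    · apply ext_sixForm
      simp only [List.forall_mem_cons]
      refine ⟨?_, by simp⟩
      simp [wedge_two_two, wedge_four_two, omegaForm_stdFrame]
      linarith

/-- The first six equations are the vanishing of the contraction of γ with Ω₀. The last two are
orthogonality to Im Υ₀ and to Re Υ₀, which come from wedging with Re Υ₀ and with Im Υ₀ respectively.
-/
theorem isModelThreeTwelve_iff (γ : ModelV [⋀^Fin 3]→ₗ[ℝ] ℝ) : IsModelThreeTwelve γ ↔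
    γ ![stdFrame 0, stdFrame 2, stdFrame 3] + γ ![stdFrame 1, stdFrame 2, stdFrame 4] = 0 ∧
    γ ![stdFrame 1, stdFrame 2, stdFrame 5] - γ ![stdFrame 0, stdFrame 1, stdFrame 3] = 0 ∧
    γ ![stdFrame 0, stdFrame 1, stdFrame 4] + γ ![stdFrame 0, stdFrame 2, stdFrame 5] = 0 ∧
    γ ![stdFrame 0, stdFrame 3, stdFrame 5] + γ ![stdFrame 1, stdFrame 4, stdFrame 5] = 0 ∧
    γ ![stdFrame 0, stdFrame 3, stdFrame 4] - γ ![stdFrame 2, stdFrame 4, stdFrame 5] = 0 ∧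
    γ ![stdFrame 1, stdFrame 3, stdFrame 4] + γ ![stdFrame 2, stdFrame 3, stdFrame 5] = 0 ∧
    γ ![stdFrame 0, stdFrame 1, stdFrame 5] - γ ![stdFrame 0, stdFrame 2, stdFrame 4] +
      γ ![stdFrame 1, stdFrame 2, stdFrame 3] - γ ![stdFrame 3, stdFrame 4, stdFrame 5] = 0 ∧
    γ ![stdFrame 0, stdFrame 1, stdFrame 2] - γ ![stdFrame 0, stdFrame 4, stdFrame 5] +
      γ ![stdFrame 1, stdFrame 3, stdFrame 5] - γ ![stdFrame 2, stdFrame 3, stdFrame 4] = 0 := by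
  constructor
  · rintro ⟨h1, h2, h3⟩
    have e := fun v => DFunLike.congr_fun h1 v
    have e6 := DFunLike.congr_fun h2 ![stdFrame 0, stdFrame 1, stdFrame 2, stdFrame 3, stdFrame 4,
      stdFrame 5]
    have e7 := DFunLike.congr_fun h3 ![stdFrame 0, stdFrame 1, stdFrame 2, stdFrame 3, stdFrame 4,
      stdFrame 5]
    have e0 := e ![stdFrame 0, stdFrame 1, stdFrame 2, stdFrame 3, stdFrame 4]
    have e1 := e ![stdFrame 0, stdFrame 1, stdFrame 2, stdFrame 3, stdFrame 5]
    have e2 := e ![stdFrame 0, stdFrame 1, stdFrame 2, stdFrame 4, stdFrame 5]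
    have e3 := e ![stdFrame 0, stdFrame 1, stdFrame 3, stdFrame 4, stdFrame 5]
    have e4 := e ![stdFrame 0, stdFrame 2, stdFrame 3, stdFrame 4, stdFrame 5]
    have e5 := e ![stdFrame 1, stdFrame 2, stdFrame 3, stdFrame 4, stdFrame 5]
    simp [wedge_three_two, wedge_three_three, omegaForm_stdFrame, reForm_stdFrame, imForm_stdFrame]
      at e0 e1 e2 e3 e4 e5 e6 e7
    refine ⟨?_, ?_, ?_, ?_, ?_, ?_, ?_, ?_⟩ <;> linarith
  · rintro ⟨h1, h2, h3, h4, h5, h6, h7, h8⟩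
    refine ⟨?_, ?_, ?_⟩
    · apply ext_fiveForm
      simp only [List.forall_mem_cons]
      refine ⟨?_, ?_, ?_, ?_, ?_, ?_, by simp⟩ <;>
        simp [wedge_three_two, omegaForm_stdFrame] <;> linarith
    · apply ext_sixForm
      simp only [List.forall_mem_cons]
      refine ⟨?_, by simp⟩
      simp [wedge_three_three, reForm_stdFrame]
      linarith
    · apply ext_sixForm
      simp only [List.forall_mem_cons]
      refine ⟨?_, by simp⟩
      simp [wedge_three_three, imForm_stdFrame]
      linarith

/-- One table serves both d Re Υ and d Im Υ, since the second is also written with Re Υ, with τ5 ∘ J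
in place of τ5. For β in Λ²₈ the off-diagonal components come in pairs that share α and β up to
signs, so half-sums and half-differences separate the two. -/
theorem fourForm_values (s : ℝ) (α : ModelV →L[ℝ] ℝ) (β : ModelV [⋀^Fin 2]→ₗ[ℝ] ℝ) :
    let r := s • wedge omegaForm omegaForm + wedge (oneForm α) reForm + wedge β omegaForm
    r ![stdFrame 0, stdFrame 1, stdFrame 2, stdFrame 3] =
      -α (stdFrame 3) + β ![stdFrame 1, stdFrame 2] ∧
    r ![stdFrame 0, stdFrame 1, stdFrame 2, stdFrame 4] =
      -α (stdFrame 4) - β ![stdFrame 0, stdFrame 2] ∧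
    r ![stdFrame 0, stdFrame 1, stdFrame 2, stdFrame 5] =
      -α (stdFrame 5) + β ![stdFrame 0, stdFrame 1] ∧
    r ![stdFrame 0, stdFrame 1, stdFrame 3, stdFrame 4] =
      -2 * s - β ![stdFrame 0, stdFrame 3] - β ![stdFrame 1, stdFrame 4] ∧
    r ![stdFrame 0, stdFrame 1, stdFrame 3, stdFrame 5] =
      α (stdFrame 0) - β ![stdFrame 1, stdFrame 5] ∧
    r ![stdFrame 0, stdFrame 1, stdFrame 4, stdFrame 5] =
      α (stdFrame 1) + β ![stdFrame 0, stdFrame 5] ∧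
    r ![stdFrame 0, stdFrame 2, stdFrame 3, stdFrame 4] =
      -α (stdFrame 0) - β ![stdFrame 2, stdFrame 4] ∧
    r ![stdFrame 0, stdFrame 2, stdFrame 3, stdFrame 5] =
      -2 * s - β ![stdFrame 0, stdFrame 3] - β ![stdFrame 2, stdFrame 5] ∧
    r ![stdFrame 0, stdFrame 2, stdFrame 4, stdFrame 5] =
      α (stdFrame 2) - β ![stdFrame 0, stdFrame 4] ∧
    r ![stdFrame 0, stdFrame 3, stdFrame 4, stdFrame 5] =
      α (stdFrame 3) + β ![stdFrame 4, stdFrame 5] ∧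
    r ![stdFrame 1, stdFrame 2, stdFrame 3, stdFrame 4] =
      -α (stdFrame 1) + β ![stdFrame 2, stdFrame 3] ∧
    r ![stdFrame 1, stdFrame 2, stdFrame 3, stdFrame 5] =
      -α (stdFrame 2) - β ![stdFrame 1, stdFrame 3] ∧
    r ![stdFrame 1, stdFrame 2, stdFrame 4, stdFrame 5] =
      -2 * s - β ![stdFrame 1, stdFrame 4] - β ![stdFrame 2, stdFrame 5] ∧
    r ![stdFrame 1, stdFrame 3, stdFrame 4, stdFrame 5] =
      α (stdFrame 4) - β ![stdFrame 3, stdFrame 5] ∧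
    r ![stdFrame 2, stdFrame 3, stdFrame 4, stdFrame 5] =
      α (stdFrame 5) + β ![stdFrame 3, stdFrame 4] := by
  intro r
  refine ⟨?_, ?_, ?_, ?_, ?_, ?_, ?_, ?_, ?_, ?_, ?_, ?_, ?_, ?_, ?_⟩ <;>
    simp [r, wedge_one_three, wedge_two_two, oneForm_apply, omegaForm_stdFrame,
      reForm_stdFrame] <;> ring

theorem threeForm_values (s t : ℝ) (γ : ModelV [⋀^Fin 3]→ₗ[ℝ] ℝ) (α : ModelV →L[ℝ] ℝ) :
    let r := s • reForm + t • imForm + γ + wedge (oneForm α) omegaForm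
    r ![stdFrame 0, stdFrame 1, stdFrame 2] =
      s + γ ![stdFrame 0, stdFrame 1, stdFrame 2] ∧
    r ![stdFrame 0, stdFrame 1, stdFrame 3] =
      γ ![stdFrame 0, stdFrame 1, stdFrame 3] - α (stdFrame 1) ∧
    r ![stdFrame 0, stdFrame 1, stdFrame 4] =
      γ ![stdFrame 0, stdFrame 1, stdFrame 4] + α (stdFrame 0) ∧
    r ![stdFrame 0, stdFrame 1, stdFrame 5] =
      t + γ ![stdFrame 0, stdFrame 1, stdFrame 5] ∧
    r ![stdFrame 0, stdFrame 2, stdFrame 3] =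
      γ ![stdFrame 0, stdFrame 2, stdFrame 3] - α (stdFrame 2) ∧
    r ![stdFrame 0, stdFrame 2, stdFrame 4] =
      -t + γ ![stdFrame 0, stdFrame 2, stdFrame 4] ∧
    r ![stdFrame 0, stdFrame 2, stdFrame 5] =
      γ ![stdFrame 0, stdFrame 2, stdFrame 5] + α (stdFrame 0) ∧
    r ![stdFrame 0, stdFrame 3, stdFrame 4] =
      γ ![stdFrame 0, stdFrame 3, stdFrame 4] + α (stdFrame 4) ∧
    r ![stdFrame 0, stdFrame 3, stdFrame 5] =
      γ ![stdFrame 0, stdFrame 3, stdFrame 5] + α (stdFrame 5) ∧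
    r ![stdFrame 0, stdFrame 4, stdFrame 5] =
      -s + γ ![stdFrame 0, stdFrame 4, stdFrame 5] ∧
    r ![stdFrame 1, stdFrame 2, stdFrame 3] =
      t + γ ![stdFrame 1, stdFrame 2, stdFrame 3] ∧
    r ![stdFrame 1, stdFrame 2, stdFrame 4] =
      γ ![stdFrame 1, stdFrame 2, stdFrame 4] - α (stdFrame 2) ∧
    r ![stdFrame 1, stdFrame 2, stdFrame 5] =
      γ ![stdFrame 1, stdFrame 2, stdFrame 5] + α (stdFrame 1) ∧
    r ![stdFrame 1, stdFrame 3, stdFrame 4] =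
      γ ![stdFrame 1, stdFrame 3, stdFrame 4] - α (stdFrame 3) ∧
    r ![stdFrame 1, stdFrame 3, stdFrame 5] =
      s + γ ![stdFrame 1, stdFrame 3, stdFrame 5] ∧
    r ![stdFrame 1, stdFrame 4, stdFrame 5] =
      γ ![stdFrame 1, stdFrame 4, stdFrame 5] + α (stdFrame 5) ∧
    r ![stdFrame 2, stdFrame 3, stdFrame 4] =
      -s + γ ![stdFrame 2, stdFrame 3, stdFrame 4] ∧
    r ![stdFrame 2, stdFrame 3, stdFrame 5] =
      γ ![stdFrame 2, stdFrame 3, stdFrame 5] - α (stdFrame 3) ∧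
    r ![stdFrame 2, stdFrame 4, stdFrame 5] =
      γ ![stdFrame 2, stdFrame 4, stdFrame 5] - α (stdFrame 4) ∧
    r ![stdFrame 3, stdFrame 4, stdFrame 5] =
      -t + γ ![stdFrame 3, stdFrame 4, stdFrame 5] := by
  intro r
  refine ⟨?_, ?_, ?_, ?_, ?_, ?_, ?_, ?_, ?_, ?_, ?_, ?_, ?_, ?_, ?_, ?_, ?_, ?_, ?_, ?_⟩ <;>
    simp [r, wedge_one_two, oneForm_apply, omegaForm_stdFrame, reForm_stdFrame,
      imForm_stdFrame] <;> ring

/-- The defining equations of the torsion forms on the model space, for given values `a`, `b`, `c`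
of `dΩ`, `d Re Υ`, `d Im Υ`. -/
structure IsModelTorsion (a : ModelV [⋀^Fin 3]→ₗ[ℝ] ℝ) (b c : ModelV [⋀^Fin 4]→ₗ[ℝ] ℝ)
    (τ : TorsionForms ModelV) : Prop where
  mem_τ2 : IsModelTwoEight τ.τ2
  mem_τ2' : IsModelTwoEight τ.τ2'
  mem_τ3 : IsModelThreeTwelve τ.τ3
  d_Omega : a = (3 * τ.τ0) • reForm + (3 * τ.τ0') • imForm + τ.τ3 + wedge (oneForm τ.τ4) omegaForm
  d_re : b = (2 * τ.τ0') • wedge omegaForm omegaForm + wedge (oneForm τ.τ5) reForm +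
    wedge τ.τ2 omegaForm
  d_im : c = (-2 * τ.τ0) • wedge omegaForm omegaForm +
    wedge (oneForm (τ.τ5.comp modelJ)) reForm + wedge τ.τ2' omegaForm

/-- The component in `Λ²₈` of the contraction of a four-form with the Kähler form. -/
def primitivePart (r : ModelV [⋀^Fin 4]→ₗ[ℝ] ℝ) : ModelV [⋀^Fin 2]→ₗ[ℝ] ℝ :=
  let f := fun i j k l => r ![stdFrame i, stdFrame j, stdFrame k, stdFrame l]
  -- If r = s₀ Ω₀² + α ∧ Re Υ₀ + β ∧ Ω₀ with β in Λ²₈, this mean is -2 s₀, because β is trace-free;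
  -- subtracting it from the three components leaves the diagonal entries of β.
  let s := (f 0 1 3 4 + f 0 2 3 5 + f 1 2 4 5) / 3
  let p01 := (f 0 1 2 5 + f 2 3 4 5) / 2
  let p02 := -(f 0 1 2 4 + f 1 3 4 5) / 2
  let p12 := (f 0 1 2 3 + f 0 3 4 5) / 2
  let q01 := -(f 0 2 4 5 + f 1 2 3 5) / 2
  let q02 := (f 0 1 4 5 + f 1 2 3 4) / 2
  let q12 := -(f 0 1 3 5 + f 0 2 3 4) / 2
  twoFormOf !![0, p01, p02, f 1 2 4 5 - s, q01, q02;
    0, 0, p12, q01, f 0 2 3 5 - s, q12;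
    0, 0, 0, q02, q12, f 0 1 3 4 - s;
    0, 0, 0, 0, p01, p02;
    0, 0, 0, 0, 0, p12;
    0, 0, 0, 0, 0, 0]

/-- The one-form in the component of a four-form of type `(3,1) + (1,3)`. -/
def leePart (b : ModelV [⋀^Fin 4]→ₗ[ℝ] ℝ) : ModelV →L[ℝ] ℝ :=
  let f := fun i j k l => b ![stdFrame i, stdFrame j, stdFrame k, stdFrame l]
  covecOf ![(f 0 1 3 5 - f 0 2 3 4) / 2, (f 0 1 4 5 - f 1 2 3 4) / 2, (f 0 2 4 5 - f 1 2 3 5) / 2,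
    (f 0 3 4 5 - f 0 1 2 3) / 2, (f 1 3 4 5 - f 0 1 2 4) / 2, (f 2 3 4 5 - f 0 1 2 5) / 2]

/-- Half of the contraction of a three-form with the Kähler form. -/
def contractionPart (a : ModelV [⋀^Fin 3]→ₗ[ℝ] ℝ) : ModelV →L[ℝ] ℝ :=
  let f := fun i j k => a ![stdFrame i, stdFrame j, stdFrame k]
  covecOf ![(f 0 1 4 + f 0 2 5) / 2, (f 1 2 5 - f 0 1 3) / 2, -(f 0 2 3 + f 1 2 4) / 2,
    -(f 1 3 4 + f 2 3 5) / 2, (f 0 3 4 - f 2 4 5) / 2, (f 0 3 5 + f 1 4 5) / 2]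

/-- The torsion forms, in terms of the exterior derivatives. -/
def modelTorsion (a : ModelV [⋀^Fin 3]→ₗ[ℝ] ℝ) (b c : ModelV [⋀^Fin 4]→ₗ[ℝ] ℝ) :
    TorsionForms ModelV :=
  let f := fun i j k => a ![stdFrame i, stdFrame j, stdFrame k]
  -- The numerator is the pairing with Re Υ₀, whose squared norm is 4, and the coefficient in dΩ is
  -- 3 τ0; hence 12.
  let t := (f 0 1 2 - f 0 4 5 + f 1 3 5 - f 2 3 4) / 12
  let t' := (f 0 1 5 - f 0 2 4 + f 1 2 3 - f 3 4 5) / 12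
  { τ0 := t
    τ0' := t'
    τ2 := primitivePart b
    τ2' := primitivePart c
    τ3 := a - (3 * t) • reForm - (3 * t') • imForm - wedge (oneForm (contractionPart a)) omegaForm
    τ4 := contractionPart a
    τ5 := leePart b }

theorem primitivePart_eq (s : ℝ) (α : ModelV →L[ℝ] ℝ) {β : ModelV [⋀^Fin 2]→ₗ[ℝ] ℝ}
    (hβ : IsModelTwoEight β) : primitivePart (s • wedge omegaForm omegaForm +
      wedge (oneForm α) reForm + wedge β omegaForm) = β := by
  have h := (isModelTwoEight_iff _).mp hβ
  apply ext_twoForm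
  simp only [List.forall_mem_cons, primitivePart, twoFormOf_stdFrame, fourForm_values]
  refine ⟨?_, ?_, ?_, ?_, ?_, ?_, ?_, ?_, ?_, ?_, ?_, ?_, ?_, ?_, ?_, by simp⟩ <;> simp <;> linarith

theorem leePart_eq (s : ℝ) (α : ModelV →L[ℝ] ℝ) {β : ModelV [⋀^Fin 2]→ₗ[ℝ] ℝ}
    (hβ : IsModelTwoEight β) : leePart (s • wedge omegaForm omegaForm +
      wedge (oneForm α) reForm + wedge β omegaForm) = α := by
  have h := (isModelTwoEight_iff _).mp hβ
  refine ext_covec fun i => ?_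
  simp only [leePart, covecOf_stdFrame, fourForm_values]
  fin_cases i <;> simp <;> linarith

theorem contractionPart_eq (s t : ℝ) (α : ModelV →L[ℝ] ℝ) {γ : ModelV [⋀^Fin 3]→ₗ[ℝ] ℝ}
    (hγ : IsModelThreeTwelve γ) : contractionPart (s • reForm + t • imForm + γ +
      wedge (oneForm α) omegaForm) = α := by
  have h := (isModelThreeTwelve_iff _).mp hγ
  refine ext_covec fun i => ?_
  simp only [contractionPart, covecOf_stdFrame, threeForm_values]
  fin_cases i <;> simp <;> linarith

/-- Uniqueness: the projections `contractionPart`, `leePart`, `primitivePart` and the two pairings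
recover each unknown from the equation in which it occurs, and τ3 is what is left of dΩ. No
compatibility between `a`, `b`, `c` enters. -/
theorem IsModelTorsion.eq_modelTorsion {a : ModelV [⋀^Fin 3]→ₗ[ℝ] ℝ}
    {b c : ModelV [⋀^Fin 4]→ₗ[ℝ] ℝ} {τ : TorsionForms ModelV} (h : IsModelTorsion a b c τ) :
    τ = modelTorsion a b c := by
  obtain ⟨h2, h2', h3, ha, hb, hc⟩ := h
  have e4 : contractionPart a = τ.τ4 := by rw [ha]; exact contractionPart_eq _ _ _ h3
  have e5 : leePart b = τ.τ5 := by rw [hb]; exact leePart_eq _ _ h2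
  have p2 : primitivePart b = τ.τ2 := by rw [hb]; exact primitivePart_eq _ _ h2
  have p2' : primitivePart c = τ.τ2' := by rw [hc]; exact primitivePart_eq _ _ h2'
  have h3 := (isModelThreeTwelve_iff _).mp h3
  have t : (a ![stdFrame 0, stdFrame 1, stdFrame 2] - a ![stdFrame 0, stdFrame 4, stdFrame 5] +
      a ![stdFrame 1, stdFrame 3, stdFrame 5] - a ![stdFrame 2, stdFrame 3, stdFrame 4]) / 12 =
      τ.τ0 := by
    rw [ha]
    simp only [threeForm_values]
    linarith
  have t' : (a ![stdFrame 0, stdFrame 1, stdFrame 5] - a ![stdFrame 0, stdFrame 2, stdFrame 4] +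
      a ![stdFrame 1, stdFrame 2, stdFrame 3] - a ![stdFrame 3, stdFrame 4, stdFrame 5]) / 12 =
      τ.τ0' := by
    rw [ha]
    simp only [threeForm_values]
    linarith
  have e3 : τ.τ3 = a - (3 * τ.τ0) • reForm - (3 * τ.τ0') • imForm -
      wedge (oneForm τ.τ4) omegaForm := by
    rw [ha]; abel
  simp only [modelTorsion, t, t', e4, e5, p2, p2', ← e3]

theorem isModelTwoEight_primitivePart (r : ModelV [⋀^Fin 4]→ₗ[ℝ] ℝ) :
    IsModelTwoEight (primitivePart r) := by
  rw [isModelTwoEight_iff]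
  simp only [primitivePart, twoFormOf_stdFrame]
  refine ⟨?_, ?_, ?_, ?_, ?_, ?_, ?_⟩ <;> simp
  ring

theorem modelJ_stdFrame : modelJ (stdFrame 0) = stdFrame 3 ∧ modelJ (stdFrame 1) = stdFrame 4 ∧
    modelJ (stdFrame 2) = stdFrame 5 ∧ modelJ (stdFrame 3) = -stdFrame 0 ∧
    modelJ (stdFrame 4) = -stdFrame 1 ∧ modelJ (stdFrame 5) = -stdFrame 2 := by
  refine ⟨?_, ?_, ?_, ?_, ?_, ?_⟩ <;> ext i <;> rw [modelJ_apply] <;>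
    rcases i with p | p <;> fin_cases p <;> simp [stdFrame, basisVec]

/-- The algebraic relations between the exterior derivatives of `Ω`, `Re Υ` and `Im Υ`. -/
structure TorsionRelations (a : ModelV [⋀^Fin 3]→ₗ[ℝ] ℝ) (b c : ModelV [⋀^Fin 4]→ₗ[ℝ] ℝ) :
    Prop where
  re : a ![stdFrame 0, stdFrame 1, stdFrame 5] - a ![stdFrame 0, stdFrame 2, stdFrame 4] +
      a ![stdFrame 1, stdFrame 2, stdFrame 3] - a ![stdFrame 3, stdFrame 4, stdFrame 5] =
    -(b ![stdFrame 0, stdFrame 1, stdFrame 3, stdFrame 4] +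
      b ![stdFrame 0, stdFrame 2, stdFrame 3, stdFrame 5] +
      b ![stdFrame 1, stdFrame 2, stdFrame 4, stdFrame 5])
  im : a ![stdFrame 0, stdFrame 1, stdFrame 2] - a ![stdFrame 0, stdFrame 4, stdFrame 5] +
      a ![stdFrame 1, stdFrame 3, stdFrame 5] - a ![stdFrame 2, stdFrame 3, stdFrame 4] =
    c ![stdFrame 0, stdFrame 1, stdFrame 3, stdFrame 4] +
      c ![stdFrame 0, stdFrame 2, stdFrame 3, stdFrame 5] +
      c ![stdFrame 1, stdFrame 2, stdFrame 4, stdFrame 5]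
  lee : leePart c = (leePart b).comp modelJ

/-- Existence: the equations have 50 components for 42 unknowns. The missing eight conditions are
that τ0 and τ̂0 read off from dΩ agree with those read off from dΥ, and that the one-form of d Im Υ
is the one of d Re Υ composed with J₀. -/
theorem TorsionRelations.isModelTorsion {a : ModelV [⋀^Fin 3]→ₗ[ℝ] ℝ}
    {b c : ModelV [⋀^Fin 4]→ₗ[ℝ] ℝ} (h : TorsionRelations a b c) :
    IsModelTorsion a b c (modelTorsion a b c) := by
  have hre := h.re
  have him := h.im
  refine ⟨isModelTwoEight_primitivePart _, isModelTwoEight_primitivePart _, ?_, ?_, ?_, ?_⟩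
  · have hτ := threeForm_values (3 * (modelTorsion a b c).τ0) (3 * (modelTorsion a b c).τ0')
      (modelTorsion a b c).τ3 (modelTorsion a b c).τ4
    have ha : (3 * (modelTorsion a b c).τ0) • reForm + (3 * (modelTorsion a b c).τ0') • imForm +
        (modelTorsion a b c).τ3 + wedge (oneForm (modelTorsion a b c).τ4) omegaForm = a := by
      simp only [modelTorsion]
      abel
    simp only [ha] at hτ
    have h4 : ∀ i, (modelTorsion a b c).τ4 (stdFrame i) = contractionPart a (stdFrame i) :=
      fun _ => rfl
    have ht : (modelTorsion a b c).τ0 = (a ![stdFrame 0, stdFrame 1, stdFrame 2] -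
      a ![stdFrame 0, stdFrame 4, stdFrame 5] + a ![stdFrame 1, stdFrame 3, stdFrame 5] -
      a ![stdFrame 2, stdFrame 3, stdFrame 4]) / 12 := rfl
    have ht' : (modelTorsion a b c).τ0' = (a ![stdFrame 0, stdFrame 1, stdFrame 5] -
      a ![stdFrame 0, stdFrame 2, stdFrame 4] + a ![stdFrame 1, stdFrame 2, stdFrame 3] -
      a ![stdFrame 3, stdFrame 4, stdFrame 5]) / 12 := rfl
    have h40 := h4 0
    have h41 := h4 1
    have h42 := h4 2
    have h43 := h4 3
    have h44 := h4 4
    have h45 := h4 5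
    simp only [contractionPart, covecOf_stdFrame] at h40 h41 h42 h43 h44 h45
    simp at h40 h41 h42 h43 h44 h45
    rw [isModelThreeTwelve_iff]
    refine ⟨?_, ?_, ?_, ?_, ?_, ?_, ?_, ?_⟩ <;> linarith
  · simp only [modelTorsion]
    abel
  · apply ext_fourForm
    simp only [fourForm_values, List.forall_mem_cons]
    simp only [modelTorsion, leePart, covecOf_stdFrame, primitivePart, twoFormOf_stdFrame]
    refine ⟨?_, ?_, ?_, ?_, ?_, ?_, ?_, ?_, ?_, ?_, ?_, ?_, ?_, ?_, ?_, by simp⟩ <;> simp <;>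
      linarith
  · have h5 : (modelTorsion a b c).τ5.comp modelJ = leePart c := h.lee.symm
    rw [h5]
    apply ext_fourForm
    simp only [fourForm_values, List.forall_mem_cons]
    simp only [modelTorsion, leePart, covecOf_stdFrame, primitivePart, twoFormOf_stdFrame]
    refine ⟨?_, ?_, ?_, ?_, ?_, ?_, ?_, ?_, ?_, ?_, ?_, ?_, ?_, ?_, ?_, by simp⟩ <;> simp <;>
      linarith

end ModelTorsion

/-! ### Transport of torsion between a tangent space and the model space. -/

section Transport

variable {T : Type*} [AddCommGroup T] [Module ℝ T] [TopologicalSpace T]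

/-- Transport of torsion forms by a coframe. -/
def TorsionForms.push (τ : TorsionForms T) (c : T ≃L[ℝ] ModelV) : TorsionForms ModelV where
  τ0 := τ.τ0
  τ0' := τ.τ0'
  τ2 := τ.τ2.compLinearMap (c.symm : ModelV →ₗ[ℝ] T)
  τ2' := τ.τ2'.compLinearMap (c.symm : ModelV →ₗ[ℝ] T)
  τ3 := τ.τ3.compLinearMap (c.symm : ModelV →ₗ[ℝ] T)
  τ4 := τ.τ4.comp (c.symm : ModelV →L[ℝ] T)
  τ5 := τ.τ5.comp (c.symm : ModelV →L[ℝ] T)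

/-- Transport of torsion forms back by a coframe. -/
def TorsionForms.pull (τ : TorsionForms ModelV) (c : T ≃L[ℝ] ModelV) : TorsionForms T where
  τ0 := τ.τ0
  τ0' := τ.τ0'
  τ2 := τ.τ2.compLinearMap (c : T →ₗ[ℝ] ModelV)
  τ2' := τ.τ2'.compLinearMap (c : T →ₗ[ℝ] ModelV)
  τ3 := τ.τ3.compLinearMap (c : T →ₗ[ℝ] ModelV)
  τ4 := τ.τ4.comp (c : T →L[ℝ] ModelV)
  τ5 := τ.τ5.comp (c : T →L[ℝ] ModelV)

theorem compLinearMap_symm_comp {k : ℕ} (c : T ≃L[ℝ] ModelV) (α : T [⋀^Fin k]→ₗ[ℝ] ℝ) :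
    (α.compLinearMap (c.symm : ModelV →ₗ[ℝ] T)).compLinearMap (c : T →ₗ[ℝ] ModelV) = α := by
  ext v
  simp [AlternatingMap.compLinearMap_apply]

theorem compLinearMap_comp_symm {k : ℕ} (c : T ≃L[ℝ] ModelV) (α : ModelV [⋀^Fin k]→ₗ[ℝ] ℝ) :
    (α.compLinearMap (c : T →ₗ[ℝ] ModelV)).compLinearMap (c.symm : ModelV →ₗ[ℝ] T) = α := by
  ext v
  simp [AlternatingMap.compLinearMap_apply]

theorem TorsionForms.pull_push (τ : TorsionForms T) (c : T ≃L[ℝ] ModelV) :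
    (τ.push c).pull c = τ := by
  cases τ
  simp only [push, pull, compLinearMap_symm_comp, TorsionForms.mk.injEq, true_and]
  constructor <;> ext <;> simp

theorem TorsionForms.push_pull (τ : TorsionForms ModelV) (c : T ≃L[ℝ] ModelV) :
    (τ.pull c).push c = τ := by
  cases τ
  simp only [push, pull, compLinearMap_comp_symm, TorsionForms.mk.injEq, true_and]
  constructor <;> ext <;> simp

theorem compLinearMap_symm_inj {k : ℕ} (c : T ≃L[ℝ] ModelV) {α β : T [⋀^Fin k]→ₗ[ℝ] ℝ} :
    α.compLinearMap (c.symm : ModelV →ₗ[ℝ] T) = β.compLinearMap (c.symm : ModelV →ₗ[ℝ] T) ↔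
      α = β := by
  refine ⟨fun h => ?_, fun h => by rw [h]⟩
  rw [← compLinearMap_symm_comp c α, h, compLinearMap_symm_comp]

theorem oneForm_comp (c : T ≃L[ℝ] ModelV) (α : T →L[ℝ] ℝ) :
    oneForm (α.comp (c.symm : ModelV →L[ℝ] T)) =
      (oneForm α).compLinearMap (c.symm : ModelV →ₗ[ℝ] T) := rfl

end Transport

namespace SU3Structure

variable {M : Type*} [TopologicalSpace M] [ChartedSpace (EuclideanSpace ℝ (Fin 6)) M]
  {S : SU3Structure M} {x : M} {c : TangentSpace (𝓡 6) x ≃L[ℝ] ModelV}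

theorem IsCoframe.omega_comp (hc : S.IsCoframe x c) :
    (S.Omega x).toAlternatingMap.compLinearMap (c.symm : ModelV →ₗ[ℝ] _) = omegaForm := by
  rw [hc.1]
  exact compLinearMap_comp_symm c omegaForm

theorem IsCoframe.re_comp (hc : S.IsCoframe x c) :
    (S.reUpsilon x).toAlternatingMap.compLinearMap (c.symm : ModelV →ₗ[ℝ] _) = reForm := by
  rw [reUpsilon, hc.2]
  exact compLinearMap_comp_symm c reForm

theorem IsCoframe.im_comp (hc : S.IsCoframe x c) :
    (S.imUpsilon x).toAlternatingMap.compLinearMap (c.symm : ModelV →ₗ[ℝ] _) = imForm := by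
  rw [imUpsilon, hc.2]
  exact compLinearMap_comp_symm c imForm

theorem IsCoframe.isLambdaTwoEight_iff (hc : S.IsCoframe x c)
    (β : TangentSpace (𝓡 6) x [⋀^Fin 2]→ₗ[ℝ] ℝ) : S.IsLambdaTwoEight x β ↔
      IsModelTwoEight (β.compLinearMap (c.symm : ModelV →ₗ[ℝ] _)) := by
  unfold IsLambdaTwoEight IsModelTwoEight
  rw [← compLinearMap_symm_inj c, ← compLinearMap_symm_inj c (β := 0)]
  simp only [← wedge_compLinearMap, hc.omega_comp, hc.re_comp, AlternatingMap.zero_compLinearMap]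

theorem IsCoframe.isLambdaThreeTwelve_iff (hc : S.IsCoframe x c)
    (γ : TangentSpace (𝓡 6) x [⋀^Fin 3]→ₗ[ℝ] ℝ) : S.IsLambdaThreeTwelve x γ ↔
      IsModelThreeTwelve (γ.compLinearMap (c.symm : ModelV →ₗ[ℝ] _)) := by
  unfold IsLambdaThreeTwelve IsModelThreeTwelve
  rw [← compLinearMap_symm_inj c, ← compLinearMap_symm_inj c (β := 0),
    ← compLinearMap_symm_inj c (α := wedge γ (S.imUpsilon x).toAlternatingMap)]
  simp only [← wedge_compLinearMap, hc.omega_comp, hc.re_comp, hc.im_comp,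
    AlternatingMap.zero_compLinearMap]

theorem IsCoframe.comp_J (hc : S.IsCoframe x c) (α : TangentSpace (𝓡 6) x →L[ℝ] ℝ) :
    (α.comp (S.J x)).comp (c.symm : ModelV →L[ℝ] _) =
      (α.comp (c.symm : ModelV →L[ℝ] _)).comp modelJ := by
  ext X
  simp [J_eq_of_isCoframe hc]

/-- A coframe carries Ω, Υ and J to their models and commutes with wedge products, so the torsion
equations become those of the model space, term by term. -/
theorem IsCoframe.isTorsion_iff (hc : S.IsCoframe x c)
    (τ : TorsionForms (TangentSpace (𝓡 6) x)) : S.IsTorsion x τ ↔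
      IsModelTorsion
        ((formD S.Omega x).toAlternatingMap.compLinearMap (c.symm : ModelV →ₗ[ℝ] _))
        ((formD S.reUpsilon x).toAlternatingMap.compLinearMap (c.symm : ModelV →ₗ[ℝ] _))
        ((formD S.imUpsilon x).toAlternatingMap.compLinearMap (c.symm : ModelV →ₗ[ℝ] _))
        (τ.push c) := by
  have add := fun (k : ℕ) (α β : TangentSpace (𝓡 6) x [⋀^Fin k]→ₗ[ℝ] ℝ) =>
    AlternatingMap.add_compLinearMap α β (c.symm : ModelV →ₗ[ℝ] _)
  have smul := fun (k : ℕ) (r : ℝ) (α : TangentSpace (𝓡 6) x [⋀^Fin k]→ₗ[ℝ] ℝ) =>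
    show (r • α).compLinearMap (c.symm : ModelV →ₗ[ℝ] _) =
      r • α.compLinearMap (c.symm : ModelV →ₗ[ℝ] _) from rfl
  -- Treated apart because the degree of this wedge is `1 + 2`, while it is added to forms of degree
  -- `3`.
  have hw : AlternatingMap.compLinearMap (ι := Fin 3)
      (wedge (oneForm τ.τ4) (S.Omega x).toAlternatingMap) (c.symm : ModelV →ₗ[ℝ] _) =
      wedge (oneForm (τ.push c).τ4) omegaForm := by
    rw [← hc.omega_comp]
    exact (wedge_compLinearMap _ _ _).symm
  constructor
  · rintro ⟨h1, h2, h3, h4, h5, h6⟩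
    refine ⟨(hc.isLambdaTwoEight_iff _).mp h1, (hc.isLambdaTwoEight_iff _).mp h2,
      (hc.isLambdaThreeTwelve_iff _).mp h3, ?_, ?_, ?_⟩
    · rw [h4]
      simp only [add, smul, hc.re_comp, hc.im_comp]
      rw [hw]
      rfl
    · rw [h5]
      simp only [add, smul, ← wedge_compLinearMap, hc.omega_comp, hc.re_comp]
      rfl
    · rw [h6]
      simp only [add, smul, ← wedge_compLinearMap, hc.omega_comp, hc.re_comp, ← oneForm_comp,
        hc.comp_J]
      rfl
  · rintro ⟨h1, h2, h3, h4, h5, h6⟩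
    refine ⟨(hc.isLambdaTwoEight_iff _).mpr h1, (hc.isLambdaTwoEight_iff _).mpr h2,
      (hc.isLambdaThreeTwelve_iff _).mpr h3, ?_, ?_, ?_⟩
    · rw [← compLinearMap_symm_inj c, h4]
      simp only [add, smul, hc.re_comp, hc.im_comp]
      rw [hw]
      rfl
    · rw [← compLinearMap_symm_inj c]
      refine h5.trans ?_
      simp only [add, smul, ← wedge_compLinearMap, hc.omega_comp, hc.re_comp]
      rfl
    · rw [← compLinearMap_symm_inj c]
      refine h6.trans ?_
      simp only [add, smul, ← wedge_compLinearMap, hc.omega_comp, hc.re_comp, ← oneForm_comp,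
        hc.comp_J]
      rfl

end SU3Structure

/-! ### Derivatives of the algebraic identities satisfied by Ω and Υ. -/

section LocalRelations

/-- Evaluation of `modelUpsilon` on basis vectors and Plücker relations. -/
theorem modelUpsilon_pluecker (X Y A B C D : ModelV) :
    modelUpsilon ![X, Y, A] * modelUpsilon ![B, C, D] -
      modelUpsilon ![X, Y, B] * modelUpsilon ![A, C, D] +
      modelUpsilon ![X, Y, C] * modelUpsilon ![A, B, D] -
      modelUpsilon ![X, Y, D] * modelUpsilon ![A, B, C] = 0 := by
  simp only [modelUpsilon_apply, Matrix.det_fin_three, Matrix.of_apply, Matrix.cons_val_zero,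
    Matrix.cons_val_one, Matrix.cons_val]
  generalize hz : (fun (Z : ModelV) (p : Fin 3) =>
    (Z (Sum.inl p) : ℂ) + Complex.I * (Z (Sum.inr p) : ℂ)) = z
  have h : ∀ (Z : ModelV) (p : Fin 3), (Z (Sum.inl p) : ℂ) + Complex.I * (Z (Sum.inr p) : ℂ) =
    z Z p := fun Z p => by rw [← hz]
  simp only [h]
  ring

variable {E F : Type*} [NormedAddCommGroup E] [NormedSpace ℝ E] [NormedAddCommGroup F]
  [NormedSpace ℝ F] {k : ℕ}

theorem hasDerivAt_form_line {η : E → E [⋀^Fin k]→L[ℝ] F} {y : E} (hη : DifferentiableAt ℝ η y)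
    (v : E) (w : Fin k → E) :
    HasDerivAt (fun t : ℝ => η (y + t • v) w) (fderiv ℝ η y v w) 0 := by
  have h1 : HasDerivAt (fun t : ℝ => y + t • v) v 0 := by
    simpa using ((hasDerivAt_id (0 : ℝ)).smul_const v).const_add y
  have h2 : HasFDerivAt η (fderiv ℝ η y) (y + (0 : ℝ) • v) := by
    simpa using hη.hasFDerivAt
  have h3 := h2.comp_hasDerivAt (0 : ℝ) h1
  exact ((ContinuousAlternatingMap.apply ℝ E F w).hasFDerivAt.comp_hasDerivAt (0 : ℝ) h3)

theorem extDeriv_comp_clm {G : Type*} [NormedAddCommGroup G] [NormedSpace ℝ G] (L : F →L[ℝ] G)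
    {η : E → E [⋀^Fin k]→L[ℝ] F} {y : E} (hη : DifferentiableAt ℝ η y) :
    extDeriv (fun z => L.compContinuousAlternatingMap (η z)) y =
      L.compContinuousAlternatingMap (extDeriv η y) := by
  have h1 : HasFDerivAt (fun z => L.compContinuousAlternatingMap (η z)) _ y :=
    (ContinuousLinearMap.compContinuousAlternatingMapCLM ℝ E F G (ι := Fin k) L).hasFDerivAt.comp y hη.hasFDerivAt
  ext v
  rw [extDeriv, h1.fderiv, ContinuousAlternatingMap.alternatizeUncurryFin_apply,
    ContinuousLinearMap.compContinuousAlternatingMap_coe, Function.comp_apply, extDeriv,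
    ContinuousAlternatingMap.alternatizeUncurryFin_apply, map_sum]
  refine Finset.sum_congr rfl fun i _ => ?_
  simp only [Int.reduceNeg, map_zsmul]
  rfl

theorem extDeriv_two_apply (η : E → E [⋀^Fin 2]→L[ℝ] F) (y : E) (X Y Z : E) :
    extDeriv η y ![X, Y, Z] = fderiv ℝ η y X ![Y, Z] - fderiv ℝ η y Y ![X, Z] +
      fderiv ℝ η y Z ![X, Y] := by
  have h0 : (0 : Fin 3).removeNth ![X, Y, Z] = ![Y, Z] := by funext i; fin_cases i <;> rfl
  have h1 : (1 : Fin 3).removeNth ![X, Y, Z] = ![X, Z] := by funext i; fin_cases i <;> rfl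
  have h2 : (2 : Fin 3).removeNth ![X, Y, Z] = ![X, Y] := by funext i; fin_cases i <;> rfl
  rw [extDeriv, ContinuousAlternatingMap.alternatizeUncurryFin_apply, Fin.sum_univ_three, h0, h1,
    h2]
  simp
  abel

theorem extDeriv_three_apply (η : E → E [⋀^Fin 3]→L[ℝ] F) (y : E) (X Y Z W : E) :
    extDeriv η y ![X, Y, Z, W] = fderiv ℝ η y X ![Y, Z, W] - fderiv ℝ η y Y ![X, Z, W] +
      fderiv ℝ η y Z ![X, Y, W] - fderiv ℝ η y W ![X, Y, Z] := by
  have h0 : (0 : Fin 4).removeNth ![X, Y, Z, W] = ![Y, Z, W] := by funext i; fin_cases i <;> rfl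
  have h1 : (1 : Fin 4).removeNth ![X, Y, Z, W] = ![X, Z, W] := by funext i; fin_cases i <;> rfl
  have h2 : (2 : Fin 4).removeNth ![X, Y, Z, W] = ![X, Y, W] := by funext i; fin_cases i <;> rfl
  have h3 : (3 : Fin 4).removeNth ![X, Y, Z, W] = ![X, Y, Z] := by funext i; fin_cases i <;> rfl
  rw [extDeriv, ContinuousAlternatingMap.alternatizeUncurryFin_apply, Fin.sum_univ_four, h0, h1,
    h2, h3]
  simp [pow_succ]
  abel

theorem comp_vec_two {X Y : Type*} (f : X → Y) (a b : X) :
    (fun i => f (![a, b] i)) = ![f a, f b] := by funext i; fin_cases i <;> rfl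

theorem comp_vec_three {X Y : Type*} (f : X → Y) (a b c : X) :
    (fun i => f (![a, b, c] i)) = ![f a, f b, f c] := by funext i; fin_cases i <;> rfl

theorem comp_vec_four {X Y : Type*} (f : X → Y) (a b c d : X) :
    (fun i => f (![a, b, c, d] i)) = ![f a, f b, f c, f d] := by funext i; fin_cases i <;> rfl

theorem compCLM_vec_two (η : ModelV [⋀^Fin 2]→L[ℝ] F) (A : E →L[ℝ] ModelV) (X Y : E) :
    η.compContinuousLinearMap A ![X, Y] = η ![A X, A Y] := by
  rw [← comp_vec_two A]; rfl

theorem compCLM_vec_three (η : ModelV [⋀^Fin 3]→L[ℝ] F) (A : E →L[ℝ] ModelV) (X Y Z : E) :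
    η.compContinuousLinearMap A ![X, Y, Z] = η ![A X, A Y, A Z] := by
  rw [← comp_vec_three A]; rfl

/-- Ω₀ has type (1,1) and Υ₀ type (3,0), and there is no (4,1) in complex dimension three. The same
reason covers the imaginary part. -/
theorem wedge_omegaForm_reForm : wedge omegaForm reForm = 0 := by
  apply ext_fiveForm
  simp only [List.forall_mem_cons]
  refine ⟨?_, ?_, ?_, ?_, ?_, ?_, by simp⟩ <;>
    simp [wedge_two_three, reForm_stdFrame, omegaForm_stdFrame]

theorem wedge_omegaForm_imForm : wedge omegaForm imForm = 0 := by
  apply ext_fiveForm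
  simp only [List.forall_mem_cons]
  refine ⟨?_, ?_, ?_, ?_, ?_, ?_, by simp⟩ <;>
    simp [wedge_two_three, imForm_stdFrame, omegaForm_stdFrame]

/-- The derivative of the relation `η ∧ ρ = 0`. -/
theorem wedge_fderiv_eq_zero {η : E → E [⋀^Fin 2]→L[ℝ] ℝ} {ρ : E → E [⋀^Fin 3]→L[ℝ] ℝ} {y : E}
    (hη : DifferentiableAt ℝ η y) (hρ : DifferentiableAt ℝ ρ y)
    (h : ∀ z, wedge (η z).toAlternatingMap (ρ z).toAlternatingMap = 0) (v : E) :
    wedge (fderiv ℝ η y v).toAlternatingMap (ρ y).toAlternatingMap +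
      wedge (η y).toAlternatingMap (fderiv ℝ ρ y v).toAlternatingMap = 0 := by
  ext X
  have h0 : HasDerivAt (fun t : ℝ => wedge (η (y + t • v)).toAlternatingMap
      (ρ (y + t • v)).toAlternatingMap X) 0 0 := by
    simp only [h]
    exact hasDerivAt_const _ _
  have a := fun w => hasDerivAt_form_line hη v w
  have b := fun w => hasDerivAt_form_line hρ v w
  simp only [wedge_two_three] at h0
  have h1 := (((((((((((a ![X 0, X 1]).mul (b ![X 2, X 3, X 4])).sub
    ((a ![X 0, X 2]).mul (b ![X 1, X 3, X 4]))).add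
    ((a ![X 0, X 3]).mul (b ![X 1, X 2, X 4]))).sub
    ((a ![X 0, X 4]).mul (b ![X 1, X 2, X 3]))).add
    ((a ![X 1, X 2]).mul (b ![X 0, X 3, X 4]))).sub
    ((a ![X 1, X 3]).mul (b ![X 0, X 2, X 4]))).add
    ((a ![X 1, X 4]).mul (b ![X 0, X 2, X 3]))).add
    ((a ![X 2, X 3]).mul (b ![X 0, X 1, X 4]))).sub
    ((a ![X 2, X 4]).mul (b ![X 0, X 1, X 3]))).add
    ((a ![X 3, X 4]).mul (b ![X 0, X 1, X 2])))
  have h2 := h1.unique h0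
  simp only [zero_smul, add_zero] at h2
  rw [AlternatingMap.add_apply, wedge_two_three, wedge_two_three, AlternatingMap.zero_apply]
  simp only [ContinuousAlternatingMap.coe_toAlternatingMap]
  linarith

end LocalRelations

/-! ### The eight relations between dΩ, d Re Υ and d Im Υ. -/

section LocalRelations

variable {E : Type*} [NormedAddCommGroup E] [NormedSpace ℝ E]

theorem modelUpsilon_modelJ_right (X Y Z : ModelV) :
    modelUpsilon ![X, Y, modelJ Z] = Complex.I * modelUpsilon ![X, Y, Z] := by
  simp only [modelUpsilon_apply, Matrix.det_fin_three, Matrix.of_apply, Matrix.cons_val_zero,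
    Matrix.cons_val_one, Matrix.cons_val, modelJ_apply, Sum.elim_inl, Sum.elim_inr]
  push_cast
  ring_nf
  simp only [Complex.I_sq, Complex.I_pow_three, Complex.I_pow_four]
  ring

theorem modelUpsilon_modelJ_middle (X Y Z : ModelV) :
    modelUpsilon ![X, modelJ Y, Z] = Complex.I * modelUpsilon ![X, Y, Z] := by
  simp only [modelUpsilon_apply, Matrix.det_fin_three, Matrix.of_apply, Matrix.cons_val_zero,
    Matrix.cons_val_one, Matrix.cons_val, modelJ_apply, Sum.elim_inl, Sum.elim_inr]
  push_cast
  ring_nf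
  simp only [Complex.I_sq, Complex.I_pow_three, Complex.I_pow_four]
  ring

/-- The derivative of the Plücker relations. -/
theorem pluecker_fderiv {υ : E → E [⋀^Fin 3]→L[ℝ] ℂ} {y : E} (hυ : DifferentiableAt ℝ υ y)
    (A : E → E →L[ℝ] ModelV) (hA : ∀ z, υ z = modelUpsilon.compContinuousLinearMap (A z))
    (v X Y P Q R S : E) :
    fderiv ℝ υ y v ![X, Y, P] * υ y ![Q, R, S] + υ y ![X, Y, P] * fderiv ℝ υ y v ![Q, R, S] -
      (fderiv ℝ υ y v ![X, Y, Q] * υ y ![P, R, S] + υ y ![X, Y, Q] * fderiv ℝ υ y v ![P, R, S]) +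
      (fderiv ℝ υ y v ![X, Y, R] * υ y ![P, Q, S] + υ y ![X, Y, R] * fderiv ℝ υ y v ![P, Q, S]) -
      (fderiv ℝ υ y v ![X, Y, S] * υ y ![P, Q, R] + υ y ![X, Y, S] * fderiv ℝ υ y v ![P, Q, R]) =
      0 := by
  have a := fun w => hasDerivAt_form_line hυ v w
  have h0 : HasDerivAt (fun t : ℝ => υ (y + t • v) ![X, Y, P] * υ (y + t • v) ![Q, R, S] -
      υ (y + t • v) ![X, Y, Q] * υ (y + t • v) ![P, R, S] +
      υ (y + t • v) ![X, Y, R] * υ (y + t • v) ![P, Q, S] -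
      υ (y + t • v) ![X, Y, S] * υ (y + t • v) ![P, Q, R]) 0 0 := by
    simp only [hA, compCLM_vec_three, modelUpsilon_pluecker]
    exact hasDerivAt_const _ _
  have h1 := (((((a ![X, Y, P]).mul (a ![Q, R, S])).sub ((a ![X, Y, Q]).mul (a ![P, R, S]))).add
    ((a ![X, Y, R]).mul (a ![P, Q, S]))).sub ((a ![X, Y, S]).mul (a ![P, Q, R])))
  have h2 := h1.unique h0
  simpa only [zero_smul, add_zero] using h2

/-- The derivative of `Υ` has type `(3,0) + (2,1)`. -/
theorem fderiv_upsilon_type {υ : E → E [⋀^Fin 3]→L[ℝ] ℂ} {y : E} (hυ : DifferentiableAt ℝ υ y)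
    (A : E → E →L[ℝ] ModelV) (hA : ∀ z, υ z = modelUpsilon.compContinuousLinearMap (A z))
    (c : E ≃L[ℝ] ModelV) (hc : A y = c) (v : E) (X P Q : ModelV) :
    fderiv ℝ υ y v ![c.symm X, c.symm P, c.symm Q] +
      Complex.I * fderiv ℝ υ y v ![c.symm X, c.symm (modelJ P), c.symm Q] +
      Complex.I * fderiv ℝ υ y v ![c.symm X, c.symm P, c.symm (modelJ Q)] -
      fderiv ℝ υ y v ![c.symm X, c.symm (modelJ P), c.symm (modelJ Q)] = 0 := by
  -- With e_1, e_2, e_3 as the last vectors and Υ₀(e_1, e_2, e_3) = 1, the differentiated Plücker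
  -- relation expresses the derivative of Υ on (X, Y, W) through terms that contain a value of Υ₀.
  have key := fun Y W => pluecker_fderiv hυ A hA v (c.symm X) (c.symm Y) (c.symm W)
    (c.symm (stdFrame 0)) (c.symm (stdFrame 1)) (c.symm (stdFrame 2))
  have ev : ∀ X Y Z, υ y ![c.symm X, c.symm Y, c.symm Z] = modelUpsilon ![X, Y, Z] := by
    intro X Y Z
    rw [hA, compCLM_vec_three, hc]
    simp
  have h0 : modelUpsilon ![stdFrame 0, stdFrame 1, stdFrame 2] = 1 := by
    simp [modelUpsilon_apply, Matrix.det_fin_three, stdFrame, basisVec]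
  have h1 := key P Q
  have h2 := key (modelJ P) Q
  have h3 := key P (modelJ Q)
  have h4 := key (modelJ P) (modelJ Q)
  simp only [ev, h0, modelUpsilon_modelJ, modelUpsilon_modelJ_right,
    modelUpsilon_modelJ_middle] at h1 h2 h3 h4
  rw [mul_one] at h1 h2 h3 h4
  have e := Complex.I_sq
  generalize fderiv ℝ υ y v = u at *
  -- This is evaluation on X, P + iJP, Q + iJQ. The last two are of type (0,1), and every remaining
  -- term has a factor Υ₀ with one of them as an argument, hence vanishes; the multiple of `e`
  -- collects the uses of i² = -1.
  linear_combination (exp := 1) h1 + Complex.I * h2 + Complex.I * h3 - h4 +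
    (modelUpsilon ![X, P, stdFrame 0] * u ![c.symm Q, c.symm (stdFrame 1), c.symm (stdFrame 2)] -
      modelUpsilon ![X, P, stdFrame 1] * u ![c.symm Q, c.symm (stdFrame 0), c.symm (stdFrame 2)] +
      modelUpsilon ![X, P, stdFrame 2] * u ![c.symm Q, c.symm (stdFrame 0), c.symm (stdFrame 1)] -
      modelUpsilon ![X, P, Q] *
        u ![c.symm (stdFrame 0), c.symm (stdFrame 1), c.symm (stdFrame 2)] +
      modelUpsilon ![Q, stdFrame 1, stdFrame 2] * u ![c.symm X, c.symm P, c.symm (stdFrame 0)] -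
      modelUpsilon ![Q, stdFrame 0, stdFrame 2] * u ![c.symm X, c.symm P, c.symm (stdFrame 1)] +
      modelUpsilon ![Q, stdFrame 0, stdFrame 1] * u ![c.symm X, c.symm P, c.symm (stdFrame 2)]) * e

/-- The exterior derivative of `Υ` has no component of type `(1,3)`. -/
theorem extDeriv_upsilon_type {υ : E → E [⋀^Fin 3]→L[ℝ] ℂ} {y : E} (hυ : DifferentiableAt ℝ υ y)
    (A : E → E →L[ℝ] ModelV) (hA : ∀ z, υ z = modelUpsilon.compContinuousLinearMap (A z))
    (c : E ≃L[ℝ] ModelV) (hc : A y = c) (X P Q R : ModelV) :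
    let η := fun X P Q R => extDeriv υ y ![c.symm X, c.symm P, c.symm Q, c.symm R]
    η X P Q R + Complex.I * (η X (modelJ P) Q R + η X P (modelJ Q) R + η X P Q (modelJ R)) -
      (η X (modelJ P) (modelJ Q) R + η X (modelJ P) Q (modelJ R) + η X P (modelJ Q) (modelJ R)) -
      Complex.I * η X (modelJ P) (modelJ Q) (modelJ R) = 0 := by
  intro η
  have t := fun v X P Q => fderiv_upsilon_type hυ A hA c hc (c.symm v) X P Q
  have e := Complex.I_sq
  simp only [η, extDeriv_three_apply]
  let u := fun v X P Q => fderiv ℝ υ y (c.symm v) ![c.symm X, c.symm P, c.symm Q]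
  -- The goal is the value on X and three vectors of type (0,1). In each term of the alternating sum
  -- the derivative direction takes one of the four slots, which leaves at least two vectors of type
  -- (0,1) in the differentiated Υ, where the type lemma gives zero.
  linear_combination (exp := 1) t X P Q R + Complex.I * t X (modelJ P) Q R -
    t P X Q R - Complex.I * t (modelJ P) X Q R + t Q X P R + Complex.I * t (modelJ Q) X P R -
    t R X P Q - Complex.I * t (modelJ R) X P Q +
    (-u X (modelJ P) (modelJ Q) R + u (modelJ P) X (modelJ Q) R - u (modelJ Q) X (modelJ P) R -
      u X (modelJ P) Q (modelJ R) + u (modelJ P) X Q (modelJ R) + u (modelJ R) X (modelJ P) Q -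
      u (modelJ Q) X P (modelJ R) + u (modelJ R) X P (modelJ Q)) * e

/-- The derivative of the relation `Ω ∧ ρ = 0`, alternated and read in a coframe. -/
theorem extDeriv_relation {ζ : E → E [⋀^Fin 2]→L[ℝ] ℝ} {ρ : E → E [⋀^Fin 3]→L[ℝ] ℝ} {y : E}
    (hζ : DifferentiableAt ℝ ζ y) (hρ : DifferentiableAt ℝ ρ y)
    (h : ∀ z, wedge (ζ z).toAlternatingMap (ρ z).toAlternatingMap = 0)
    (c : E ≃L[ℝ] ModelV) (ρ₀ : ModelV [⋀^Fin 3]→ₗ[ℝ] ℝ)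
    (hc : (ζ y).toAlternatingMap.compLinearMap (c.symm : ModelV →ₗ[ℝ] E) = omegaForm)
    (hc' : (ρ y).toAlternatingMap.compLinearMap (c.symm : ModelV →ₗ[ℝ] E) = ρ₀) (v : ModelV) :
    wedge ((fderiv ℝ ζ y (c.symm v)).toAlternatingMap.compLinearMap (c.symm : ModelV →ₗ[ℝ] E)) ρ₀ +
      wedge omegaForm
        ((fderiv ℝ ρ y (c.symm v)).toAlternatingMap.compLinearMap (c.symm : ModelV →ₗ[ℝ] E)) =
      0 := by
  have h1 := wedge_fderiv_eq_zero hζ hρ h (c.symm v)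
  rw [← hc, ← hc', wedge_compLinearMap, wedge_compLinearMap, ← AlternatingMap.add_compLinearMap,
    h1, AlternatingMap.zero_compLinearMap]

theorem toAlternatingMap_compLinearMap_two (c : E ≃L[ℝ] ModelV) (η : E [⋀^Fin 2]→L[ℝ] ℝ)
    (X Y : ModelV) : η.toAlternatingMap.compLinearMap (c.symm : ModelV →ₗ[ℝ] E) ![X, Y] =
      η ![c.symm X, c.symm Y] := by
  rw [← comp_vec_two c.symm]; rfl

theorem toAlternatingMap_compLinearMap_three (c : E ≃L[ℝ] ModelV) (η : E [⋀^Fin 3]→L[ℝ] ℝ)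
    (X Y Z : ModelV) : η.toAlternatingMap.compLinearMap (c.symm : ModelV →ₗ[ℝ] E) ![X, Y, Z] =
      η ![c.symm X, c.symm Y, c.symm Z] := by
  rw [← comp_vec_three c.symm]; rfl

theorem toAlternatingMap_compLinearMap_four (c : E ≃L[ℝ] ModelV) (η : E [⋀^Fin 4]→L[ℝ] ℝ)
    (X Y Z W : ModelV) : η.toAlternatingMap.compLinearMap (c.symm : ModelV →ₗ[ℝ] E) ![X, Y, Z, W] =
      η ![c.symm X, c.symm Y, c.symm Z, c.symm W] := by
  rw [← comp_vec_four c.symm]; rfl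

/-- This is the single component of dΩ ∧ Re Υ + Ω ∧ d Re Υ = 0: the derivative of Ω ∧ Re Υ = 0 in
each basis direction is evaluated on the other five basis vectors and the results are combined with
signs. It makes the two expressions for τ̂0 agree. -/
theorem torsionRelations_re {ζ : E → E [⋀^Fin 2]→L[ℝ] ℝ} {ρ : E → E [⋀^Fin 3]→L[ℝ] ℝ} {y : E}
    (hζ : DifferentiableAt ℝ ζ y) (hρ : DifferentiableAt ℝ ρ y)
    (h : ∀ z, wedge (ζ z).toAlternatingMap (ρ z).toAlternatingMap = 0) (c : E ≃L[ℝ] ModelV)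
    (hc : (ζ y).toAlternatingMap.compLinearMap (c.symm : ModelV →ₗ[ℝ] E) = omegaForm)
    (hc' : (ρ y).toAlternatingMap.compLinearMap (c.symm : ModelV →ₗ[ℝ] E) = reForm) :
    let a := fun i j k =>
      extDeriv ζ y ![c.symm (stdFrame i), c.symm (stdFrame j), c.symm (stdFrame k)]
    let b := fun i j k l => extDeriv ρ y ![c.symm (stdFrame i), c.symm (stdFrame j),
      c.symm (stdFrame k), c.symm (stdFrame l)]
    a 0 1 5 - a 0 2 4 + a 1 2 3 - a 3 4 5 = -(b 0 1 3 4 + b 0 2 3 5 + b 1 2 4 5) := by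
  intro a b
  have r := fun v X => DFunLike.congr_fun (extDeriv_relation hζ hρ h c _ hc hc' v) X
  have r0 := r (stdFrame 0) ![stdFrame 1, stdFrame 2, stdFrame 3, stdFrame 4, stdFrame 5]
  have r1 := r (stdFrame 1) ![stdFrame 0, stdFrame 2, stdFrame 3, stdFrame 4, stdFrame 5]
  have r2 := r (stdFrame 2) ![stdFrame 0, stdFrame 1, stdFrame 3, stdFrame 4, stdFrame 5]
  have r3 := r (stdFrame 3) ![stdFrame 0, stdFrame 1, stdFrame 2, stdFrame 4, stdFrame 5]
  have r4 := r (stdFrame 4) ![stdFrame 0, stdFrame 1, stdFrame 2, stdFrame 3, stdFrame 5]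
  have r5 := r (stdFrame 5) ![stdFrame 0, stdFrame 1, stdFrame 2, stdFrame 3, stdFrame 4]
  simp only [AlternatingMap.add_apply, AlternatingMap.zero_apply, wedge_two_three,
    Matrix.cons_val_zero, Matrix.cons_val_one, Matrix.cons_val, omegaForm_stdFrame,
    reForm_stdFrame, toAlternatingMap_compLinearMap_two, toAlternatingMap_compLinearMap_three]
    at r0 r1 r2 r3 r4 r5
  simp only [a, b, extDeriv_two_apply, extDeriv_three_apply]
  linarith

/-- The same argument for Ω ∧ Im Υ = 0; it makes the two expressions for τ0 agree. -/
theorem torsionRelations_im {ζ : E → E [⋀^Fin 2]→L[ℝ] ℝ} {ρ : E → E [⋀^Fin 3]→L[ℝ] ℝ} {y : E}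
    (hζ : DifferentiableAt ℝ ζ y) (hρ : DifferentiableAt ℝ ρ y)
    (h : ∀ z, wedge (ζ z).toAlternatingMap (ρ z).toAlternatingMap = 0) (c : E ≃L[ℝ] ModelV)
    (hc : (ζ y).toAlternatingMap.compLinearMap (c.symm : ModelV →ₗ[ℝ] E) = omegaForm)
    (hc' : (ρ y).toAlternatingMap.compLinearMap (c.symm : ModelV →ₗ[ℝ] E) = imForm) :
    let a := fun i j k =>
      extDeriv ζ y ![c.symm (stdFrame i), c.symm (stdFrame j), c.symm (stdFrame k)]
    let b := fun i j k l => extDeriv ρ y ![c.symm (stdFrame i), c.symm (stdFrame j),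
      c.symm (stdFrame k), c.symm (stdFrame l)]
    a 0 1 2 - a 0 4 5 + a 1 3 5 - a 2 3 4 = b 0 1 3 4 + b 0 2 3 5 + b 1 2 4 5 := by
  intro a b
  have r := fun v X => DFunLike.congr_fun (extDeriv_relation hζ hρ h c _ hc hc' v) X
  have r0 := r (stdFrame 0) ![stdFrame 1, stdFrame 2, stdFrame 3, stdFrame 4, stdFrame 5]
  have r1 := r (stdFrame 1) ![stdFrame 0, stdFrame 2, stdFrame 3, stdFrame 4, stdFrame 5]
  have r2 := r (stdFrame 2) ![stdFrame 0, stdFrame 1, stdFrame 3, stdFrame 4, stdFrame 5]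
  have r3 := r (stdFrame 3) ![stdFrame 0, stdFrame 1, stdFrame 2, stdFrame 4, stdFrame 5]
  have r4 := r (stdFrame 4) ![stdFrame 0, stdFrame 1, stdFrame 2, stdFrame 3, stdFrame 5]
  have r5 := r (stdFrame 5) ![stdFrame 0, stdFrame 1, stdFrame 2, stdFrame 3, stdFrame 4]
  simp only [AlternatingMap.add_apply, AlternatingMap.zero_apply, wedge_two_three,
    Matrix.cons_val_zero, Matrix.cons_val_one, Matrix.cons_val, omegaForm_stdFrame,
    imForm_stdFrame, toAlternatingMap_compLinearMap_two, toAlternatingMap_compLinearMap_three]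
    at r0 r1 r2 r3 r4 r5
  simp only [a, b, extDeriv_two_apply, extDeriv_three_apply]
  linarith

theorem alternating_four {V : Type*} [AddCommGroup V] [Module ℝ V] (β : V [⋀^Fin 4]→ₗ[ℝ] ℝ)
    (X Y Z W : V) : β ![X, X, Z, W] = 0 ∧ β ![X, Y, X, W] = 0 ∧ β ![X, Y, Z, X] = 0 ∧
      β ![X, Y, Z, W] = -β ![Y, X, Z, W] ∧ β ![X, Y, Z, W] = -β ![X, Z, Y, W] ∧
      β ![X, Y, Z, W] = -β ![X, Y, W, Z] := by
  refine ⟨β.map_eq_zero_of_eq _ (i := 0) (j := 1) rfl (by decide),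
    β.map_eq_zero_of_eq _ (i := 0) (j := 2) rfl (by decide),
    β.map_eq_zero_of_eq _ (i := 0) (j := 3) rfl (by decide), ?_, ?_, ?_⟩
  · rw [← β.map_swap _ (show (0 : Fin 4) ≠ 1 by decide)]
    congr 1; funext i; fin_cases i <;> rfl
  · rw [← β.map_swap _ (show (1 : Fin 4) ≠ 2 by decide)]
    congr 1; funext i; fin_cases i <;> rfl
  · rw [← β.map_swap _ (show (2 : Fin 4) ≠ 3 by decide)]
    congr 1; funext i; fin_cases i <;> rfl

/-- The values of an alternating four-form on the unordered tuples of basis vectors that occur in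
the component of type `(1,3)`. -/
theorem fourForm_sorted (β : ModelV [⋀^Fin 4]→ₗ[ℝ] ℝ) :
    let f := fun i j k l => β ![stdFrame i, stdFrame j, stdFrame k, stdFrame l]
    f 0 3 1 2 = f 0 1 2 3 ∧ f 0 3 4 2 = f 0 2 3 4 ∧ f 0 3 1 5 = -f 0 1 3 5 ∧
    f 1 0 4 2 = f 0 1 2 4 ∧ f 1 3 4 2 = f 1 2 3 4 ∧ f 1 0 4 5 = -f 0 1 4 5 ∧
    f 2 0 1 5 = f 0 1 2 5 ∧ f 2 3 1 5 = f 1 2 3 5 ∧ f 2 0 4 5 = -f 0 2 4 5 := by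
  intro f
  have s1 : ∀ i j k l, f i j k l = -f j i k l := fun i j k l =>
    (alternating_four β _ _ _ _).2.2.2.1
  have s2 : ∀ i j k l, f i j k l = -f i k j l := fun i j k l =>
    (alternating_four β _ _ _ _).2.2.2.2.1
  have s3 : ∀ i j k l, f i j k l = -f i j l k := fun i j k l =>
    (alternating_four β _ _ _ _).2.2.2.2.2
  refine ⟨?_, ?_, ?_, ?_, ?_, ?_, ?_, ?_, ?_⟩
  · rw [s2, s3, neg_neg]
  · rw [s3, s2, neg_neg]
  · rw [s2]
  · rw [s1, s3, neg_neg]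
  · rw [s3, s2, neg_neg]
  · rw [s1]
  · rw [s1, s2, neg_neg]
  · rw [s2, s1, neg_neg]
  · rw [s1]

/-- The vanishing of the (1,3) part of dΥ, tested on X = e_1, e_2, e_3 and on the (0,1) parts of
e_1, e_2, e_3, gives three complex equations, that is six real ones, which are exactly the
components of the claimed identity. -/
theorem torsionRelations_lee {υ : E → E [⋀^Fin 3]→L[ℝ] ℂ} {y : E} (hυ : DifferentiableAt ℝ υ y)
    (A : E → E →L[ℝ] ModelV) (hA : ∀ z, υ z = modelUpsilon.compContinuousLinearMap (A z))
    (c : E ≃L[ℝ] ModelV) (hc : A y = c) {b b' : ModelV [⋀^Fin 4]→ₗ[ℝ] ℝ}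
    (hb : ∀ X, b X = (extDeriv υ y fun i => c.symm (X i)).re)
    (hb' : ∀ X, b' X = (extDeriv υ y fun i => c.symm (X i)).im) :
    leePart b' = (leePart b).comp modelJ := by
  have t := fun X P Q R => extDeriv_upsilon_type hυ A hA c hc X P Q R
  have e : ∀ X P Q R, extDeriv υ y ![c.symm X, c.symm P, c.symm Q, c.symm R] =
      (b ![X, P, Q, R] : ℂ) + Complex.I * b' ![X, P, Q, R] := by
    intro X P Q R
    rw [hb, hb', comp_vec_four]
    apply Complex.ext <;> simp
  simp only [e] at t
  have t0 := t (stdFrame 0) (stdFrame 0) (stdFrame 1) (stdFrame 2)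
  have t1 := t (stdFrame 1) (stdFrame 0) (stdFrame 1) (stdFrame 2)
  have t2 := t (stdFrame 2) (stdFrame 0) (stdFrame 1) (stdFrame 2)
  have z1 := fun (β : ModelV [⋀^Fin 4]→ₗ[ℝ] ℝ) X Z W => (alternating_four β X X Z W).1
  have z2 := fun (β : ModelV [⋀^Fin 4]→ₗ[ℝ] ℝ) X Y W => (alternating_four β X Y X W).2.1
  have z3 := fun (β : ModelV [⋀^Fin 4]→ₗ[ℝ] ℝ) X Y Z => (alternating_four β X Y Z X).2.2.1
  simp only [modelJ_stdFrame, z1, z2, z3, fourForm_sorted] at t0 t1 t2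
  simp [Complex.ext_iff] at t0 t1 t2
  refine ext_covec fun i => ?_
  rw [ContinuousLinearMap.comp_apply]
  fin_cases i <;>
    simp only [Fin.zero_eta, Fin.mk_one, Fin.reduceFinMk, modelJ_stdFrame, map_neg, leePart,
      covecOf_stdFrame] <;> simp <;> linarith

end LocalRelations

/-! ### Forms in the preferred charts. -/

section Chart

variable {n : ℕ} {M : Type*} [TopologicalSpace M] [ChartedSpace (EuclideanSpace ℝ (Fin n)) M]

/-- The derivative of the inverse of the preferred chart at `x`. -/
def chartSymmDeriv (x : M) (y : EuclideanSpace ℝ (Fin n)) :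
    EuclideanSpace ℝ (Fin n) →L[ℝ] EuclideanSpace ℝ (Fin n) :=
  mfderiv 𝓘(ℝ, EuclideanSpace ℝ (Fin n)) (𝓡 n) (extChartAt (𝓡 n) x).symm y

/-- A tangent space is read in the preferred chart at its own base point, so at that point the chart
has identity derivative. Formulas at `x` therefore carry no Jacobian. -/
theorem chartSymmDeriv_self [IsManifold (𝓡 n) ∞ M] (x : M) :
    chartSymmDeriv x (extChartAt (𝓡 n) x x) =
      ContinuousLinearMap.id ℝ (EuclideanSpace ℝ (Fin n)) := by
  have : IsManifold (𝓡 n) 1 M := IsManifold.of_le (n := ∞) (by norm_num)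
  have h := mfderivWithin_range_extChartAt_symm (I := 𝓡 n) (x := x)
  rw [ModelWithCorners.range_eq_univ, mfderivWithin_univ] at h
  exact h

variable {F : Type*} [NormedAddCommGroup F] [NormedSpace ℝ F] {k : ℕ}

theorem formD_eq [IsManifold (𝓡 n) ∞ M] (η : RoughForm n M F k) (x : M) :
    formD η x = extDeriv (formInChart η x) (extChartAt (𝓡 n) x x) := by
  have : IsManifold (𝓡 n) 1 M := IsManifold.of_le (n := ∞) (by norm_num)
  have h := mfderiv_extChartAt_self (I := 𝓡 n) (x := x)
  unfold formD
  rw [h]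
  rfl

theorem IsSmoothForm.differentiableAt {η : RoughForm n M F k} (hη : IsSmoothForm η) (x : M) :
    DifferentiableAt ℝ (formInChart η x) (extChartAt (𝓡 n) x x) :=
  ((hη x).contDiffAt (extChartAt_target_mem_nhds x)).differentiableAt (by simp)

end Chart

section Pullback

variable {E : Type*} [NormedAddCommGroup E] [NormedSpace ℝ E] (A : E →L[ℝ] ModelV)

theorem toAlternatingMap_pullback_omega :
    (modelOmega.compContinuousLinearMap A).toAlternatingMap =
      omegaForm.compLinearMap (A : E →ₗ[ℝ] ModelV) := rfl

theorem toAlternatingMap_pullback_re :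
    (Complex.reCLM.compContinuousAlternatingMap
      (modelUpsilon.compContinuousLinearMap A)).toAlternatingMap =
      reForm.compLinearMap (A : E →ₗ[ℝ] ModelV) := rfl

theorem toAlternatingMap_pullback_im :
    (Complex.imCLM.compContinuousAlternatingMap
      (modelUpsilon.compContinuousLinearMap A)).toAlternatingMap =
      imForm.compLinearMap (A : E →ₗ[ℝ] ModelV) := rfl

theorem wedge_pullback_re : wedge (modelOmega.compContinuousLinearMap A).toAlternatingMap
    (Complex.reCLM.compContinuousAlternatingMap
      (modelUpsilon.compContinuousLinearMap A)).toAlternatingMap = 0 := by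
  rw [toAlternatingMap_pullback_omega, toAlternatingMap_pullback_re, wedge_compLinearMap,
    wedge_omegaForm_reForm, AlternatingMap.zero_compLinearMap]

theorem wedge_pullback_im : wedge (modelOmega.compContinuousLinearMap A).toAlternatingMap
    (Complex.imCLM.compContinuousAlternatingMap
      (modelUpsilon.compContinuousLinearMap A)).toAlternatingMap = 0 := by
  rw [toAlternatingMap_pullback_omega, toAlternatingMap_pullback_im, wedge_compLinearMap,
    wedge_omegaForm_imForm, AlternatingMap.zero_compLinearMap]

end Pullback

/-! ### Existence and uniqueness of the torsion forms. -/

namespace SU3Structure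

variable {M : Type*} [TopologicalSpace M] [ChartedSpace (EuclideanSpace ℝ (Fin 6)) M]
  (S : SU3Structure M)

/-- A coframe at `x`, as a map on the Euclidean space underlying the tangent space. -/
def euclCoframe (x : M) : EuclideanSpace ℝ (Fin 6) ≃L[ℝ] ModelV := S.coframe x

/-- A coframe, in the preferred chart at `x`. -/
def chartCoframe (x : M) (y : EuclideanSpace ℝ (Fin 6)) : EuclideanSpace ℝ (Fin 6) →L[ℝ] ModelV :=
  (S.euclCoframe ((extChartAt (𝓡 6) x).symm y) : EuclideanSpace ℝ (Fin 6) →L[ℝ] ModelV).comp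
    (chartSymmDeriv x y)

/-- This holds at every `y`, even off the chart's target, where the linear map may be degenerate.
Identities of the model forms thus hold everywhere in the chart space and can be differentiated
without restricting to a neighbourhood. -/
theorem formInChart_Omega (x : M) (y : EuclideanSpace ℝ (Fin 6)) :
    formInChart S.Omega x y = modelOmega.compContinuousLinearMap (S.chartCoframe x y) := by
  unfold formInChart
  rw [(S.isCoframe_coframe _).1]
  rfl

theorem formInChart_Upsilon (x : M) (y : EuclideanSpace ℝ (Fin 6)) :
    formInChart S.Upsilon x y = modelUpsilon.compContinuousLinearMap (S.chartCoframe x y) := by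
  unfold formInChart
  rw [(S.isCoframe_coframe _).2]
  rfl

theorem metricInChart_metric (x : M) (y : EuclideanSpace ℝ (Fin 6)) (i j : Fin 6) :
    metricInChart S.metric x y i j =
      inner ℝ (S.chartCoframe x y (stdVec i)) (S.chartCoframe x y (stdVec j)) := rfl

theorem chartCoframe_self [IsManifold (𝓡 6) ∞ M] (x : M) :
    S.chartCoframe x (extChartAt (𝓡 6) x x) =
      (S.euclCoframe x : EuclideanSpace ℝ (Fin 6) →L[ℝ] ModelV) := by
  rw [chartCoframe, chartSymmDeriv_self, extChartAt_to_inv, ContinuousLinearMap.comp_id]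

theorem formD_reUpsilon [IsManifold (𝓡 6) ∞ M] (x : M) : formD S.reUpsilon x =
    Complex.reCLM.compContinuousAlternatingMap (formD S.Upsilon x) := by
  rw [formD_eq, formD_eq]
  exact extDeriv_comp_clm Complex.reCLM (S.smooth_Upsilon.differentiableAt x)

theorem formD_imUpsilon [IsManifold (𝓡 6) ∞ M] (x : M) : formD S.imUpsilon x =
    Complex.imCLM.compContinuousAlternatingMap (formD S.Upsilon x) := by
  rw [formD_eq, formD_eq]
  exact extDeriv_comp_clm Complex.imCLM (S.smooth_Upsilon.differentiableAt x)

theorem differentiableAt_comp {E F G : Type*} [NormedAddCommGroup E] [NormedSpace ℝ E]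
    [NormedAddCommGroup F] [NormedSpace ℝ F] [NormedAddCommGroup G] [NormedSpace ℝ G] {k : ℕ}
    (L : F →L[ℝ] G) {η : E → E [⋀^Fin k]→L[ℝ] F} {y : E} (hη : DifferentiableAt ℝ η y) :
    DifferentiableAt ℝ (fun z => L.compContinuousAlternatingMap (η z)) y :=
  (ContinuousLinearMap.compContinuousAlternatingMapCLM ℝ E F G
    (ι := Fin k) L).differentiableAt.comp y hη

theorem torsionRelations [IsManifold (𝓡 6) ∞ M] (x : M) : TorsionRelations
    ((formD S.Omega x).toAlternatingMap.compLinearMap ((S.coframe x).symm : ModelV →ₗ[ℝ] _))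
    ((formD S.reUpsilon x).toAlternatingMap.compLinearMap ((S.coframe x).symm : ModelV →ₗ[ℝ] _))
    ((formD S.imUpsilon x).toAlternatingMap.compLinearMap
      ((S.coframe x).symm : ModelV →ₗ[ℝ] _)) := by
  let c := S.euclCoframe x
  have hΩ := S.smooth_Omega.differentiableAt x
  have hΥ := S.smooth_Upsilon.differentiableAt x
  have hc := S.chartCoframe_self x
  have hO : (formInChart S.Omega x (extChartAt (𝓡 6) x x)).toAlternatingMap.compLinearMap
      (c.symm : ModelV →ₗ[ℝ] _) = omegaForm := by
    rw [formInChart_Omega, hc]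
    exact compLinearMap_comp_symm c omegaForm
  have hR : (Complex.reCLM.compContinuousAlternatingMap (formInChart S.Upsilon x
      (extChartAt (𝓡 6) x x))).toAlternatingMap.compLinearMap
      (c.symm : ModelV →ₗ[ℝ] _) = reForm := by
    rw [formInChart_Upsilon, hc]
    exact compLinearMap_comp_symm c reForm
  have hI : (Complex.imCLM.compContinuousAlternatingMap (formInChart S.Upsilon x
      (extChartAt (𝓡 6) x x))).toAlternatingMap.compLinearMap
      (c.symm : ModelV →ₗ[ℝ] _) = imForm := by
    rw [formInChart_Upsilon, hc]
    exact compLinearMap_comp_symm c imForm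
  have wR : ∀ z, wedge (formInChart S.Omega x z).toAlternatingMap
      (Complex.reCLM.compContinuousAlternatingMap (formInChart S.Upsilon x z)).toAlternatingMap =
      0 := by
    intro z
    rw [formInChart_Omega, formInChart_Upsilon, wedge_pullback_re]
  have wI : ∀ z, wedge (formInChart S.Omega x z).toAlternatingMap
      (Complex.imCLM.compContinuousAlternatingMap (formInChart S.Upsilon x z)).toAlternatingMap =
      0 := by
    intro z
    rw [formInChart_Omega, formInChart_Upsilon, wedge_pullback_im]
  have eO := formD_eq S.Omega x
  have eR := formD_eq S.reUpsilon x
  have eI := formD_eq S.imUpsilon x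
  refine ⟨?_, ?_, ?_⟩
  · have h := torsionRelations_re hΩ (differentiableAt_comp Complex.reCLM hΥ) wR c hO hR
    simp only [← toAlternatingMap_compLinearMap_three c, ← toAlternatingMap_compLinearMap_four c]
      at h
    rw [eO, eR]
    exact h
  · have h := torsionRelations_im hΩ (differentiableAt_comp Complex.imCLM hΥ) wI c hO hI
    simp only [← toAlternatingMap_compLinearMap_three c, ← toAlternatingMap_compLinearMap_four c]
      at h
    rw [eO, eI]
    exact h
  · refine torsionRelations_lee hΥ (S.chartCoframe x) (S.formInChart_Upsilon x) c hc ?_ ?_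
    · intro X
      rw [formD_reUpsilon, formD_eq]
      rfl
    · intro X
      rw [formD_imUpsilon, formD_eq]
      rfl

theorem existsUnique_isTorsion [IsManifold (𝓡 6) ∞ M] (x : M) :
    ∃! τ : TorsionForms (TangentSpace (𝓡 6) x), S.IsTorsion x τ := by
  have hc := S.isCoframe_coframe x
  have h := (S.torsionRelations x).isModelTorsion
  refine ⟨_, (hc.isTorsion_iff (TorsionForms.pull _ (S.coframe x))).mpr
    (by rw [TorsionForms.push_pull]; exact h), fun τ hτ => ?_⟩
  rw [← ((hc.isTorsion_iff τ).mp hτ).eq_modelTorsion, TorsionForms.pull_push]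

end SU3Structure

/-! ### The special Lagrangian calibration on the model space. -/

section ModelCalibration

/-- The complex coordinates of a vector of the model space. -/
def complexCoord (X : ModelV) (p : Fin 3) : ℂ := (X (Sum.inl p) : ℂ) + Complex.I * X (Sum.inr p)

theorem modelUpsilon_eq_det (X : Fin 3 → ModelV) :
    modelUpsilon X = Matrix.det (Matrix.of fun a b => complexCoord (X a) b) := rfl

theorem modelOmega_apply (X Y : ModelV) : modelOmega ![X, Y] =
    ∑ p : Fin 3, (X (Sum.inl p) * Y (Sum.inr p) - X (Sum.inr p) * Y (Sum.inl p)) := by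
  simp only [modelOmega, ContinuousAlternatingMap.sum_apply, dualVec₂_apply]

theorem inner_modelV (X Y : ModelV) : inner ℝ X Y =
    ∑ p : Fin 3, (X (Sum.inl p) * Y (Sum.inl p) + X (Sum.inr p) * Y (Sum.inr p)) := by
  rw [PiLp.inner_apply, Fintype.sum_sum_type, Finset.sum_add_distrib]
  simp [mul_comm]

/-- The real and imaginary parts of the standard Hermitian product are the metric and -Ω₀, so one
complex identity controls both. -/
theorem complexCoord_hermitian (X Y : ModelV) :
    ∑ p, complexCoord X p * (starRingEnd ℂ) (complexCoord Y p) =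
      (inner ℝ X Y : ℝ) - Complex.I * (modelOmega ![X, Y] : ℝ) := by
  rw [inner_modelV, modelOmega_apply]
  push_cast
  rw [Finset.mul_sum, ← Finset.sum_sub_distrib]
  refine Finset.sum_congr rfl fun p _ => ?_
  simp only [complexCoord, map_add, map_mul, Complex.conj_ofReal, Complex.conj_I]
  ring_nf
  simp only [Complex.I_sq]
  ring

/-- If Z and W are the matrices of complex coordinates of the two triples, this is det Z · conj(det
W) = det(Z W*), and the entries of Z W* are Hermitian products. -/
theorem modelUpsilon_mul_conj (X Y : Fin 3 → ModelV) :
    modelUpsilon X * (starRingEnd ℂ) (modelUpsilon Y) =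
      Matrix.det (Matrix.of fun a b => ((inner ℝ (X a) (Y b) : ℝ) : ℂ) -
        Complex.I * (modelOmega ![X a, Y b] : ℝ)) := by
  rw [modelUpsilon_eq_det, modelUpsilon_eq_det, ← Complex.star_def, ← Matrix.det_conjTranspose,
    ← Matrix.det_mul]
  congr 1
  ext a b
  rw [Matrix.mul_apply]
  exact complexCoord_hermitian (X a) (Y b)

theorem modelOmega_swap (X Y : ModelV) : modelOmega ![X, Y] = -modelOmega ![Y, X] := by
  rw [modelOmega_apply, modelOmega_apply, ← Finset.sum_neg_distrib]
  exact Finset.sum_congr rfl fun p _ => by ring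

/-- The real part of `e^{-iθ} Υ₀`. -/
def modelPhase (θ : ℝ) (X : Fin 3 → ModelV) : ℝ :=
  (Complex.exp (-(θ * Complex.I)) * modelUpsilon X).re

/-- The determinant is linear in row c, the only one with an imaginary part, so that part
contributes only an imaginary number. -/
theorem re_det_sub_I_mul_of_row {G W : Matrix (Fin 3) (Fin 3) ℝ} {c : Fin 3}
    (hW : ∀ a b, a ≠ c → W a b = 0) :
    (Matrix.det (Matrix.of fun a b => ((G a b : ℝ) : ℂ) - Complex.I * (W a b : ℝ))).re = G.det := by
  rw [Matrix.det_fin_three, Matrix.det_fin_three]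
  fin_cases c
  · have h1 := fun b => hW 1 b (by decide)
    have h2 := fun b => hW 2 b (by decide)
    simp [h1, h2]
  · have h1 := fun b => hW 0 b (by decide)
    have h2 := fun b => hW 2 b (by decide)
    simp [h1, h2]
  · have h1 := fun b => hW 0 b (by decide)
    have h2 := fun b => hW 1 b (by decide)
    simp [h1, h2]

/-- Terms of odd order in W are imaginary. The quadratic term is minus the value of G on the axial
vector of W. -/
theorem re_det_sub_I_mul_of_skew {G W : Matrix (Fin 3) (Fin 3) ℝ} (hG : ∀ a b, G a b = G b a)
    (hW : ∀ a b, W a b = -W b a) :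
    (Matrix.det (Matrix.of fun a b => ((G a b : ℝ) : ℂ) - Complex.I * (W a b : ℝ))).re = G.det -
      ∑ a, ∑ b, ![W 1 2, W 2 0, W 0 1] a * ![W 1 2, W 2 0, W 0 1] b * G a b := by
  have h0 : ∀ a, W a a = 0 := fun a => by linarith [hW a a]
  rw [Matrix.det_fin_three, Matrix.det_fin_three]
  simp [Fin.sum_univ_three, h0, hG 1 0, hG 2 0, hG 2 1, hW 1 0, hW 2 0, hW 2 1]
  ring

/-- The special Lagrangian calibration inequality. -/
theorem sq_modelPhase_le_det (θ : ℝ) (X : Fin 3 → ModelV) :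
    modelPhase θ X ^ 2 ≤ Matrix.det (Matrix.of fun a b => inner ℝ (X a) (X b)) := by
  have h1 : modelPhase θ X ^ 2 ≤ Complex.normSq (modelUpsilon X) := by
    have h2 : Complex.normSq (Complex.exp (-(θ * Complex.I)) * modelUpsilon X) =
        Complex.normSq (modelUpsilon X) := by
      rw [map_mul, Complex.normSq_eq_norm_sq (Complex.exp _)]
      have : ‖Complex.exp (-(θ * Complex.I))‖ = 1 := by
        rw [← neg_mul, ← Complex.ofReal_neg, Complex.norm_exp_ofReal_mul_I]
      rw [this]; simp
    rw [← h2, Complex.normSq_apply, modelPhase]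
    nlinarith [mul_self_nonneg (Complex.exp (-(θ * Complex.I)) * modelUpsilon X).im]
  have h3 := congrArg Complex.re (modelUpsilon_mul_conj X X)
  rw [Complex.mul_conj, Complex.ofReal_re] at h3
  rw [h3] at h1
  refine h1.trans ?_
  -- The defect in the inequality is the squared norm of this combination of the X_a, whose
  -- coefficients are the axial vector of the matrix Ω₀(X_a, X_b).
  have hn := real_inner_self_nonneg (x := modelOmega ![X 1, X 2] • X 0 +
    modelOmega ![X 2, X 0] • X 1 + modelOmega ![X 0, X 1] • X 2)
  have e := re_det_sub_I_mul_of_skew (G := Matrix.of fun a b => inner ℝ (X a) (X b))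
    (W := Matrix.of fun a b => modelOmega ![X a, X b])
    (fun a b => real_inner_comm (X b) (X a)) (fun a b => modelOmega_swap (X a) (X b))
  simp only [Matrix.of_apply] at e
  rw [e]
  simp only [inner_add_left, inner_add_right, inner_smul_left, inner_smul_right,
    RCLike.conj_to_real] at hn
  rw [sub_le_self_iff]
  refine hn.trans (le_of_eq ?_)
  simp only [Fin.sum_univ_three, Matrix.cons_val_zero, Matrix.cons_val_one, Matrix.cons_val]
  ring

/-- Polarization of the equality case of the calibration inequality. -/
theorem det_inner_eq_of_calibrated (θ : ℝ) {Y : Fin 3 → ModelV}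
    (hΩ : ∀ a b, modelOmega ![Y a, Y b] = 0)
    (hΥ : (Complex.exp (-(θ * Complex.I)) * modelUpsilon Y).im = 0) (c : Fin 3) (X : ModelV) :
    Matrix.det (Matrix.of fun a b => inner ℝ (Function.update Y c X a) (Y b)) =
      modelPhase θ (Function.update Y c X) * modelPhase θ Y := by
  have h := congrArg Complex.re (modelUpsilon_mul_conj (Function.update Y c X) Y)
  have hY : modelUpsilon Y = Complex.exp (θ * Complex.I) * (modelPhase θ Y : ℝ) := by
    have h1 : Complex.exp (-(θ * Complex.I)) * modelUpsilon Y = (modelPhase θ Y : ℝ) := by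
      apply Complex.ext
      · simp [modelPhase]
      · rw [hΥ]; simp
    rw [← h1, ← mul_assoc, ← Complex.exp_add]
    simp
  have hL : (modelUpsilon (Function.update Y c X) * (starRingEnd ℂ) (modelUpsilon Y)).re =
      modelPhase θ (Function.update Y c X) * modelPhase θ Y := by
    rw [hY, map_mul, Complex.conj_ofReal, ← Complex.exp_conj, map_mul, Complex.conj_ofReal,
      Complex.conj_I, ← mul_assoc, Complex.re_mul_ofReal, modelPhase]
    congr 2
    rw [mul_comm, mul_neg]
  rw [← hL, h]
  refine (re_det_sub_I_mul_of_row (G := Matrix.of fun a b => inner ℝ (Function.update Y c X a) (Y b))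
    (W := Matrix.of fun a b => modelOmega ![Function.update Y c X a, Y b]) (c := c) ?_).symm
  intro a b hab
  rw [Matrix.of_apply, Function.update_of_ne hab, hΩ]

/-- Expansion of the polarized determinant along row c, by Cramer's rule. The adjugate of the Gram
matrix is φ² times its inverse, so the left side has the shape of the trace that defines the mean
curvature. -/
theorem sum_inner_mul_adjugate_of_calibrated (θ : ℝ) {Y : Fin 3 → ModelV}
    (hΩ : ∀ a b, modelOmega ![Y a, Y b] = 0)
    (hΥ : (Complex.exp (-(θ * Complex.I)) * modelUpsilon Y).im = 0) (c : Fin 3) (X : ModelV) :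
    ∑ b, inner ℝ X (Y b) * (Matrix.of fun a b => inner ℝ (Y a) (Y b)).adjugate b c =
      modelPhase θ (Function.update Y c X) * modelPhase θ Y := by
  rw [← det_inner_eq_of_calibrated θ hΩ hΥ]
  have h1 : (Matrix.of fun a b => inner ℝ (Function.update Y c X a) (Y b)) =
      (Matrix.of fun a b => inner ℝ (Y a) (Y b)).updateRow c fun b => inner ℝ X (Y b) := by
    ext a b
    rcases eq_or_ne a c with rfl | h
    · simp
    · simp [h]
  rw [h1, ← Matrix.cramer_transpose_apply, Matrix.cramer_eq_adjugate_mulVec, Matrix.mulVec,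
    dotProduct, ← Matrix.adjugate_transpose]
  exact Finset.sum_congr rfl fun b _ => mul_comm _ _

end ModelCalibration

/-! ### Mean curvature in coordinates without Christoffel symbols. -/

section RiemannianLocal

variable {m n : ℕ}

/-- The bilinear form with a given coefficient matrix. -/
def bilinOf (M : Matrix (Fin n) (Fin n) ℝ) :
    EuclideanSpace ℝ (Fin n) →ₗ[ℝ] EuclideanSpace ℝ (Fin n) →ₗ[ℝ] ℝ :=
  LinearMap.mk₂ ℝ (fun X Y => ∑ i, ∑ j, M i j * X i * Y j)
    (fun X X' Y => by
      simp only [PiLp.add_apply, mul_add, add_mul, Finset.sum_add_distrib])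
    (fun c X Y => by
      simp only [PiLp.smul_apply, smul_eq_mul, Finset.mul_sum]
      exact Finset.sum_congr rfl fun i _ => Finset.sum_congr rfl fun j _ => by ring)
    (fun X Y Y' => by
      simp only [PiLp.add_apply, mul_add, Finset.sum_add_distrib])
    (fun c X Y => by
      simp only [PiLp.smul_apply, smul_eq_mul, Finset.mul_sum]
      exact Finset.sum_congr rfl fun i _ => Finset.sum_congr rfl fun j _ => by ring)

theorem bilinOf_apply (M : Matrix (Fin n) (Fin n) ℝ) (X Y : EuclideanSpace ℝ (Fin n)) :
    bilinOf M X Y = ∑ i, ∑ j, M i j * X i * Y j := rfl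

theorem bilinOf_comm {M : Matrix (Fin n) (Fin n) ℝ} (hM : ∀ i j, M i j = M j i)
    (X Y : EuclideanSpace ℝ (Fin n)) : bilinOf M X Y = bilinOf M Y X := by
  rw [bilinOf_apply, bilinOf_apply, Finset.sum_comm]
  refine Finset.sum_congr rfl fun i _ => Finset.sum_congr rfl fun j _ => ?_
  rw [hM]; ring

variable (G : EuclideanSpace ℝ (Fin n) → Matrix (Fin n) (Fin n) ℝ)

/-- The derivative of the matrix field `G` in the direction `v`. -/
def matrixDeriv (y v : EuclideanSpace ℝ (Fin n)) : Matrix (Fin n) (Fin n) ℝ :=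
  Matrix.of fun i j => fderiv ℝ (fun z => G z i j) y v

theorem matrixDeriv_eq_sum (y v : EuclideanSpace ℝ (Fin n)) (i j : Fin n) :
    matrixDeriv G y v i j = ∑ k, v k * fderiv ℝ (fun z => G z i j) y (stdVec k) := by
  have hv : v = ∑ k, v k • stdVec k := by
    ext l
    simp [stdVec, Finset.sum_apply, Pi.single_apply]
  change fderiv ℝ (fun z => G z i j) y v = _
  conv_lhs => rw [hv]
  rw [map_sum]
  simp

theorem matrixDeriv_symm (hG : ∀ z i j, G z i j = G z j i) (y v : EuclideanSpace ℝ (Fin n))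
    (i j : Fin n) : matrixDeriv G y v i j = matrixDeriv G y v j i := by
  simp only [matrixDeriv, Matrix.of_apply, hG _ i j]

variable {G}

theorem sum_mul_christoffel (hs : ∀ z i j, G z i j = G z j i) {y : EuclideanSpace ℝ (Fin n)}
    (hG : IsUnit (G y).det) (l i j : Fin n) : ∑ k, G y k l * christoffel G y k i j =
      (1 / 2) * (fderiv ℝ (fun z => G z j l) y (stdVec i) +
        fderiv ℝ (fun z => G z i l) y (stdVec j) - fderiv ℝ (fun z => G z i j) y (stdVec l)) := by
  set T : Fin n → ℝ := fun l => fderiv ℝ (fun z => G z j l) y (stdVec i) +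
    fderiv ℝ (fun z => G z i l) y (stdVec j) - fderiv ℝ (fun z => G z i j) y (stdVec l) with hT
  have h1 : (G y).mulVec ((G y)⁻¹.mulVec T) = T := by
    rw [Matrix.mulVec_mulVec, Matrix.mul_nonsing_inv _ hG, Matrix.one_mulVec]
  have h2 := congrFun h1 l
  have h3 : ∑ k, G y k l * christoffel G y k i j =
      (1 / 2) * (G y).mulVec ((G y)⁻¹.mulVec T) l := by
    rw [Matrix.mulVec, dotProduct, Finset.mul_sum]
    refine Finset.sum_congr rfl fun k _ => ?_
    rw [hs y k l]
    change G y l k * ((1 / 2) * ∑ l, (G y)⁻¹ k l * T l) = _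
    rw [Matrix.mulVec, dotProduct]
    ring
  rw [h3, h2]

/-- The quadratic term of the covariant derivative. -/
def christoffelVec (G : EuclideanSpace ℝ (Fin n) → Matrix (Fin n) (Fin n) ℝ)
    (y X Y : EuclideanSpace ℝ (Fin n)) : EuclideanSpace ℝ (Fin n) :=
  WithLp.toLp 2 fun k => ∑ i, ∑ j, christoffel G y k i j * X i * Y j

/-- The Koszul formula. -/
theorem bilinOf_christoffelVec (hs : ∀ z i j, G z i j = G z j i) {y : EuclideanSpace ℝ (Fin n)}
    (hG : IsUnit (G y).det) (X Y Z : EuclideanSpace ℝ (Fin n)) :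
    bilinOf (G y) (christoffelVec G y X Y) Z = (1 / 2) * (bilinOf (matrixDeriv G y X) Y Z +
      bilinOf (matrixDeriv G y Y) X Z - bilinOf (matrixDeriv G y Z) X Y) := by
  have h1 : bilinOf (G y) (christoffelVec G y X Y) Z =
      ∑ l, ∑ i, ∑ j, (∑ k, G y k l * christoffel G y k i j) * (X i * Y j * Z l) := by
    rw [bilinOf_apply, Finset.sum_comm]
    refine Finset.sum_congr rfl fun l _ => ?_
    simp only [christoffelVec, Finset.sum_mul, Finset.mul_sum]
    rw [Finset.sum_comm]
    refine Finset.sum_congr rfl fun i _ => ?_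
    rw [Finset.sum_comm]
    exact Finset.sum_congr rfl fun j _ => Finset.sum_congr rfl fun k _ => by ring
  have h2 : bilinOf (matrixDeriv G y X) Y Z =
      ∑ l, ∑ i, ∑ j, fderiv ℝ (fun z => G z j l) y (stdVec i) * (X i * Y j * Z l) := by
    rw [bilinOf_apply, Finset.sum_comm]
    refine Finset.sum_congr rfl fun l _ => ?_
    simp only [matrixDeriv_eq_sum, Finset.sum_mul]
    rw [Finset.sum_comm]
    exact Finset.sum_congr rfl fun j _ => Finset.sum_congr rfl fun k _ => by ring
  have h3 : bilinOf (matrixDeriv G y Y) X Z =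
      ∑ l, ∑ i, ∑ j, fderiv ℝ (fun z => G z i l) y (stdVec j) * (X i * Y j * Z l) := by
    rw [bilinOf_apply, Finset.sum_comm]
    refine Finset.sum_congr rfl fun l _ => ?_
    simp only [matrixDeriv_eq_sum, Finset.sum_mul]
    exact Finset.sum_congr rfl fun j _ => Finset.sum_congr rfl fun k _ => by ring
  have h4 : bilinOf (matrixDeriv G y Z) X Y =
      ∑ l, ∑ i, ∑ j, fderiv ℝ (fun z => G z i j) y (stdVec l) * (X i * Y j * Z l) := by
    rw [bilinOf_apply]
    simp only [matrixDeriv_eq_sum, Finset.sum_mul]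
    rw [Finset.sum_comm_cycle]
    refine Finset.sum_congr rfl fun l _ => ?_
    exact Finset.sum_congr rfl fun j _ => Finset.sum_congr rfl fun k _ => by ring
  rw [h1, h2, h3, h4, ← Finset.sum_add_distrib, ← Finset.sum_sub_distrib, Finset.mul_sum]
  refine Finset.sum_congr rfl fun l _ => ?_
  rw [← Finset.sum_add_distrib, ← Finset.sum_sub_distrib, Finset.mul_sum]
  refine Finset.sum_congr rfl fun i _ => ?_
  rw [← Finset.sum_add_distrib, ← Finset.sum_sub_distrib, Finset.mul_sum]
  refine Finset.sum_congr rfl fun j _ => ?_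
  rw [sum_mul_christoffel hs hG]
  ring

variable (G) (Φ : EuclideanSpace ℝ (Fin m) → EuclideanSpace ℝ (Fin n))
  (s : EuclideanSpace ℝ (Fin m))

theorem inducedMetric_apply (a b : Fin m) : inducedMetric G Φ s a b =
    bilinOf (G (Φ s)) (fderiv ℝ Φ s (stdVec a)) (fderiv ℝ Φ s (stdVec b)) := rfl

/-- The second derivative of `Φ`. -/
def secondDeriv (a b : Fin m) : EuclideanSpace ℝ (Fin n) :=
  fderiv ℝ (fun z => fderiv ℝ Φ z (stdVec b)) s (stdVec a)

theorem toLp_covHessian (a b : Fin m) : WithLp.toLp 2 (fun k => covHessian G Φ s a b k) =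
    secondDeriv Φ s a b + christoffelVec G (Φ s) (fderiv ℝ Φ s (stdVec a))
      (fderiv ℝ Φ s (stdVec b)) := rfl

theorem toLp_normalPart (Z : Fin n → ℝ) :
    WithLp.toLp 2 (normalPart G Φ s Z) = WithLp.toLp 2 Z - ∑ a, ∑ b, ((inducedMetric G Φ s)⁻¹ a b *
      bilinOf (G (Φ s)) (WithLp.toLp 2 Z) (fderiv ℝ Φ s (stdVec a))) • fderiv ℝ Φ s (stdVec b) := by
  ext k
  simp [normalPart, bilinOf_apply]

theorem coordMeanCurvature_eq : coordMeanCurvature G Φ s =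
    ∑ a, ∑ b, (inducedMetric G Φ s)⁻¹ a b • WithLp.toLp 2 (normalPart G Φ s
      fun k => covHessian G Φ s a b k) := by
  ext k
  simp [coordMeanCurvature]

variable {G Φ s}

theorem bilinOf_normalPart_normal {X : EuclideanSpace ℝ (Fin n)}
    (hX : ∀ a, bilinOf (G (Φ s)) (fderiv ℝ Φ s (stdVec a)) X = 0) (Z : Fin n → ℝ) :
    bilinOf (G (Φ s)) (WithLp.toLp 2 (normalPart G Φ s Z)) X =
      bilinOf (G (Φ s)) (WithLp.toLp 2 Z) X := by
  rw [toLp_normalPart]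
  simp [hX]

theorem bilinOf_normalPart_tangent (hs : ∀ z i j, G z i j = G z j i)
    (hh : IsUnit (inducedMetric G Φ s).det) (Z : Fin n → ℝ) (c : Fin m) :
    bilinOf (G (Φ s)) (WithLp.toLp 2 (normalPart G Φ s Z)) (fderiv ℝ Φ s (stdVec c)) = 0 := by
  set ζ : Fin m → ℝ := fun a => bilinOf (G (Φ s)) (WithLp.toLp 2 Z) (fderiv ℝ Φ s (stdVec a)) with hζ
  have hsymm : (inducedMetric G Φ s).transpose = inducedMetric G Φ s := by
    ext a b
    rw [Matrix.transpose_apply, inducedMetric_apply, inducedMetric_apply, bilinOf_comm (hs _)]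
  have h1 : (inducedMetric G Φ s).mulVec ((inducedMetric G Φ s)⁻¹.mulVec ζ) = ζ := by
    rw [Matrix.mulVec_mulVec, Matrix.mul_nonsing_inv _ hh, Matrix.one_mulVec]
  have h2 : ∀ a b, (inducedMetric G Φ s)⁻¹ a b = (inducedMetric G Φ s)⁻¹ b a := by
    intro a b
    conv_lhs => rw [← hsymm, ← Matrix.transpose_nonsing_inv]
    rfl
  have hsymm' : ∀ a b, inducedMetric G Φ s a b = inducedMetric G Φ s b a := fun a b =>
    congrFun (congrFun hsymm b) a
  have h3 := congrFun h1 c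
  rw [toLp_normalPart]
  simp only [map_sub, map_sum, map_smul, LinearMap.sub_apply, LinearMap.sum_apply,
    LinearMap.smul_apply, smul_eq_mul]
  rw [sub_eq_zero]
  change ζ c = _
  rw [← h3, Matrix.mulVec, dotProduct, Finset.sum_comm]
  refine Finset.sum_congr rfl fun b _ => ?_
  rw [Matrix.mulVec, dotProduct, Finset.mul_sum]
  refine Finset.sum_congr rfl fun a _ => ?_
  rw [h2 a b, ← inducedMetric_apply, hsymm' b c]
  simp only [hζ]
  ring

theorem bilinOf_coordMeanCurvature_tangent (hs : ∀ z i j, G z i j = G z j i)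
    (hh : IsUnit (inducedMetric G Φ s).det) (c : Fin m) :
    bilinOf (G (Φ s)) (coordMeanCurvature G Φ s) (fderiv ℝ Φ s (stdVec c)) = 0 := by
  rw [coordMeanCurvature_eq]
  simp only [map_sum, map_smul, LinearMap.sum_apply, LinearMap.smul_apply,
    bilinOf_normalPart_tangent hs hh, smul_zero, Finset.sum_const_zero]

/-- Against a normal vector the tangential correction disappears, and the Koszul formula trades the
connection for first derivatives of G. What is left can be compared with derivatives of the
calibration. -/
theorem bilinOf_coordMeanCurvature_normal (hs : ∀ z i j, G z i j = G z j i)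
    (hG : IsUnit (G (Φ s)).det) {X : EuclideanSpace ℝ (Fin n)}
    (hX : ∀ a, bilinOf (G (Φ s)) (fderiv ℝ Φ s (stdVec a)) X = 0) :
    bilinOf (G (Φ s)) (coordMeanCurvature G Φ s) X =
      ∑ a, ∑ b, (inducedMetric G Φ s)⁻¹ a b * (bilinOf (G (Φ s)) (secondDeriv Φ s a b) X +
        (1 / 2) * (bilinOf (matrixDeriv G (Φ s) (fderiv ℝ Φ s (stdVec a)))
            (fderiv ℝ Φ s (stdVec b)) X +
          bilinOf (matrixDeriv G (Φ s) (fderiv ℝ Φ s (stdVec b))) (fderiv ℝ Φ s (stdVec a)) X -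
          bilinOf (matrixDeriv G (Φ s) X) (fderiv ℝ Φ s (stdVec a))
            (fderiv ℝ Φ s (stdVec b)))) := by
  rw [coordMeanCurvature_eq]
  simp only [map_sum, map_smul, LinearMap.sum_apply, LinearMap.smul_apply, smul_eq_mul,
    bilinOf_normalPart_normal hX, toLp_covHessian, map_add, LinearMap.add_apply,
    bilinOf_christoffelVec hs hG]

end RiemannianLocal

/-! ### Mean curvature from the first derivative of a calibration. -/

section CalibratedLocal

open Topology Filter

/-- At a zero of f the slope of f g is the slope of f times g, so g need only be continuous. This
avoids differentiating the adjugate of the induced metric. -/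
theorem hasDerivAt_mul_of_eq_zero {f g : ℝ → ℝ} {f' t : ℝ} (hf : HasDerivAt f f' t) (h0 : f t = 0)
    (hg : ContinuousAt g t) : HasDerivAt (fun x => f x * g x) (f' * g t) t := by
  rw [hasDerivAt_iff_tendsto_slope] at hf ⊢
  have h1 := hf.mul (hg.tendsto.mono_left nhdsWithin_le_nhds)
  refine h1.congr fun x => ?_
  simp only [slope_def_field, h0]
  ring

section

variable {E F : Type*} [NormedAddCommGroup E] [NormedSpace ℝ E] [NormedAddCommGroup F]
  [NormedSpace ℝ F] {k : ℕ}

theorem hasDerivAt_form_curve {η : E → E [⋀^Fin k]→L[ℝ] F} {γ : ℝ → E} {γ' : E}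
    {W : Fin k → ℝ → E} {W' : Fin k → E} {t : ℝ} (hη : DifferentiableAt ℝ η (γ t))
    (hγ : HasDerivAt γ γ' t) (hW : ∀ i, HasDerivAt (W i) (W' i) t) :
    HasDerivAt (fun x => η (γ x) fun i => W i x) (fderiv ℝ η (γ t) γ' (fun i => W i t) +
      ∑ i, η (γ t) (Function.update (fun i => W i t) i (W' i))) t := by
  have h1 := (hη.hasFDerivAt.comp_hasDerivAt t hγ).hasFDerivAt
  have h2 := (h1.continuousAlternatingMap_apply fun i => (hW i).hasFDerivAt).hasDerivAt
  simp only [add_apply, ContinuousLinearMap.comp_apply,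
    sum_apply, ContinuousLinearMap.toSpanSingleton_apply, one_smul] at h2
  exact h2

theorem alternating_three_swap (η : E [⋀^Fin 3]→L[ℝ] F) (X Y Z : E) :
    η ![Y, X, Z] = -η ![X, Y, Z] := by
  have h := η.toAlternatingMap.map_swap ![X, Y, Z] (show (0 : Fin 3) ≠ 1 by decide)
  have e : (![X, Y, Z] : Fin 3 → E) ∘ Equiv.swap 0 1 = ![Y, X, Z] := by
    funext i; fin_cases i <;> rfl
  rw [e] at h
  exact h

theorem alternating_three_rotate (η : E [⋀^Fin 3]→L[ℝ] F) (X Y Z : E) :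
    η ![Y, Z, X] = η ![X, Y, Z] := by
  have h := η.toAlternatingMap.map_swap ![Y, X, Z] (show (1 : Fin 3) ≠ 2 by decide)
  have e : (![Y, X, Z] : Fin 3 → E) ∘ Equiv.swap 1 2 = ![Y, Z, X] := by
    funext i; fin_cases i <;> rfl
  rw [e] at h
  have h' : η ![Y, Z, X] = -η ![Y, X, Z] := h
  rw [h', alternating_three_swap, neg_neg]

/-- The antisymmetry against which the symmetric second derivatives of the immersion cancel. -/
theorem update_update_swap (η : E [⋀^Fin k]→L[ℝ] F) (ξ : Fin k → E) (X S : E) {i c : Fin k}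
    (h : i ≠ c) : η (Function.update (Function.update ξ c X) i S) =
      -η (Function.update (Function.update ξ i X) c S) := by
  have h1 := η.toAlternatingMap.map_swap (Function.update (Function.update ξ i X) c S) h
  have e : Function.update (Function.update ξ i X) c S ∘ Equiv.swap i c =
      Function.update (Function.update ξ c X) i S := by
    funext j
    simp only [Function.comp_apply]
    rcases eq_or_ne j i with rfl | hi
    · simp
    · rcases eq_or_ne j c with rfl | hc
      · simp [h, hi]
      · rw [Equiv.swap_apply_of_ne_of_ne hi hc]
        simp [hi, hc]
  rw [e] at h1
  exact h1

end

/-- Jacobi's formula, by direct expansion. -/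
theorem hasDerivAt_det_three {m : ℝ → Matrix (Fin 3) (Fin 3) ℝ} {m' : Matrix (Fin 3) (Fin 3) ℝ}
    {t : ℝ} (h : ∀ a b, HasDerivAt (fun x => m x a b) (m' a b) t) :
    HasDerivAt (fun x => (m x).det) (∑ a, ∑ b, (m t).adjugate b a * m' a b) t := by
  simp only [Matrix.det_fin_three]
  have h1 := ((((((((h 0 0).mul (h 1 1)).mul (h 2 2)).sub
    (((h 0 0).mul (h 1 2)).mul (h 2 1))).sub
    (((h 0 1).mul (h 1 0)).mul (h 2 2))).add
    (((h 0 1).mul (h 1 2)).mul (h 2 0))).add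
    (((h 0 2).mul (h 1 0)).mul (h 2 1))).sub
    (((h 0 2).mul (h 1 1)).mul (h 2 0)))
  refine h1.congr_deriv ?_
  rw [Matrix.adjugate_fin_three]
  simp [Fin.sum_univ_three]
  ring

variable {n : ℕ} {G : EuclideanSpace ℝ (Fin n) → Matrix (Fin n) (Fin n) ℝ}

theorem hasDerivAt_bilinOf_curve {γ Y : ℝ → EuclideanSpace ℝ (Fin n)}
    {γ' Y' X : EuclideanSpace ℝ (Fin n)} {t : ℝ}
    (hG : ∀ i j, DifferentiableAt ℝ (fun y => G y i j) (γ t)) (hγ : HasDerivAt γ γ' t)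
    (hY : HasDerivAt Y Y' t) : HasDerivAt (fun x => bilinOf (G (γ x)) X (Y x))
      (bilinOf (matrixDeriv G (γ t) γ') X (Y t) + bilinOf (G (γ t)) X Y') t := by
  simp only [bilinOf_apply]
  rw [← Finset.sum_add_distrib]
  refine HasDerivAt.fun_sum fun i _ => ?_
  rw [← Finset.sum_add_distrib]
  refine HasDerivAt.fun_sum fun j _ => ?_
  have h1 : HasDerivAt (fun x => G (γ x) i j) (matrixDeriv G (γ t) γ' i j) t :=
    (hG i j).hasFDerivAt.comp_hasDerivAt t hγ
  have h2 : HasDerivAt (fun x => Y x j) (Y' j) t :=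
    (EuclideanSpace.proj (𝕜 := ℝ) j).hasFDerivAt.comp_hasDerivAt t hY
  exact (h1.mul_const (X i)).mul h2

variable {Φ : EuclideanSpace ℝ (Fin 3) → EuclideanSpace ℝ (Fin n)} {s : EuclideanSpace ℝ (Fin 3)}

/-- The coordinate frame along `Φ`. -/
def coordFrame (Φ : EuclideanSpace ℝ (Fin 3) → EuclideanSpace ℝ (Fin n))
    (s : EuclideanSpace ℝ (Fin 3)) (a : Fin 3) : EuclideanSpace ℝ (Fin n) :=
  fderiv ℝ Φ s (stdVec a)

theorem differentiableAt_coordFrame (hΦ : ContDiffAt ℝ 2 Φ s) (b : Fin 3) :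
    DifferentiableAt ℝ (fun z => coordFrame Φ z b) s := by
  have h : DifferentiableAt ℝ (fderiv ℝ Φ) s :=
    (hΦ.fderiv_right (m := 1) (by norm_num)).differentiableAt (by norm_num)
  exact h.clm_apply (differentiableAt_const _)

theorem secondDeriv_comm (hΦ : ContDiffAt ℝ 2 Φ s) (a b : Fin 3) :
    secondDeriv Φ s a b = secondDeriv Φ s b a := by
  have h : DifferentiableAt ℝ (fderiv ℝ Φ) s :=
    (hΦ.fderiv_right (m := 1) (by norm_num)).differentiableAt (by norm_num)
  have h1 : ∀ a b : Fin 3, secondDeriv Φ s a b =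
      fderiv ℝ (fderiv ℝ Φ) s (stdVec a) (stdVec b) := by
    intro a b
    rw [secondDeriv, fderiv_clm_apply h (differentiableAt_const _)]
    simp
  rw [h1, h1]
  exact hΦ.isSymmSndFDerivAt (by simp) _ _

theorem hasDerivAt_line {E F : Type*} [NormedAddCommGroup E] [NormedSpace ℝ E]
    [NormedAddCommGroup F] [NormedSpace ℝ F] {g : E → F} {x : E} (hg : DifferentiableAt ℝ g x)
    (v : E) : HasDerivAt (fun t : ℝ => g (x + t • v)) (fderiv ℝ g x v) 0 := by
  have h1 : HasDerivAt (fun t : ℝ => x + t • v) v 0 := by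
    simpa using ((hasDerivAt_id (0 : ℝ)).smul_const v).const_add x
  have h2 : HasFDerivAt g (fderiv ℝ g x) (x + (0 : ℝ) • v) := by simpa using hg.hasFDerivAt
  exact h2.comp_hasDerivAt (0 : ℝ) h1

variable {φ : EuclideanSpace ℝ (Fin n) → EuclideanSpace ℝ (Fin n) [⋀^Fin 3]→L[ℝ] ℝ}

/-- First-order consequence of the calibration inequality at a calibrated plane. -/
theorem sum_adjugate_matrixDeriv {y X : EuclideanSpace ℝ (Fin n)}
    {ξ : Fin 3 → EuclideanSpace ℝ (Fin n)} (hG : ∀ i j, DifferentiableAt ℝ (fun y => G y i j) y)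
    (hφ : DifferentiableAt ℝ φ y)
    (hle : ∀ z, φ z ξ ^ 2 ≤ (Matrix.of fun a b => bilinOf (G z) (ξ a) (ξ b)).det)
    (heq : φ y ξ ^ 2 = (Matrix.of fun a b => bilinOf (G y) (ξ a) (ξ b)).det) :
    ∑ a, ∑ b, (Matrix.of fun a b => bilinOf (G y) (ξ a) (ξ b)).adjugate b a *
      bilinOf (matrixDeriv G y X) (ξ a) (ξ b) = 2 * φ y ξ * fderiv ℝ φ y X ξ := by
  have hγ : HasDerivAt (fun t : ℝ => y + t • X) X 0 := by
    simpa using ((hasDerivAt_id (0 : ℝ)).smul_const X).const_add y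
  have hG' : ∀ i j, DifferentiableAt ℝ (fun y => G y i j) (y + (0 : ℝ) • X) := by simpa using hG
  have h1 := hasDerivAt_det_three (t := (0 : ℝ))
    (m := fun t => Matrix.of fun a b => bilinOf (G (y + t • X)) (ξ a) (ξ b))
    (m' := Matrix.of fun a b => bilinOf (matrixDeriv G y X) (ξ a) (ξ b)) (by
      intro a b
      have := hasDerivAt_bilinOf_curve (X := ξ a) hG' hγ (hasDerivAt_const (0 : ℝ) (ξ b))
      simpa using this)
  have h2 := (hasDerivAt_form_line hφ X ξ).pow 2
  have h3 := h1.sub h2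
  -- With the vectors ξ frozen and the base point moving along X, det - φ² is nonnegative by `hle`
  -- and zero at t = 0 by `heq`, so its derivative vanishes there.
  have hmin : IsLocalMin ((fun t : ℝ => (Matrix.of fun a b =>
      bilinOf (G (y + t • X)) (ξ a) (ξ b)).det) - (fun t : ℝ => φ (y + t • X) ξ) ^ 2) 0 := by
    refine Eventually.of_forall fun t => ?_
    simp only [Pi.sub_apply, Pi.pow_apply, zero_smul, add_zero, heq, sub_self, sub_nonneg]
    exact hle _
  have h4 := hmin.hasDerivAt_eq_zero h3
  simp only [zero_smul, add_zero, Matrix.of_apply] at h4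
  rw [sub_eq_zero] at h4
  rw [h4]
  simp

/-- Write ξ for the coordinate frame. The trace defining ⟨H, X⟩, multiplied by φ(ξ)², is a sum of
derivatives along Σ minus half a derivative in the direction X. The polarized equality turns the
first into φ(ξ) times the terms of dφ that differentiate along ξ_c, the minimum principle turns the
second into φ(ξ) times the term that differentiates along X, and together these are -φ(ξ) dφ(X, ξ).
-/
theorem bilinOf_coordMeanCurvature_of_calibrated (hs : ∀ z i j, G z i j = G z j i)
    (hG : ∀ i j, DifferentiableAt ℝ (fun y => G y i j) (Φ s)) (hdet : IsUnit (G (Φ s)).det)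
    (hh : IsUnit (inducedMetric G Φ s).det) (hφ : DifferentiableAt ℝ φ (Φ s))
    (hΦ : ContDiffAt ℝ 2 Φ s)
    (hle : ∀ z (ξ : Fin 3 → EuclideanSpace ℝ (Fin n)),
      φ z ξ ^ 2 ≤ (Matrix.of fun a b => bilinOf (G z) (ξ a) (ξ b)).det)
    (heq : ∀ᶠ z in 𝓝 s, ∀ c X, ∑ b, bilinOf (G (Φ z)) X (coordFrame Φ z b) *
      (inducedMetric G Φ z).adjugate b c =
      φ (Φ z) (Function.update (coordFrame Φ z) c X) * φ (Φ z) (coordFrame Φ z)) :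
    φ (Φ s) (coordFrame Φ s) ≠ 0 ∧ ∀ X : EuclideanSpace ℝ (Fin n),
      (∀ a, bilinOf (G (Φ s)) (coordFrame Φ s a) X = 0) →
      bilinOf (G (Φ s)) (coordMeanCurvature G Φ s) X * φ (Φ s) (coordFrame Φ s) =
        -extDeriv φ (Φ s) ![X, coordFrame Φ s 0, coordFrame Φ s 1, coordFrame Φ s 2] := by
  set ξ := coordFrame Φ s with hξ
  have heq0 := heq.self_of_nhds
  -- For X = ξ_0 and c = 0 the identity `heq` is the expansion of the determinant along a row.
  have hsq : φ (Φ s) ξ ^ 2 = (inducedMetric G Φ s).det := by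
    have h := heq0 0 (ξ 0)
    rw [Function.update_eq_self] at h
    rw [pow_two, ← h, Matrix.det_eq_sum_mul_adjugate_row _ 0]
    rfl
  have hne : φ (Φ s) ξ ≠ 0 := by
    intro h
    rw [h] at hsq
    exact hh.ne_zero (by rw [← hsq]; norm_num)
  refine ⟨hne, fun X hX => ?_⟩
  have hX' : ∀ a, bilinOf (G (Φ s)) X (ξ a) = 0 := fun a => by rw [bilinOf_comm (hs _), hX]
  -- The first cousin principle: a calibration vanishes when one vector of a calibrated frame is
  -- replaced by a normal one.
  have hu0 : ∀ c, φ (Φ s) (Function.update ξ c X) = 0 := by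
    intro c
    have h := heq0 c X
    simp only [← hξ, hX', zero_mul, Finset.sum_const_zero] at h
    exact (mul_eq_zero.mp h.symm).resolve_right hne
  -- the derivative of the calibration identity along the coordinate directions
  have key : ∀ c, ∑ b, (bilinOf (matrixDeriv G (Φ s) (ξ c)) X (ξ b) +
      bilinOf (G (Φ s)) X (secondDeriv Φ s c b)) * (inducedMetric G Φ s).adjugate b c =
      (fderiv ℝ φ (Φ s) (ξ c) (Function.update ξ c X) + ∑ i, φ (Φ s) (Function.update
        (Function.update ξ c X) i (Function.update (secondDeriv Φ s c) c 0 i))) * φ (Φ s) ξ := by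
    intro c
    have hγ : HasDerivAt (fun t : ℝ => Φ (s + t • stdVec c)) (ξ c) 0 :=
      hasDerivAt_line (hΦ.differentiableAt (by norm_num)) _
    have hf : ∀ b, HasDerivAt (fun t : ℝ => coordFrame Φ (s + t • stdVec c) b)
        (secondDeriv Φ s c b) 0 := fun b => hasDerivAt_line (differentiableAt_coordFrame hΦ b) _
    have hG0 : ∀ i j, DifferentiableAt ℝ (fun y => G y i j) (Φ (s + (0 : ℝ) • stdVec c)) := by
      simpa using hG
    have hφ0 : DifferentiableAt ℝ φ (Φ (s + (0 : ℝ) • stdVec c)) := by simpa using hφ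
    have hW : ∀ i, HasDerivAt
        (fun t : ℝ => Function.update (coordFrame Φ (s + t • stdVec c)) c X i)
        (Function.update (secondDeriv Φ s c) c 0 i) 0 := by
      intro i
      rcases eq_or_ne i c with rfl | hi
      · simpa using hasDerivAt_const (0 : ℝ) X
      · simpa [hi] using hf i
    have hφW := hasDerivAt_form_curve hφ0 hγ hW
    have hφξ := hasDerivAt_form_curve hφ0 hγ hf
    have hind : ContinuousAt (fun t : ℝ => inducedMetric G Φ (s + t • stdVec c)) 0 := by
      refine continuousAt_pi.mpr fun a => continuousAt_pi.mpr fun b => ?_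
      have hent : DifferentiableAt ℝ (fun z => inducedMetric G Φ z a b) s := by
        have e : (fun z => inducedMetric G Φ z a b) = fun z => ∑ i, ∑ j,
            G (Φ z) i j * coordFrame Φ z a i * coordFrame Φ z b j := rfl
        rw [e]
        refine DifferentiableAt.fun_sum fun i _ => DifferentiableAt.fun_sum fun j _ => ?_
        have hp : ∀ a i, DifferentiableAt ℝ (fun z => coordFrame Φ z a i) s := fun a i =>
          (EuclideanSpace.proj (𝕜 := ℝ) i).differentiableAt.comp s
            (differentiableAt_coordFrame hΦ a)
        exact (((hG i j).comp s (hΦ.differentiableAt (by norm_num))).mul (hp a i)).mul (hp b j)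
      exact (hasDerivAt_line hent (stdVec c)).continuousAt
    have hadj : ∀ b, ContinuousAt
        (fun t : ℝ => (inducedMetric G Φ (s + t • stdVec c)).adjugate b c) 0 := by
      intro b
      have h1 : Continuous fun M : Matrix (Fin 3) (Fin 3) ℝ => M.adjugate b c :=
        (continuous_id.matrix_adjugate).matrix_elem b c
      exact ContinuousAt.comp (f := fun t : ℝ => inducedMetric G Φ (s + t • stdVec c))
        h1.continuousAt hind
    have hL : HasDerivAt (fun t : ℝ => ∑ b, bilinOf (G (Φ (s + t • stdVec c))) X
        (coordFrame Φ (s + t • stdVec c) b) * (inducedMetric G Φ (s + t • stdVec c)).adjugate b c)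
        (∑ b, (bilinOf (matrixDeriv G (Φ s) (ξ c)) X (ξ b) +
          bilinOf (G (Φ s)) X (secondDeriv Φ s c b)) * (inducedMetric G Φ s).adjugate b c) 0 := by
      refine HasDerivAt.fun_sum fun b _ => ?_
      have h1 := hasDerivAt_bilinOf_curve (X := X) hG0 hγ (hf b)
      have h2 := hasDerivAt_mul_of_eq_zero h1 (by simpa using hX' b) (hadj b)
      simpa using h2
    -- On both sides of `heq` the factor containing X vanishes at s, so only that factor is
    -- differentiated. X itself is held constant and need not stay normal along the curve.
    have hR := hasDerivAt_mul_of_eq_zero hφW (by simpa using hu0 c) hφξ.continuousAt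
    have hev : (fun t : ℝ => ∑ b, bilinOf (G (Φ (s + t • stdVec c))) X
        (coordFrame Φ (s + t • stdVec c) b) *
          (inducedMetric G Φ (s + t • stdVec c)).adjugate b c) =ᶠ[𝓝 0]
        fun t : ℝ => φ (Φ (s + t • stdVec c))
          (fun i => Function.update (coordFrame Φ (s + t • stdVec c)) c X i) *
          φ (Φ (s + t • stdVec c)) fun i => coordFrame Φ (s + t • stdVec c) i := by
      have hc : Tendsto (fun t : ℝ => s + t • stdVec c) (𝓝 0) (𝓝 s) := by
        have : Continuous fun t : ℝ => s + t • (stdVec c : EuclideanSpace ℝ (Fin 3)) := by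
          fun_prop
        simpa using this.tendsto 0
      filter_upwards [hc.eventually heq] with t ht
      exact ht c X
    have := hL.unique (hR.congr_of_eventuallyEq hev)
    simpa using this
  -- The terms (c, i) and (i, c) contain the same second derivative with the slots of X and of that
  -- derivative exchanged, so they cancel; for i = c the inserted vector is 0.
  have hsum : ∑ c, ∑ i, φ (Φ s) (Function.update (Function.update ξ c X) i
      (Function.update (secondDeriv Φ s c) c 0 i)) = 0 := by
    have hz : ∀ c, φ (Φ s) (Function.update (Function.update ξ c X) c 0) = 0 := fun c =>
      (φ (Φ s)).map_coord_zero c (by simp)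
    have hsw := fun c i => secondDeriv_comm (s := s) hΦ c i
    have e01 := update_update_swap (φ (Φ s)) ξ X (secondDeriv Φ s 0 1)
      (show (1 : Fin 3) ≠ 0 by decide)
    have e02 := update_update_swap (φ (Φ s)) ξ X (secondDeriv Φ s 0 2)
      (show (2 : Fin 3) ≠ 0 by decide)
    have e12 := update_update_swap (φ (Φ s)) ξ X (secondDeriv Φ s 1 2)
      (show (2 : Fin 3) ≠ 1 by decide)
    simp only [Fin.sum_univ_three, Function.update_self, hz, ne_eq, Function.update_of_ne,
      show (1 : Fin 3) ≠ 0 by decide, show (2 : Fin 3) ≠ 0 by decide,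
      show (2 : Fin 3) ≠ 1 by decide, show (0 : Fin 3) ≠ 1 by decide,
      show (0 : Fin 3) ≠ 2 by decide, show (1 : Fin 3) ≠ 2 by decide, not_false_eq_true,
      hsw 1 0, hsw 2 0, hsw 2 1]
    linarith
  have hmin := sum_adjugate_matrixDeriv (X := X) (ξ := ξ) hG hφ (fun z => hle z ξ) hsq
  have hadjs : ∀ a b, (inducedMetric G Φ s).adjugate a b = (inducedMetric G Φ s).adjugate b a := by
    have hsymm : (inducedMetric G Φ s).transpose = inducedMetric G Φ s := by
      ext a b
      rw [Matrix.transpose_apply, inducedMetric_apply, inducedMetric_apply, bilinOf_comm (hs _)]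
    intro a b
    conv_lhs => rw [← hsymm, ← Matrix.adjugate_transpose]
    rfl
  -- Since φ(ξ)² is the determinant of the induced metric, this factor clears the inverse in the
  -- trace.
  have hinv : ∀ a b, (inducedMetric G Φ s)⁻¹ a b * φ (Φ s) ξ ^ 2 =
      (inducedMetric G Φ s).adjugate a b := by
    intro a b
    rw [hsq, Matrix.inv_def, Matrix.smul_apply, smul_eq_mul, Ring.inverse_eq_inv']
    field_simp [hh.ne_zero]
  have hH := bilinOf_coordMeanCurvature_normal hs hdet hX
  have hdφ : extDeriv φ (Φ s) ![X, ξ 0, ξ 1, ξ 2] = fderiv ℝ φ (Φ s) X ξ -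
      ∑ c, fderiv ℝ φ (Φ s) (ξ c) (Function.update ξ c X) := by
    have e : ξ = ![ξ 0, ξ 1, ξ 2] := by funext i; fin_cases i <;> rfl
    have e0 : Function.update ξ 0 X = ![X, ξ 1, ξ 2] := by funext i; fin_cases i <;> rfl
    have e1 : Function.update ξ 1 X = ![ξ 0, X, ξ 2] := by funext i; fin_cases i <;> rfl
    have e2 : Function.update ξ 2 X = ![ξ 0, ξ 1, X] := by funext i; fin_cases i <;> rfl
    rw [extDeriv_three_apply, Fin.sum_univ_three, e0, e1, e2, alternating_three_swap _ X (ξ 0),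
      alternating_three_rotate _ X, ← e]
    ring
  have hHs : bilinOf (G (Φ s)) (coordMeanCurvature G Φ s) X * φ (Φ s) ξ ^ 2 =
      ∑ c, ∑ b, (bilinOf (matrixDeriv G (Φ s) (ξ c)) X (ξ b) +
        bilinOf (G (Φ s)) X (secondDeriv Φ s c b)) * (inducedMetric G Φ s).adjugate b c -
      (1 / 2) * ∑ a, ∑ b, (inducedMetric G Φ s).adjugate b a *
        bilinOf (matrixDeriv G (Φ s) X) (ξ a) (ξ b) := by
    have hd : ∀ v : EuclideanSpace ℝ (Fin n), ∀ Y Z, bilinOf (matrixDeriv G (Φ s) v) Y Z =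
      bilinOf (matrixDeriv G (Φ s) v) Z Y := fun v => bilinOf_comm (matrixDeriv_symm G hs _ v)
    change _ = ∑ a, ∑ b, _ * (_ + (1 / 2) * (bilinOf (matrixDeriv G (Φ s) (ξ a)) (ξ b) X +
      bilinOf (matrixDeriv G (Φ s) (ξ b)) (ξ a) X -
      bilinOf (matrixDeriv G (Φ s) X) (ξ a) (ξ b))) at hH
    have h1 : ∑ a, ∑ b, (inducedMetric G Φ s).adjugate a b *
        bilinOf (matrixDeriv G (Φ s) (ξ b)) (ξ a) X =
        ∑ a, ∑ b, (inducedMetric G Φ s).adjugate a b *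
        bilinOf (matrixDeriv G (Φ s) (ξ a)) (ξ b) X := by
      rw [Finset.sum_comm]
      exact Finset.sum_congr rfl fun a _ => Finset.sum_congr rfl fun b _ => by rw [hadjs]
    have h2 : bilinOf (G (Φ s)) (coordMeanCurvature G Φ s) X * φ (Φ s) ξ ^ 2 =
        ∑ a, ∑ b, (inducedMetric G Φ s).adjugate a b * bilinOf (G (Φ s)) (secondDeriv Φ s a b) X +
        (1 / 2) * (∑ a, ∑ b, (inducedMetric G Φ s).adjugate a b *
          bilinOf (matrixDeriv G (Φ s) (ξ a)) (ξ b) X +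
          ∑ a, ∑ b, (inducedMetric G Φ s).adjugate a b *
          bilinOf (matrixDeriv G (Φ s) (ξ b)) (ξ a) X -
          ∑ a, ∑ b, (inducedMetric G Φ s).adjugate a b *
          bilinOf (matrixDeriv G (Φ s) X) (ξ a) (ξ b)) := by
      rw [hH]
      simp only [← Finset.sum_add_distrib, ← Finset.sum_sub_distrib, Finset.sum_mul,
        Finset.mul_sum]
      refine Finset.sum_congr rfl fun a _ => Finset.sum_congr rfl fun b _ => ?_
      rw [← hinv]
      ring
    rw [h2, h1]
    simp only [← Finset.sum_add_distrib, ← Finset.sum_sub_distrib, Finset.mul_sum]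
    refine Finset.sum_congr rfl fun a _ => Finset.sum_congr rfl fun b _ => ?_
    rw [hadjs b a, hd (ξ a) X, bilinOf_comm (hs _) X]
    ring
  have hmin' : ∑ a, ∑ b, (inducedMetric G Φ s).adjugate b a *
        bilinOf (matrixDeriv G (Φ s) X) (ξ a) (ξ b) =
      2 * φ (Φ s) ξ * fderiv ℝ φ (Φ s) X ξ := hmin
  have hkey : ∑ c, ∑ b, (bilinOf (matrixDeriv G (Φ s) (ξ c)) X (ξ b) +
        bilinOf (G (Φ s)) X (secondDeriv Φ s c b)) * (inducedMetric G Φ s).adjugate b c =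
      (∑ c, fderiv ℝ φ (Φ s) (ξ c) (Function.update ξ c X)) * φ (Φ s) ξ := by
    rw [Finset.sum_congr rfl fun c _ => key c, ← Finset.sum_mul, Finset.sum_add_distrib, hsum,
      add_zero]
  rw [hmin', hkey] at hHs
  rw [hdφ]
  refine mul_right_cancel₀ hne ?_
  linear_combination hHs

end CalibratedLocal

/-! ### Differentiability of the metric of an SU(3)-structure. -/

section MetricSmooth

open Topology Filter

theorem complexCoord_modelJ (X : ModelV) (p : Fin 3) :
    complexCoord (modelJ X) p = Complex.I * complexCoord X p := by
  simp only [complexCoord, modelJ_apply, Sum.elim_inl, Sum.elim_inr]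
  push_cast
  ring_nf
  rw [Complex.I_sq]
  ring

theorem complexCoord_injective {X Y : ModelV} (h : ∀ p, complexCoord X p = complexCoord Y p) :
    X = Y := by
  ext i
  rcases i with p | p
  · simpa [complexCoord] using congrArg Complex.re (h p)
  · simpa [complexCoord] using congrArg Complex.im (h p)

/-- The inclusion of the `p`-th complex coordinate line. -/
def complexLine (p : Fin 3) : ℂ →L[ℝ] ModelV :=
  Complex.reCLM.smulRight (basisVec (Sum.inl p)) + Complex.imCLM.smulRight (basisVec (Sum.inr p))

theorem complexCoord_sum_complexLine (z : Fin 3 → ℂ) (q : Fin 3) :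
    complexCoord (∑ p, complexLine p (z p)) q = z q := by
  fin_cases q <;>
    simp [complexCoord, complexLine, basisVec, Fin.sum_univ_three, mul_comm Complex.I]

variable {E : Type*} [NormedAddCommGroup E] [NormedSpace ℝ E]

/-- The map to the model space whose complex coordinates are the contractions of a complex
three-form with pairs of vectors from a given triple. -/
def contractionMap (b : Fin 3 → E) (η : E [⋀^Fin 3]→L[ℝ] ℂ) : E →L[ℝ] ModelV :=
  ∑ p, (complexLine p).comp ((ContinuousAlternatingMap.apply ℝ E ℂ ![b (p + 1), b (p + 2)]).comp
    (ContinuousAlternatingMap.curryLeftLI (𝕜 := ℝ) (E := E) (F := ℂ) (n := 2) η))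

theorem complexCoord_contractionMap (b : Fin 3 → E) (η : E [⋀^Fin 3]→L[ℝ] ℂ) (X : E) (p : Fin 3) :
    complexCoord (contractionMap b η X) p = η ![X, b (p + 1), b (p + 2)] := by
  have h : contractionMap b η X = ∑ p, complexLine p (η ![X, b (p + 1), b (p + 2)]) := by
    rw [contractionMap, sum_apply]
    rfl
  rw [h, complexCoord_sum_complexLine]

theorem differentiableAt_curryLeft {F : Type*} [NormedAddCommGroup F] [NormedSpace ℝ F]
    {η : E → E [⋀^Fin 3]→L[ℝ] F} {y : E} (hη : DifferentiableAt ℝ η y) :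
    DifferentiableAt ℝ (fun z => ContinuousAlternatingMap.curryLeftLI (𝕜 := ℝ) (E := E) (F := F)
      (n := 2) (η z)) y :=
  DifferentiableAt.comp (G := E →L[ℝ] E [⋀^Fin 2]→L[ℝ] F) (F := E [⋀^Fin 3]→L[ℝ] F)
    (g := ContinuousAlternatingMap.curryLeftLI (𝕜 := ℝ) (E := E) (F := F) (n := 2)) y
    (ContinuousAlternatingMap.curryLeftLI (𝕜 := ℝ) (E := E) (F := F)
      (n := 2)).toContinuousLinearMap.differentiableAt hη

theorem differentiableAt_contractionMap (b : Fin 3 → E) {η : E → E [⋀^Fin 3]→L[ℝ] ℂ} {y : E}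
    (hη : DifferentiableAt ℝ η y) : DifferentiableAt ℝ (fun z => contractionMap b (η z)) y := by
  unfold contractionMap
  refine DifferentiableAt.fun_sum fun p _ => ?_
  exact (differentiableAt_const _).clm_comp
    ((differentiableAt_const _).clm_comp (differentiableAt_curryLeft hη))

/-- Υ₀ is complex linear in its first argument. Hence the contraction intertwines the complex
structure induced by A with J₀, whatever the triple `b` is. -/
theorem contractionMap_pullback_J (b : Fin 3 → E) (A : E →L[ℝ] ModelV) {X Y : E}
    (h : A Y = modelJ (A X)) :
    contractionMap b (modelUpsilon.compContinuousLinearMap A) Y =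
      modelJ (contractionMap b (modelUpsilon.compContinuousLinearMap A) X) := by
  refine complexCoord_injective fun p => ?_
  rw [complexCoord_modelJ, complexCoord_contractionMap, complexCoord_contractionMap,
    compCLM_vec_three, compCLM_vec_three, h, modelUpsilon_modelJ]

/-- Contracting Υ₀ with e_{p+1} and e_{p+2}, indices modulo 3, leaves the complex covector e^p + i
e^{p+3}. -/
theorem contractionMap_pullback_self (A : E →L[ℝ] ModelV) {b : Fin 3 → E}
    (hb : ∀ p, A (b p) = basisVec (Sum.inl p)) :
    contractionMap b (modelUpsilon.compContinuousLinearMap A) = A := by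
  ext1 X
  refine complexCoord_injective fun p => ?_
  rw [complexCoord_contractionMap, compCLM_vec_three, hb, hb, modelUpsilon_apply]
  fin_cases p <;> simp [Matrix.det_fin_three, basisVec, complexCoord]

theorem injective_of_contractionMap {b : Fin 3 → E} {A : E →L[ℝ] ModelV}
    (h : Function.Injective (contractionMap b (modelUpsilon.compContinuousLinearMap A))) :
    Function.Injective A := by
  rw [injective_iff_map_eq_zero] at h ⊢
  intro X hX
  refine h X (complexCoord_injective fun p => ?_)
  rw [complexCoord_contractionMap, compCLM_vec_three, hX]
  have h0 : modelUpsilon ![0, A (b (p + 1)), A (b (p + 2))] = 0 :=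
    modelUpsilon.map_coord_zero 0 rfl
  rw [h0]
  simp [complexCoord]

/-- The metric of an `SU(3)`-structure depends differentiably on its forms. -/
theorem differentiableAt_inner_of_pullback [FiniteDimensional ℝ E] [CompleteSpace E]
    (hdim : Module.finrank ℝ E = 6) {A : E → E →L[ℝ] ModelV}
    {y : E} (hΩ : DifferentiableAt ℝ (fun z => modelOmega.compContinuousLinearMap (A z)) y)
    (hΥ : DifferentiableAt ℝ (fun z => modelUpsilon.compContinuousLinearMap (A z)) y)
    (e : E ≃L[ℝ] ModelV) (he : A y = e) (X Y : E) :
    DifferentiableAt ℝ (fun z => (inner ℝ (A z X) (A z Y) : ℝ)) y := by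
  -- The coframes A z are chosen arbitrarily and need not vary differentiably. The map u z, a
  -- contraction of Υ with the fixed triple b, does; it equals A y at y and induces the same almost
  -- complex structure as A z wherever it is invertible.
  set b : Fin 3 → E := fun p => e.symm (basisVec (Sum.inl p)) with hb
  set u : E → E →L[ℝ] ModelV :=
    fun z => contractionMap b (modelUpsilon.compContinuousLinearMap (A z)) with hu
  have huy : u y = e := by
    rw [← he]
    exact contractionMap_pullback_self (A y) fun p => by rw [he, hb]; simp
  have hud : DifferentiableAt ℝ u y := differentiableAt_contractionMap b hΥ
  have hinv : DifferentiableAt ℝ (fun z => ContinuousLinearMap.inverse (u z)) y := by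
    have h1 : DifferentiableAt ℝ ContinuousLinearMap.inverse (u y) := by
      rw [huy]
      exact (contDiffAt_map_inverse (n := 1) e).differentiableAt (by norm_num)
    exact h1.comp y hud
  have hJ : DifferentiableAt ℝ
      (fun z => ContinuousLinearMap.inverse (u z) (modelJ (u z Y))) y :=
    hinv.clm_apply ((differentiableAt_const modelJ).clm_apply
      (hud.clm_apply (differentiableAt_const Y)))
  -- The metric is Ω(X, JY), with J = u⁻¹ J₀ u, so it is built from differentiable pieces.
  have hF : DifferentiableAt ℝ (fun z => modelOmega.compContinuousLinearMap (A z)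
      (fun i => (![fun _ => X, fun z => ContinuousLinearMap.inverse (u z) (modelJ (u z Y))] :
        Fin 2 → E → E) i z)) y := by
    refine hΩ.continuousAlternatingMap_apply fun i => ?_
    fin_cases i
    · exact differentiableAt_const X
    · exact hJ
  refine hF.congr_of_eventuallyEq ?_
  have hev : ∀ᶠ z in 𝓝 y, u z ∈ Set.range ((↑) : (E ≃L[ℝ] ModelV) → E →L[ℝ] ModelV) := by
    refine hud.continuousAt.eventually ?_
    rw [huy]
    exact ContinuousLinearEquiv.nhds e
  filter_upwards [hev] with z ⟨ez, hez⟩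
  have hinj : Function.Injective (A z) := by
    refine injective_of_contractionMap (b := b) ?_
    change Function.Injective (u z)
    rw [← hez]
    exact ez.injective
  have hsurj : Function.Surjective (A z) := by
    have hd : Module.finrank ℝ E = Module.finrank ℝ ModelV := by
      rw [hdim, finrank_euclideanSpace]; rfl
    exact (LinearMap.injective_iff_surjective_of_finrank_eq_finrank hd
      (f := (A z : E →ₗ[ℝ] ModelV))).mp hinj
  obtain ⟨W, hW⟩ := hsurj (modelJ (A z Y))
  have h1 : ContinuousLinearMap.inverse (u z) (modelJ (u z Y)) = W := by
    have h2 : u z W = modelJ (u z Y) := contractionMap_pullback_J b (A z) hW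
    rw [← h2, ← hez, ContinuousLinearMap.inverse_equiv]
    simp
  have h3 : (fun i => (![fun _ => X, fun z => ContinuousLinearMap.inverse (u z) (modelJ (u z Y))] :
      Fin 2 → E → E) i z) = ![X, W] := by
    funext i
    fin_cases i
    · rfl
    · exact h1
  rw [h3, compCLM_vec_two, hW, modelOmega_modelJ]

end MetricSmooth

/-! ### Between charts and tangent spaces. -/

/-- The derivative of a map of manifolds, as a map of Euclidean spaces. -/
def euclDeriv {m n : ℕ} {M : Type*} [TopologicalSpace M]
    [ChartedSpace (EuclideanSpace ℝ (Fin n)) M] {L : Type*}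
    [TopologicalSpace L] [ChartedSpace (EuclideanSpace ℝ (Fin m)) L] (f : L → M) (p : L) :
    EuclideanSpace ℝ (Fin m) →L[ℝ] EuclideanSpace ℝ (Fin n) := mfderiv (𝓡 m) (𝓡 n) f p

open Topology Filter in
-- The chain rule applied to the two expressions of f in charts. It is needed on a whole
-- neighbourhood, not only at the base point, because the calibration identity along the submanifold
-- is differentiated.
theorem eventually_chartSymmDeriv_fderiv {m n : ℕ} {M : Type*} [TopologicalSpace M]
    [ChartedSpace (EuclideanSpace ℝ (Fin n)) M] [IsManifold (𝓡 n) ∞ M] {L : Type*}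
    [TopologicalSpace L] [ChartedSpace (EuclideanSpace ℝ (Fin m)) L] [IsManifold (𝓡 m) ∞ L]
    {f : L → M} (hf : ContMDiff (𝓡 m) (𝓡 n) ∞ f) (p : L) :
    ∀ᶠ s in 𝓝 (extChartAt (𝓡 m) p p), ∃ q : L,
      (extChartAt (𝓡 n) (f p)).symm ((extChartAt (𝓡 n) (f p) ∘ f ∘ (extChartAt (𝓡 m) p).symm) s) =
        f q ∧ q = (extChartAt (𝓡 m) p).symm s ∧ ∀ v : EuclideanSpace ℝ (Fin m),
      chartSymmDeriv (f p) ((extChartAt (𝓡 n) (f p) ∘ f ∘ (extChartAt (𝓡 m) p).symm) s)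
        (fderiv ℝ (extChartAt (𝓡 n) (f p) ∘ f ∘ (extChartAt (𝓡 m) p).symm) s v) =
      euclDeriv f q (chartSymmDeriv p s v) := by
  have : IsManifold (𝓡 n) 1 M := IsManifold.of_le (n := ∞) (by norm_num)
  have : IsManifold (𝓡 m) 1 L := IsManifold.of_le (n := ∞) (by norm_num)
  set σ := (extChartAt (𝓡 m) p).symm with hσ
  set s₀ := extChartAt (𝓡 m) p p with hs₀
  have h1 : ∀ᶠ s in 𝓝 s₀, s ∈ (extChartAt (𝓡 m) p).target := extChartAt_target_mem_nhds p
  have h2 : ∀ᶠ s in 𝓝 s₀, f (σ s) ∈ (extChartAt (𝓡 n) (f p)).source := by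
    have hc : ContinuousAt (fun s => f (σ s)) s₀ := by
      refine ContinuousAt.comp hf.continuous.continuousAt ?_
      exact continuousAt_extChartAt_symm p
    refine hc.eventually (IsOpen.mem_nhds (isOpen_extChartAt_source (f p)) ?_)
    change f ((extChartAt (𝓡 m) p).symm (extChartAt (𝓡 m) p p)) ∈ (extChartAt (𝓡 n) (f p)).source
    rw [extChartAt_to_inv]
    exact mem_extChartAt_source (f p)
  filter_upwards [h1.eventually_nhds, h2.eventually_nhds] with s e1 e2
  have hs1 := e1.self_of_nhds
  have hs2 := e2.self_of_nhds
  refine ⟨σ s, (extChartAt (𝓡 n) (f p)).left_inv hs2, rfl, fun v => ?_⟩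
  set Φ := extChartAt (𝓡 n) (f p) ∘ f ∘ σ with hΦ
  have dσ : MDifferentiableAt 𝓘(ℝ, EuclideanSpace ℝ (Fin m)) (𝓡 m) σ s := by
    have h := mdifferentiableWithinAt_extChartAt_symm (I := 𝓡 m) hs1
    rwa [ModelWithCorners.range_eq_univ, mdifferentiableWithinAt_univ] at h
  have df : MDifferentiableAt (𝓡 m) (𝓡 n) f (σ s) := hf.mdifferentiableAt (by simp)
  have dχ : MDifferentiableAt (𝓡 n) 𝓘(ℝ, EuclideanSpace ℝ (Fin n)) (extChartAt (𝓡 n) (f p))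
      (f (σ s)) := mdifferentiableAt_extChartAt (by rwa [← extChartAt_source (𝓡 n)])
  have dΦ : MDifferentiableAt 𝓘(ℝ, EuclideanSpace ℝ (Fin m)) 𝓘(ℝ, EuclideanSpace ℝ (Fin n)) Φ s :=
    dχ.comp s (df.comp s dσ)
  have dχ' : MDifferentiableAt 𝓘(ℝ, EuclideanSpace ℝ (Fin n)) (𝓡 n)
      (extChartAt (𝓡 n) (f p)).symm (Φ s) := by
    have h := mdifferentiableWithinAt_extChartAt_symm (I := 𝓡 n)
      ((extChartAt (𝓡 n) (f p)).map_source hs2)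
    rwa [ModelWithCorners.range_eq_univ, mdifferentiableWithinAt_univ] at h
  have hev : (extChartAt (𝓡 n) (f p)).symm ∘ Φ =ᶠ[𝓝 s] f ∘ σ := by
    filter_upwards [e2] with z hz
    exact (extChartAt (𝓡 n) (f p)).left_inv hz
  have hm := hev.mfderiv_eq (I := 𝓘(ℝ, EuclideanSpace ℝ (Fin m))) (I' := 𝓡 n)
  rw [mfderiv_comp s dχ' dΦ, mfderiv_comp s df dσ, mfderiv_eq_fderiv] at hm
  exact congrArg (fun A : EuclideanSpace ℝ (Fin m) →L[ℝ] EuclideanSpace ℝ (Fin n) => A v) hm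

/-- The real part of `e^{-iθ} z`. -/
def phaseCLM (θ : ℝ) : ℂ →L[ℝ] ℝ :=
  Real.cos θ • Complex.reCLM + Real.sin θ • Complex.imCLM

theorem phaseCLM_apply (θ : ℝ) (z : ℂ) :
    phaseCLM θ z = (Complex.exp (-(θ * Complex.I)) * z).re := by
  rw [← neg_mul, ← Complex.ofReal_neg, Complex.exp_mul_I, ← Complex.ofReal_cos,
    ← Complex.ofReal_sin]
  simp [phaseCLM]
  rw [Complex.cos_ofReal_re, Complex.sin_ofReal_re]

theorem isUnit_det_gram_of_injective {n : ℕ} {W : Type*} [NormedAddCommGroup W]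
    [InnerProductSpace ℝ W] {A : EuclideanSpace ℝ (Fin n) →L[ℝ] W} (hA : Function.Injective A) :
    IsUnit (Matrix.of fun a b => (inner ℝ (A (stdVec a)) (A (stdVec b)) : ℝ)).det := by
  have h : LinearIndependent ℝ fun a => A (stdVec a : EuclideanSpace ℝ (Fin n)) := by
    have h0 := (EuclideanSpace.basisFun (Fin n) ℝ).toBasis.linearIndependent
    have h1 := h0.map' (A : EuclideanSpace ℝ (Fin n) →ₗ[ℝ] W) (LinearMap.ker_eq_bot.mpr hA)
    have e : (fun a => A (stdVec a : EuclideanSpace ℝ (Fin n))) =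
        ⇑(A : EuclideanSpace ℝ (Fin n) →ₗ[ℝ] W) ∘ (EuclideanSpace.basisFun (Fin n) ℝ).toBasis := by
      funext a
      simp [stdVec]
    rw [e]
    exact h1
  rw [isUnit_iff_ne_zero]
  exact Matrix.det_gram_ne_zero_iff_linearIndependent.mpr h

theorem inner_apply_eq_bilinOf {n : ℕ} {W : Type*} [NormedAddCommGroup W]
    [InnerProductSpace ℝ W] (A : EuclideanSpace ℝ (Fin n) →L[ℝ] W) (X Y : EuclideanSpace ℝ (Fin n)) :
    bilinOf (Matrix.of fun a b => (inner ℝ (A (stdVec a)) (A (stdVec b)) : ℝ)) X Y =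
      inner ℝ (A X) (A Y) := by
  have hv : ∀ v : EuclideanSpace ℝ (Fin n), A v = ∑ k, v k • A (stdVec k) := by
    intro v
    have : v = ∑ k, v k • stdVec k := by
      ext l
      simp [stdVec, Pi.single_apply]
    conv_lhs => rw [this]
    simp
  rw [hv X, hv Y, bilinOf_apply, sum_inner]
  refine Finset.sum_congr rfl fun i _ => ?_
  rw [inner_sum]
  refine Finset.sum_congr rfl fun j _ => ?_
  rw [inner_smul_left, inner_smul_right, Matrix.of_apply]
  simp
  ring

/-! ### Mean curvature of special Lagrangian three-folds in terms of dΥ. -/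

namespace SU3Structure

variable {M : Type*} [TopologicalSpace M] [ChartedSpace (EuclideanSpace ℝ (Fin 6)) M]
  (S : SU3Structure M)

theorem differentiableAt_metricInChart [IsManifold (𝓡 6) ∞ M] (x : M) (i j : Fin 6) :
    DifferentiableAt ℝ (fun y => metricInChart S.metric x y i j) (extChartAt (𝓡 6) x x) := by
  have hΩ := S.smooth_Omega.differentiableAt x
  have hΥ := S.smooth_Upsilon.differentiableAt x
  have e1 : formInChart S.Omega x = fun z => modelOmega.compContinuousLinearMap
      (S.chartCoframe x z) := funext (S.formInChart_Omega x)
  have e2 : formInChart S.Upsilon x = fun z => modelUpsilon.compContinuousLinearMap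
      (S.chartCoframe x z) := funext (S.formInChart_Upsilon x)
  rw [e1] at hΩ
  rw [e2] at hΥ
  exact differentiableAt_inner_of_pullback (by simp) hΩ hΥ (S.euclCoframe x)
    (S.chartCoframe_self x) (stdVec i) (stdVec j)

theorem metricInChart_eq (x : M) (y : EuclideanSpace ℝ (Fin 6)) :
    metricInChart S.metric x y = Matrix.of fun i j => (inner ℝ (S.chartCoframe x y (stdVec i))
      (S.chartCoframe x y (stdVec j)) : ℝ) := rfl

theorem modelOmega_euclCoframe (x : M) (X Y : EuclideanSpace ℝ (Fin 6)) :
    modelOmega ![S.euclCoframe x X, S.euclCoframe x Y] = S.Omega x ![X, Y] := by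
  rw [(S.isCoframe_coframe x).1]
  exact (compCLM_vec_two modelOmega
    (S.euclCoframe x : EuclideanSpace ℝ (Fin 6) →L[ℝ] ModelV) X Y).symm

theorem modelUpsilon_euclCoframe (x : M) (X : Fin 3 → EuclideanSpace ℝ (Fin 6)) :
    modelUpsilon (fun i => S.euclCoframe x (X i)) = S.Upsilon x X := by
  rw [(S.isCoframe_coframe x).2]
  rfl

variable {L : Type*} [TopologicalSpace L] [ChartedSpace (EuclideanSpace ℝ (Fin 3)) L]

/-- The images of the coordinate vectors under the derivative of an immersion. -/
def tangentFrame (f : L → M) (p : L) (a : Fin 3) : EuclideanSpace ℝ (Fin 6) :=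
  euclDeriv f p (stdVec a)

variable {S} in
theorem IsSpecialLagrangian.omega_euclDeriv {θ : ℝ} {f : L → M} (hf : S.IsSpecialLagrangian θ f)
    (q : L) (X Y : EuclideanSpace ℝ (Fin 3)) :
    S.Omega (f q) ![euclDeriv f q X, euclDeriv f q Y] = 0 := by
  exact (congrArg (S.Omega (f q)) (comp_vec_two (euclDeriv f q) X Y).symm).trans
    (hf.lagrangian q ![X, Y])

variable {S} in
/-- The mean curvature of a special Lagrangian three-fold is minus the contraction of the exterior
derivative of the calibration `Re (e^{-iθ} Υ)` with its tangent planes. -/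
theorem IsSpecialLagrangian.inner_meanCurvature [IsManifold (𝓡 6) ∞ M] [IsManifold (𝓡 3) ∞ L]
    {θ : ℝ} {f : L → M} (hf : S.IsSpecialLagrangian θ f) (p : L) :
    (∀ a, inner ℝ (S.euclCoframe (f p) (meanCurvature 3 S.metric f p))
      (S.euclCoframe (f p) (tangentFrame f p a)) = 0) ∧
    phaseCLM θ (S.Upsilon (f p) (tangentFrame f p)) ≠ 0 ∧
    ∀ X : EuclideanSpace ℝ (Fin 6),
      (∀ a, inner ℝ (S.euclCoframe (f p) (tangentFrame f p a)) (S.euclCoframe (f p) X) = 0) →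
      inner ℝ (S.euclCoframe (f p) (meanCurvature 3 S.metric f p)) (S.euclCoframe (f p) X) *
        phaseCLM θ (S.Upsilon (f p) (tangentFrame f p)) =
      -phaseCLM θ (formD S.Upsilon (f p)
        ![X, tangentFrame f p 0, tangentFrame f p 1, tangentFrame f p 2]) := by
  set Φ := extChartAt (𝓡 6) (f p) ∘ f ∘ (extChartAt (𝓡 3) p).symm with hΦ
  set s := extChartAt (𝓡 3) p p with hs
  set G := metricInChart S.metric (f p) with hG
  have hΦs : Φ s = extChartAt (𝓡 6) (f p) (f p) := by
    simp only [hΦ, hs, Function.comp_apply, extChartAt_to_inv]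
  have hC : S.chartCoframe (f p) (Φ s) = (S.euclCoframe (f p) : EuclideanSpace ℝ (Fin 6) →L[ℝ] ModelV) := by
    rw [hΦs, chartCoframe_self]
  have hev := eventually_chartSymmDeriv_fderiv hf.smooth p
  have hframe : coordFrame Φ s = tangentFrame f p := by
    obtain ⟨q, -, hq, h⟩ := hev.self_of_nhds
    funext a
    have h1 := h (stdVec a)
    rw [← hΦ, ← hs, hΦs, chartSymmDeriv_self, chartSymmDeriv_self] at h1
    rw [extChartAt_to_inv] at hq
    subst hq
    exact h1
  have hH : meanCurvature 3 S.metric f p = coordMeanCurvature G Φ s := by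
    have h0 : meanCurvature 3 S.metric f p =
      chartSymmDeriv (f p) (extChartAt (𝓡 6) (f p) (f p)) (coordMeanCurvature G Φ s) := rfl
    rw [h0, chartSymmDeriv_self]
    rfl
  have hb : ∀ z X Y, bilinOf (G z) X Y = inner ℝ (S.chartCoframe (f p) z X)
      (S.chartCoframe (f p) z Y) := fun z X Y => by
    rw [hG, metricInChart_eq, inner_apply_eq_bilinOf]
  set φ : EuclideanSpace ℝ (Fin 6) → EuclideanSpace ℝ (Fin 6) [⋀^Fin 3]→L[ℝ] ℝ :=
    fun z => (phaseCLM θ).compContinuousAlternatingMap (formInChart S.Upsilon (f p) z) with hφ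
  have hφm : ∀ z ξ, φ z ξ = modelPhase θ fun i => S.chartCoframe (f p) z (ξ i) := by
    intro z ξ
    rw [modelPhase, ← phaseCLM_apply, hφ]
    simp only [formInChart_Upsilon]
    rfl
  have hsymm : ∀ z i j, G z i j = G z j i := by
    intro z i j
    rw [hG, metricInChart_metric, metricInChart_metric, real_inner_comm]
  have hΥd := S.smooth_Upsilon.differentiableAt (f p)
  have hφd : DifferentiableAt ℝ φ (Φ s) := by
    rw [hΦs]
    exact differentiableAt_comp (phaseCLM θ) hΥd
  have hΦd : ContDiffAt ℝ 2 Φ s := by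
    have h := ((contMDiffAt_iff).mp (hf.smooth p)).2
    rw [ModelWithCorners.range_eq_univ, contDiffWithinAt_univ] at h
    exact h.of_le (by norm_cast)
  have hdet : IsUnit (G (Φ s)).det := by
    rw [hG, metricInChart_eq, hC]
    exact isUnit_det_gram_of_injective (S.euclCoframe (f p)).injective
  have hind : ∀ z, inducedMetric G Φ z = Matrix.of fun a b =>
      (inner ℝ (S.chartCoframe (f p) (Φ z) (coordFrame Φ z a))
        (S.chartCoframe (f p) (Φ z) (coordFrame Φ z b)) : ℝ) := by
    intro z
    ext a b
    rw [inducedMetric_apply, hb]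
    rfl
  have hh : IsUnit (inducedMetric G Φ s).det := by
    rw [hind, hC, hframe]
    have hinj : Function.Injective ((S.euclCoframe (f p) : EuclideanSpace ℝ (Fin 6) →L[ℝ] ModelV).comp
        (euclDeriv f p)) :=
      (S.euclCoframe (f p)).injective.comp (hf.immersion p)
    exact isUnit_det_gram_of_injective hinj
  have hle : ∀ z (ξ : Fin 3 → EuclideanSpace ℝ (Fin 6)),
      φ z ξ ^ 2 ≤ (Matrix.of fun a b => bilinOf (G z) (ξ a) (ξ b)).det := by
    intro z ξ
    simp only [hφm, hb]
    exact sq_modelPhase_le_det θ _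
  -- For z near s the coordinate frame at z is the image of tangent vectors at a point q of the
  -- three-fold, and the special Lagrangian conditions at q supply the polarized equality.
  have heq : ∀ᶠ z in nhds s, ∀ c X, ∑ b, bilinOf (G (Φ z)) X (coordFrame Φ z b) *
      (inducedMetric G Φ z).adjugate b c =
      φ (Φ z) (Function.update (coordFrame Φ z) c X) * φ (Φ z) (coordFrame Φ z) := by
    filter_upwards [hev] with z ⟨q, hq1, _, hq2⟩ c X
    have hY : ∀ a, S.chartCoframe (f p) (Φ z) (coordFrame Φ z a) =
        S.euclCoframe (f q) (euclDeriv f q (chartSymmDeriv p z (stdVec a))) := by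
      intro a
      refine Eq.trans ?_ (congrArg (S.euclCoframe (f q)) (hq2 (stdVec a)))
      rw [← hq1]
      rfl
    have hO : ∀ a b, modelOmega ![S.chartCoframe (f p) (Φ z) (coordFrame Φ z a),
        S.chartCoframe (f p) (Φ z) (coordFrame Φ z b)] = 0 := by
      intro a b
      rw [hY, hY, modelOmega_euclCoframe]
      exact hf.omega_euclDeriv q _ _
    have hU : (Complex.exp (-(θ * Complex.I)) *
        modelUpsilon fun a => S.chartCoframe (f p) (Φ z) (coordFrame Φ z a)).im = 0 := by
      simp only [hY]
      rw [modelUpsilon_euclCoframe]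
      exact hf.phase q fun a => chartSymmDeriv p z (stdVec a)
    have h := sum_inner_mul_adjugate_of_calibrated θ
      (Y := fun a => S.chartCoframe (f p) (Φ z) (coordFrame Φ z a)) hO hU c
      (S.chartCoframe (f p) (Φ z) X)
    rw [hind, hφm, hφm]
    simp only [hb]
    rw [h]
    congr 2
    funext a
    rcases eq_or_ne a c with rfl | hac
    · simp
    · simp [hac]
  obtain ⟨h1, h2⟩ := bilinOf_coordMeanCurvature_of_calibrated (Φ := Φ) hsymm
    (fun i j => by rw [hΦs]; exact S.differentiableAt_metricInChart (f p) i j) hdet hh hφd hΦd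
    hle heq
  have hφs : φ (Φ s) (coordFrame Φ s) = phaseCLM θ (S.Upsilon (f p) (tangentFrame f p)) := by
    rw [hφm, hC, hframe, modelPhase, ← phaseCLM_apply]
    exact congrArg _ (S.modelUpsilon_euclCoframe (f p) _)
  have h3 := bilinOf_coordMeanCurvature_tangent hsymm hh
  rw [hφs] at h1 h2
  rw [hH]
  simp only [hb, hC, hframe] at h2
  refine ⟨fun a => ?_, h1, fun X hX => ?_⟩
  · have := h3 a
    rw [hb, hC] at this
    change inner ℝ _ (S.euclCoframe (f p) (coordFrame Φ s a)) = 0 at this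
    rw [hframe] at this
    exact this
  · refine (h2 X hX).trans ?_
    rw [formD_eq, hΦs, hφ, extDeriv_comp_clm (phaseCLM θ) hΥd]
    rfl

end SU3Structure

/-! ### The rotated orthonormal frame v_p(θ), w_p(θ). -/

section RotatedFrame

theorem neg_ite_zero {P : Prop} [Decidable P] (x : ℝ) :
    -(if P then x else 0) = if P then -x else 0 := by
  split_ifs <;> simp

variable (θ : ℝ)

theorem inner_vVec (p : Fin 3) (X : ModelV) : inner ℝ (vVec θ p) X =
    Real.cos (θ / 3) * X (Sum.inl p) + Real.sin (θ / 3) * X (Sum.inr p) := by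
  simp [vVec, inner_add_left, inner_smul_left, basisVec, EuclideanSpace.inner_single_left]

theorem inner_wVec (p : Fin 3) (X : ModelV) : inner ℝ (wVec θ p) X =
    -Real.sin (θ / 3) * X (Sum.inl p) + Real.cos (θ / 3) * X (Sum.inr p) := by
  simp [wVec, inner_add_left, inner_smul_left, basisVec, EuclideanSpace.inner_single_left]

theorem vVec_apply (p : Fin 3) (i : Fin 3 ⊕ Fin 3) : vVec θ p i =
    Sum.elim (fun q => if q = p then Real.cos (θ / 3) else 0)
      (fun q => if q = p then Real.sin (θ / 3) else 0) i := by
  rcases i with q | q <;> simp [vVec, basisVec]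

theorem wVec_apply (p : Fin 3) (i : Fin 3 ⊕ Fin 3) : wVec θ p i =
    Sum.elim (fun q => if q = p then -Real.sin (θ / 3) else 0)
      (fun q => if q = p then Real.cos (θ / 3) else 0) i := by
  rcases i with q | q <;> simp [wVec, basisVec, neg_ite_zero]

theorem sum_smul_wVec_apply (a : Fin 3 → ℝ) (i : Fin 3 ⊕ Fin 3) : (∑ q, a q • wVec θ q) i =
    Sum.elim (fun q => -Real.sin (θ / 3) * a q) (fun q => Real.cos (θ / 3) * a q) i := by
  rcases i with q | q <;>
    simp [wVec_apply, mul_comm]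

theorem inner_wVec_sum (a : Fin 3 → ℝ) (p : Fin 3) :
    inner ℝ (wVec θ p) (∑ q, a q • wVec θ q) = a p := by
  rw [inner_wVec, sum_smul_wVec_apply, sum_smul_wVec_apply, Sum.elim_inl, Sum.elim_inr]
  linear_combination a p * Real.sin_sq_add_cos_sq (θ / 3)

theorem eq_sum_wVec_of_inner {X : ModelV} (hX : ∀ p, inner ℝ (vVec θ p) X = 0) :
    X = ∑ q, (inner ℝ (wVec θ q) X : ℝ) • wVec θ q := by
  ext i
  rw [sum_smul_wVec_apply]
  have h := fun p => (inner_vVec θ p X).symm.trans (hX p)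
  rcases i with p | p
  · rw [Sum.elim_inl, inner_wVec]
    linear_combination Real.cos (θ / 3) * h p -
      X (Sum.inl p) * Real.sin_sq_add_cos_sq (θ / 3)
  · rw [Sum.elim_inr, inner_wVec]
    linear_combination Real.sin (θ / 3) * h p -
      X (Sum.inr p) * Real.sin_sq_add_cos_sq (θ / 3)

theorem sum_smul_wVec_mem (a : Fin 3 → ℝ) : ∑ q, a q • wVec θ q ∈ rotatedNormal θ :=
  Submodule.sum_mem _ fun q _ => Submodule.smul_mem _ _ (Submodule.subset_span ⟨q, rfl⟩)

theorem exists_eq_sum_wVec {X : ModelV} (hX : X ∈ rotatedNormal θ) :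
    ∃ a : Fin 3 → ℝ, X = ∑ q, a q • wVec θ q := by
  obtain ⟨a, ha⟩ := (Submodule.mem_span_range_iff_exists_fun ℝ).mp hX
  exact ⟨a, ha.symm⟩

theorem norm_sq_sum_smul_wVec (a : Fin 3 → ℝ) : ‖∑ q, a q • wVec θ q‖ ^ 2 = ∑ q, a q ^ 2 := by
  rw [← real_inner_self_eq_norm_sq, sum_inner]
  refine Finset.sum_congr rfl fun q _ => ?_
  rw [inner_smul_left, inner_wVec_sum]
  simp [pow_two]

theorem modelJ_vVec (p : Fin 3) : modelJ (vVec θ p) = wVec θ p := by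
  ext i
  rw [modelJ_apply, wVec_apply]
  rcases i with q | q <;> simp [vVec_apply, neg_ite_zero]

theorem modelJ_wVec (p : Fin 3) : modelJ (wVec θ p) = -vVec θ p := by
  ext i
  rw [modelJ_apply]
  rcases i with q | q <;> simp [wVec_apply, vVec_apply, neg_ite_zero]

end RotatedFrame

/-! ### The isometry § from T to the rotated normal space. -/

section SectionMap

variable (θ : ℝ)

theorem toDual_symm_apply (α : ModelV →L[ℝ] ℝ) (i : Fin 3 ⊕ Fin 3) :
    (InnerProductSpace.toDual ℝ ModelV).symm α i = α (basisVec i) := by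
  have h := InnerProductSpace.toDual_symm_apply (𝕜 := ℝ) (x := basisVec i) (y := α)
  rw [basisVec, EuclideanSpace.inner_single_right] at h
  rw [basisVec, ← h]
  simp

theorem sectionMap_eq_sum {α : ModelV →L[ℝ] ℝ} (hα : ∀ p, α (basisVec (Sum.inr p)) = 0) :
    sectionMap θ α = ∑ p, α (basisVec (Sum.inl p)) • wVec θ p := by
  ext i
  rw [sum_smul_wVec_apply]
  rcases i with p | p <;> simp [sectionMap, modelJ_apply, toDual_symm_apply, hα]

theorem covec_ext {α β : ModelV →L[ℝ] ℝ} (h : ∀ i, α (basisVec i) = β (basisVec i)) : α = β := by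
  refine ContinuousLinearMap.coe_injective ?_
  refine (EuclideanSpace.basisFun (Fin 3 ⊕ Fin 3) ℝ).toBasis.ext fun i => ?_
  simpa [basisVec] using h i

theorem dualVec_basisVec (i j : Fin 3 ⊕ Fin 3) :
    dualVec i (basisVec j) = if i = j then 1 else 0 := by
  simp [dualVec, basisVec]

theorem partT_inl (α : ModelV →L[ℝ] ℝ) (p : Fin 3) :
    partT α (basisVec (Sum.inl p)) = α (basisVec (Sum.inl p)) := by
  simp [partT, sum_apply, dualVec_basisVec]

theorem partT_inr (α : ModelV →L[ℝ] ℝ) (p : Fin 3) : partT α (basisVec (Sum.inr p)) = 0 := by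
  simp [partT, sum_apply, dualVec_basisVec]

theorem partN_inl (α : ModelV →L[ℝ] ℝ) (p : Fin 3) : partN α (basisVec (Sum.inl p)) = 0 := by
  simp [partN, sum_apply, dualVec_basisVec]

theorem partN_inr (α : ModelV →L[ℝ] ℝ) (p : Fin 3) :
    partN α (basisVec (Sum.inr p)) = α (basisVec (Sum.inr p)) := by
  simp [partN, sum_apply, dualVec_basisVec]

theorem modelJ_basisVec_inl (p : Fin 3) : modelJ (basisVec (Sum.inl p)) = basisVec (Sum.inr p) := by
  ext i
  rw [modelJ_apply]
  rcases i with q | q <;> simp [basisVec]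

theorem modelJ_basisVec_inr (p : Fin 3) :
    modelJ (basisVec (Sum.inr p)) = -basisVec (Sum.inl p) := by
  ext i
  rw [modelJ_apply]
  rcases i with q | q <;> simp [basisVec, neg_ite_zero]

theorem mem_covecT_iff (α : ModelV →L[ℝ] ℝ) :
    α ∈ covecT ↔ ∀ p, α (basisVec (Sum.inr p)) = 0 := by
  constructor
  · intro h p
    obtain ⟨a, rfl⟩ := (Submodule.mem_span_range_iff_exists_fun ℝ).mp h
    simp [sum_apply, dualVec_basisVec]
  · intro h
    have : α = partT α := by
      refine covec_ext fun i => ?_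
      rcases i with p | p
      · rw [partT_inl]
      · rw [partT_inr, h]
    rw [this]
    exact Submodule.sum_mem _ fun p _ => Submodule.smul_mem _ _ (Submodule.subset_span ⟨p, rfl⟩)

theorem norm_sectionMap {α : ModelV →L[ℝ] ℝ} (hα : α ∈ covecT) : ‖sectionMap θ α‖ = ‖α‖ := by
  rw [mem_covecT_iff] at hα
  have h1 : ‖sectionMap θ α‖ ^ 2 = ‖α‖ ^ 2 := by
    rw [sectionMap_eq_sum θ hα, norm_sq_sum_smul_wVec,
      ← (InnerProductSpace.toDual ℝ ModelV).symm.norm_map α, EuclideanSpace.norm_sq_eq,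
      Fintype.sum_sum_type]
    simp [toDual_symm_apply, hα]
  exact (sq_eq_sq₀ (norm_nonneg _) (norm_nonneg _)).mp h1

theorem bijOn_sectionMap : Set.BijOn (sectionMap θ) covecT (rotatedNormal θ) := by
  refine ⟨fun α hα => ?_, fun α hα β hβ h => ?_, fun X hX => ?_⟩
  · rw [SetLike.mem_coe, mem_covecT_iff] at hα
    rw [sectionMap_eq_sum θ hα]
    exact sum_smul_wVec_mem θ _
  · rw [SetLike.mem_coe, mem_covecT_iff] at hα hβ
    rw [sectionMap_eq_sum θ hα, sectionMap_eq_sum θ hβ] at h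
    refine covec_ext fun i => ?_
    rcases i with p | p
    · have := congrArg (inner ℝ (wVec θ p)) h
      rwa [inner_wVec_sum, inner_wVec_sum] at this
    · rw [hα, hβ]
  · obtain ⟨a, rfl⟩ := exists_eq_sum_wVec θ hX
    have h0 : ∀ p, (∑ p, a p • dualVec (Sum.inl p)) (basisVec (Sum.inr p)) = 0 := by
      intro p
      simp [sum_apply, dualVec_basisVec]
    refine ⟨∑ p, a p • dualVec (Sum.inl p), (mem_covecT_iff _).mpr h0, ?_⟩
    rw [sectionMap_eq_sum θ h0]
    simp [sum_apply, dualVec_basisVec]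

end SectionMap

/-! ### The isometry ♮ from (Λ²₈)₁ to the rotated normal space. -/

section NaturalMap

variable (θ : ℝ)

theorem rho_offDiag_inl (h : Matrix (Fin 3) (Fin 3) ℝ) (p q : Fin 3) :
    rho (Matrix.fromBlocks 0 h (-h) 0) ![basisVec (Sum.inl p), basisVec (Sum.inl q)] =
      (1 / 2) * (h q p - h p q) := by
  rw [rho_basisVec, omegaMatrix, Matrix.fromBlocks_multiply]
  simp
  ring

theorem rho_offDiag_inr (h : Matrix (Fin 3) (Fin 3) ℝ) (p q : Fin 3) :
    rho (Matrix.fromBlocks 0 h (-h) 0) ![basisVec (Sum.inr p), basisVec (Sum.inr q)] =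
      (1 / 2) * (h q p - h p q) := by
  rw [rho_basisVec, omegaMatrix, Matrix.fromBlocks_multiply]
  simp
  ring

theorem rho_offDiag_mixed (h : Matrix (Fin 3) (Fin 3) ℝ) (p q : Fin 3) :
    rho (Matrix.fromBlocks 0 h (-h) 0) ![basisVec (Sum.inl p), basisVec (Sum.inr q)] = 0 := by
  rw [rho_basisVec, omegaMatrix, Matrix.fromBlocks_multiply]
  simp

theorem rho_offDiag_mixed' (h : Matrix (Fin 3) (Fin 3) ℝ) (p q : Fin 3) :
    rho (Matrix.fromBlocks 0 h (-h) 0) ![basisVec (Sum.inr p), basisVec (Sum.inl q)] = 0 := by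
  rw [rho_basisVec, omegaMatrix, Matrix.fromBlocks_multiply]
  simp

theorem naturalInv_eq_rho (X : ModelV) : naturalInv θ X =
    rho (Matrix.fromBlocks 0 ((1 / Real.sqrt 2) • skewOfVec fun p => inner ℝ (wVec θ p) X)
      (-((1 / Real.sqrt 2) • skewOfVec fun p => inner ℝ (wVec θ p) X)) 0) := by
  rw [naturalInv, ← map_smul, Matrix.fromBlocks_smul]
  simp

theorem rho_offDiag_injective {h k : Matrix (Fin 3) (Fin 3) ℝ} (hh : h.transpose = -h)
    (hk : k.transpose = -k) (e : rho (Matrix.fromBlocks 0 h (-h) 0) =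
      rho (Matrix.fromBlocks 0 k (-k) 0)) : h = k := by
  ext p q
  have h1 := DFunLike.congr_fun e ![basisVec (Sum.inl p), basisVec (Sum.inl q)]
  rw [rho_offDiag_inl, rho_offDiag_inl] at h1
  have h2 : h q p = -h p q := congrFun (congrFun hh p) q
  have h3 : k q p = -k p q := congrFun (congrFun hk p) q
  linarith

theorem skewOfVec_transpose (a : Fin 3 → ℝ) : (skewOfVec a).transpose = -skewOfVec a := by
  ext p q
  fin_cases p <;> fin_cases q <;> simp [skewOfVec]

theorem skewOfVec_injective {a b : Fin 3 → ℝ} (h : skewOfVec a = skewOfVec b) : a = b := by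
  funext p
  fin_cases p
  · simpa [skewOfVec] using congrFun (congrFun h 1) 2
  · simpa [skewOfVec] using congrFun (congrFun h 2) 0
  · simpa [skewOfVec] using congrFun (congrFun h 0) 1

theorem exists_eq_skewOfVec {h : Matrix (Fin 3) (Fin 3) ℝ} (hh : h.transpose = -h) :
    h = skewOfVec ![h 1 2, h 2 0, h 0 1] := by
  have h1 : ∀ p q, h q p = -h p q := fun p q => congrFun (congrFun hh p) q
  have h0 : ∀ p, h p p = 0 := fun p => by linarith [h1 p p]
  ext p q
  fin_cases p <;> fin_cases q <;> simp [skewOfVec, h0, h1 0 1, h1 1 2, h1 2 0]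

theorem bijOn_naturalInv : Set.BijOn (naturalInv θ) (rotatedNormal θ) lambdaEightOne := by
  have hs : (1 / Real.sqrt 2 : ℝ) ≠ 0 := by positivity
  have hT : ∀ a : Fin 3 → ℝ, ((1 / Real.sqrt 2 : ℝ) • skewOfVec a).transpose =
      -((1 / Real.sqrt 2 : ℝ) • skewOfVec a) := by
    intro a
    rw [Matrix.transpose_smul, skewOfVec_transpose, smul_neg]
  refine ⟨fun X _ => ?_, fun X hX Y hY h => ?_, fun β hβ => ?_⟩
  · rw [naturalInv_eq_rho]
    exact ⟨_, ⟨_, hT _, rfl⟩, rfl⟩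
  · obtain ⟨a, rfl⟩ := exists_eq_sum_wVec θ hX
    obtain ⟨b, rfl⟩ := exists_eq_sum_wVec θ hY
    rw [naturalInv_eq_rho, naturalInv_eq_rho] at h
    have h1 := skewOfVec_injective
      (smul_right_injective _ hs (rho_offDiag_injective (hT _) (hT _) h))
    simp only [inner_wVec_sum] at h1
    have h2 : a = b := h1
    rw [h2]
  · obtain ⟨s, ⟨h, hh, rfl⟩, rfl⟩ := hβ
    refine ⟨∑ q, (Real.sqrt 2 • ![h 1 2, h 2 0, h 0 1]) q • wVec θ q, sum_smul_wVec_mem θ _, ?_⟩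
    rw [naturalInv_eq_rho]
    simp only [inner_wVec_sum]
    have e : (1 / Real.sqrt 2 : ℝ) • (skewOfVec fun p =>
        (Real.sqrt 2 • ![h 1 2, h 2 0, h 0 1]) p) = h := by
      conv_rhs => rw [exists_eq_skewOfVec hh]
      ext p q
      fin_cases p <;> fin_cases q <;> simp [skewOfVec]
    rw [e]

theorem naturalMap_naturalInv {X : ModelV} (hX : X ∈ rotatedNormal θ) :
    naturalMap θ (naturalInv θ X) = X :=
  (bijOn_naturalInv θ).injOn.leftInvOn_invFunOn hX

theorem bijOn_naturalMap : Set.BijOn (naturalMap θ) lambdaEightOne (rotatedNormal θ) :=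
  (bijOn_naturalInv θ).symm (bijOn_naturalInv θ).invOn_invFunOn.symm

/-- The skew matrix enters both diagonal blocks of the two-form, each with squared norm |a|²; the
factor 1/√2 compensates for the doubling. -/
theorem twoFormNormSq_naturalInv (a : Fin 3 → ℝ) :
    twoFormNormSq (naturalInv θ (∑ q, a q • wVec θ q)) = ∑ q, a q ^ 2 := by
  have h2 : (Real.sqrt 2)⁻¹ ^ 2 = 1 / 2 := by
    rw [inv_pow, Real.sq_sqrt (by norm_num)]
    norm_num
  rw [naturalInv_eq_rho, twoFormNormSq]
  simp only [inner_wVec_sum, Fintype.sum_sum_type, rho_offDiag_inl, rho_offDiag_inr,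
    rho_offDiag_mixed, rho_offDiag_mixed']
  simp [Fin.sum_univ_three, skewOfVec]
  ring_nf
  rw [h2]
  ring

theorem norm_naturalMap {β : ModelV [⋀^Fin 2]→ₗ[ℝ] ℝ} (hβ : β ∈ lambdaEightOne) :
    ‖naturalMap θ β‖ ^ 2 = twoFormNormSq β := by
  obtain ⟨X, hX, rfl⟩ := (bijOn_naturalInv θ).surjOn hβ
  rw [naturalMap_naturalInv θ hX]
  obtain ⟨a, rfl⟩ := exists_eq_sum_wVec θ hX
  rw [twoFormNormSq_naturalInv, norm_sq_sum_smul_wVec]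

/-- In Λ²₈ the two diagonal blocks of β coincide, so the skew matrix of its first component is minus
that block. Undoing 1/√2 gives the factor -√2; indices are modulo 3. -/
theorem naturalMap_partOne {β : ModelV [⋀^Fin 2]→ₗ[ℝ] ℝ} (hβ : IsModelTwoEight β) :
    naturalMap θ (partOne β) = ∑ q : Fin 3, (-Real.sqrt 2 *
      β ![basisVec (Sum.inl (q + 1)), basisVec (Sum.inl (q + 2))]) • wVec θ q := by
  rw [← naturalMap_naturalInv θ (sum_smul_wVec_mem θ _), naturalInv_eq_rho, partOne]
  simp only [inner_wVec_sum]
  obtain ⟨h1, h2, h3, -⟩ := (isModelTwoEight_iff β).mp hβ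
  have hsw : ∀ X Y, β ![Y, X] = -β ![X, Y] := by
    intro X Y
    have h := β.map_swap ![X, Y] (show (0 : Fin 2) ≠ 1 by decide)
    have e : (![X, Y] : Fin 2 → ModelV) ∘ Equiv.swap 0 1 = ![Y, X] := by
      funext i; fin_cases i <;> rfl
    rwa [e] at h
  have h0 : ∀ X, β ![X, X] = 0 := fun X => by linarith [hsw X X]
  have hs : Real.sqrt 2 ≠ 0 := by positivity
  simp only [stdFrame, Matrix.cons_val_zero, Matrix.cons_val_one, Matrix.cons_val] at h1 h2 h3
  congr 2
  have e : (Matrix.of fun p q => -(1 / 2) * (β ![basisVec (Sum.inl p), basisVec (Sum.inl q)] +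
      β ![basisVec (Sum.inr p), basisVec (Sum.inr q)])) = (1 / Real.sqrt 2 : ℝ) •
      skewOfVec fun q : Fin 3 => -Real.sqrt 2 *
        β ![basisVec (Sum.inl (q + 1)), basisVec (Sum.inl (q + 2))] := by
    ext p q
    fin_cases p <;> fin_cases q <;>
      simp [skewOfVec, h0, ← h1, ← h2, ← h3, hsw (basisVec (Sum.inl 0)) (basisVec (Sum.inl 1)),
        hsw (basisVec (Sum.inl 0)) (basisVec (Sum.inl 2)),
        hsw (basisVec (Sum.inl 1)) (basisVec (Sum.inl 2)),
        hsw (basisVec (Sum.inr 0)) (basisVec (Sum.inr 1)),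
        hsw (basisVec (Sum.inr 0)) (basisVec (Sum.inr 2)),
        hsw (basisVec (Sum.inr 1)) (basisVec (Sum.inr 2))] <;> field_simp <;> ring
  rw [e]

end NaturalMap

/-! ### The calibration's derivative evaluated in the rotated frame. -/

section RotatedEvaluation

variable (θ : ℝ)

theorem complexCoord_vVec (p q : Fin 3) : complexCoord (vVec θ p) q =
    if q = p then Complex.exp ((θ / 3 : ℝ) * Complex.I) else 0 := by
  rw [complexCoord, vVec_apply, vVec_apply, Sum.elim_inl, Sum.elim_inr, Complex.exp_mul_I,
    ← Complex.ofReal_cos, ← Complex.ofReal_sin]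
  split_ifs
  · ring
  · simp

/-- Rotation multiplies complex coordinates by e^{iθ/3}, and three factors give e^{iθ}. The
determinant stands for the permutation symbol of (i, j, k). -/
theorem modelUpsilon_vVec (i j k : Fin 3) : modelUpsilon ![vVec θ i, vVec θ j, vVec θ k] =
    Complex.exp (θ * Complex.I) *
      Matrix.det (Matrix.of fun a b : Fin 3 => if b = ![i, j, k] a then (1 : ℂ) else 0) := by
  have h : Complex.exp (θ * Complex.I) = Complex.exp ((θ / 3 : ℝ) * Complex.I) ^ 3 := by
    rw [← Complex.exp_nat_mul]
    congr 1
    push_cast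
    ring
  have h2 : (Matrix.of fun a b => complexCoord (![vVec θ i, vVec θ j, vVec θ k] a) b) =
      Complex.exp ((θ / 3 : ℝ) * Complex.I) •
        (Matrix.of fun a b : Fin 3 => if b = ![i, j, k] a then (1 : ℂ) else 0) := by
    ext a b
    have h3 : (![vVec θ i, vVec θ j, vVec θ k] : Fin 3 → ModelV) a = vVec θ (![i, j, k] a) := by
      fin_cases a <;> rfl
    rw [Matrix.smul_apply, Matrix.of_apply, Matrix.of_apply, h3, complexCoord_vVec]
    simp
  rw [modelUpsilon_eq_det, h2, Matrix.det_smul, h]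
  simp

theorem exp_re_im : (Complex.exp (θ * Complex.I)).re = Real.cos θ ∧
    (Complex.exp (θ * Complex.I)).im = Real.sin θ :=
  ⟨Complex.exp_ofReal_mul_I_re θ, Complex.exp_ofReal_mul_I_im θ⟩

theorem reForm_vVec_vVec (i j k : Fin 3) : reForm ![vVec θ i, vVec θ j, vVec θ k] = Real.cos θ *
      Matrix.det (Matrix.of fun a b : Fin 3 => if b = ![i, j, k] a then (1 : ℝ) else 0) ∧
    imForm ![vVec θ i, vVec θ j, vVec θ k] = Real.sin θ *
      Matrix.det (Matrix.of fun a b : Fin 3 => if b = ![i, j, k] a then (1 : ℝ) else 0) := by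
  have h1 : Matrix.det (Matrix.of fun a b : Fin 3 => if b = ![i, j, k] a then (1 : ℂ) else 0) =
      (Matrix.det (Matrix.of fun a b : Fin 3 => if b = ![i, j, k] a then (1 : ℝ) else 0) : ℝ) := by
    rw [← Complex.ofRealHom_eq_coe, RingHom.map_det]
    congr 1
    ext a b
    simp only [RingHom.mapMatrix_apply, Matrix.map_apply, Matrix.of_apply]
    split_ifs <;> simp
  have h2 := modelUpsilon_vVec θ i j k
  rw [h1] at h2
  constructor
  · change (modelUpsilon ![vVec θ i, vVec θ j, vVec θ k]).re = _
    rw [h2, Complex.re_mul_ofReal, (exp_re_im θ).1]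
  · change (modelUpsilon ![vVec θ i, vVec θ j, vVec θ k]).im = _
    rw [h2, Complex.im_mul_ofReal, (exp_re_im θ).2]

theorem reForm_wVec_vVec (i j k : Fin 3) :
    reForm ![wVec θ i, vVec θ j, vVec θ k] = -imForm ![vVec θ i, vVec θ j, vVec θ k] := by
  change (modelUpsilon ![wVec θ i, vVec θ j, vVec θ k]).re =
    -(modelUpsilon ![vVec θ i, vVec θ j, vVec θ k]).im
  rw [← modelJ_vVec, modelUpsilon_modelJ]
  simp

theorem omegaForm_vVec_vVec (i j : Fin 3) : omegaForm ![vVec θ i, vVec θ j] = 0 := by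
  change modelOmega ![vVec θ i, vVec θ j] = 0
  rw [modelOmega_apply]
  simp only [vVec_apply, Sum.elim_inl, Sum.elim_inr]
  refine Finset.sum_eq_zero fun p _ => ?_
  split_ifs <;> ring

theorem omegaForm_wVec_vVec (i j : Fin 3) :
    omegaForm ![wVec θ i, vVec θ j] = if i = j then -1 else 0 := by
  change modelOmega ![wVec θ i, vVec θ j] = _
  rw [modelOmega_swap, ← modelJ_vVec, modelOmega_modelJ, inner_vVec, vVec_apply, vVec_apply]
  simp only [Sum.elim_inl, Sum.elim_inr]
  have := Real.sin_sq_add_cos_sq (θ / 3)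
  rcases eq_or_ne i j with rfl | h
  · simp only [if_true]
    linear_combination -this
  · simp [h, h.symm]

theorem twoForm_swap {E : Type*} [AddCommGroup E] [Module ℝ E] (β : E [⋀^Fin 2]→ₗ[ℝ] ℝ) (X Y : E) :
    β ![Y, X] = -β ![X, Y] := by
  have h := β.map_swap ![X, Y] (show (0 : Fin 2) ≠ 1 by decide)
  have e : (![X, Y] : Fin 2 → E) ∘ Equiv.swap 0 1 = ![Y, X] := by
    funext i; fin_cases i <;> rfl
  rwa [e] at h

theorem twoForm_comb_left {E : Type*} [AddCommGroup E] [Module ℝ E] (β : E [⋀^Fin 2]→ₗ[ℝ] ℝ)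
    (a b : ℝ) (X Y Z : E) : β ![a • X + b • Y, Z] = a * β ![X, Z] + b * β ![Y, Z] := by
  rw [AlternatingMap.map_vecCons_add, AlternatingMap.map_vecCons_smul,
    AlternatingMap.map_vecCons_smul, smul_eq_mul, smul_eq_mul]

theorem twoForm_comb {E : Type*} [AddCommGroup E] [Module ℝ E] (β : E [⋀^Fin 2]→ₗ[ℝ] ℝ)
    (a b : ℝ) (X Y Z W : E) : β ![a • X + b • Y, a • Z + b • W] =
      a ^ 2 * β ![X, Z] + a * b * (β ![X, W] + β ![Y, Z]) + b ^ 2 * β ![Y, W] := by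
  rw [twoForm_comb_left, twoForm_swap β _ X, twoForm_swap β _ Y, twoForm_comb_left,
    twoForm_comb_left, twoForm_swap β X Z, twoForm_swap β X W, twoForm_swap β Y Z,
    twoForm_swap β Y W]
  ring

/-- A form of type (1,1) is invariant under multiplication by the unit complex number e^{iθ/3},
which takes e_p to v_p; so θ disappears. -/
theorem IsModelTwoEight.apply_vVec {β : ModelV [⋀^Fin 2]→ₗ[ℝ] ℝ} (hβ : IsModelTwoEight β) :
    β ![vVec θ 0, vVec θ 1] = β ![basisVec (Sum.inl 0), basisVec (Sum.inl 1)] ∧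
    β ![vVec θ 0, vVec θ 2] = β ![basisVec (Sum.inl 0), basisVec (Sum.inl 2)] ∧
    β ![vVec θ 1, vVec θ 2] = β ![basisVec (Sum.inl 1), basisVec (Sum.inl 2)] := by
  obtain ⟨h1, h2, h3, h4, h5, h6, -⟩ := (isModelTwoEight_iff β).mp hβ
  simp only [stdFrame, Matrix.cons_val_zero, Matrix.cons_val_one, Matrix.cons_val] at h1 h2 h3 h4 h5 h6
  have := Real.sin_sq_add_cos_sq (θ / 3)
  simp only [vVec, twoForm_comb]
  rw [twoForm_swap β (basisVec (Sum.inl 1)) (basisVec (Sum.inr 0)),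
    twoForm_swap β (basisVec (Sum.inl 2)) (basisVec (Sum.inr 0)),
    twoForm_swap β (basisVec (Sum.inl 2)) (basisVec (Sum.inr 1)), ← h1, ← h2, ← h3, h4, h5, h6]
  refine ⟨?_, ?_, ?_⟩
  · linear_combination β ![basisVec (Sum.inl 0), basisVec (Sum.inl 1)] * this
  · linear_combination β ![basisVec (Sum.inl 0), basisVec (Sum.inl 2)] * this
  · linear_combination β ![basisVec (Sum.inl 1), basisVec (Sum.inl 2)] * this

variable {θ}

/-- The exterior derivative of the calibration `Re (e^{-iθ} Υ)` on a normal vector and the tangent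
frame of a special Lagrangian plane. -/
theorem IsModelTorsion.apply_wVec_vVec {a : ModelV [⋀^Fin 3]→ₗ[ℝ] ℝ}
    {b c : ModelV [⋀^Fin 4]→ₗ[ℝ] ℝ} {τ : TorsionForms ModelV} (h : IsModelTorsion a b c τ)
    (q : Fin 3) :
    Real.cos θ * b ![wVec θ q, vVec θ 0, vVec θ 1, vVec θ 2] +
      Real.sin θ * c ![wVec θ q, vVec θ 0, vVec θ 1, vVec θ 2] = τ.τ5 (wVec θ q) -
      Real.cos θ * τ.τ2 ![basisVec (Sum.inl (q + 1)), basisVec (Sum.inl (q + 2))] -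
      Real.sin θ * τ.τ2' ![basisVec (Sum.inl (q + 1)), basisVec (Sum.inl (q + 2))] := by
  obtain ⟨h01, h02, h12⟩ := h.mem_τ2.apply_vVec θ
  obtain ⟨k01, k02, k12⟩ := h.mem_τ2'.apply_vVec θ
  have s2 := twoForm_swap τ.τ2 (basisVec (Sum.inl 0)) (basisVec (Sum.inl 2))
  have s2' := twoForm_swap τ.τ2' (basisVec (Sum.inl 0)) (basisVec (Sum.inl 2))
  have hcs := Real.sin_sq_add_cos_sq θ
  rw [h.d_re, h.d_im]
  simp only [AlternatingMap.add_apply, AlternatingMap.smul_apply, wedge_two_two, wedge_one_three,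
    oneForm_apply, Matrix.cons_val_zero, Matrix.cons_val_one, Matrix.cons_val,
    omegaForm_vVec_vVec, omegaForm_wVec_vVec, reForm_wVec_vVec, (reForm_vVec_vVec θ _ _ _).1,
    (reForm_vVec_vVec θ _ _ _).2, h01, h02, h12, k01, k02, k12, smul_eq_mul,
    ContinuousLinearMap.comp_apply, modelJ_vVec, modelJ_wVec, map_neg]
  -- The Ω² terms vanish since Ω(v, v) = 0. From τ5 ∧ Re Υ and (τ5 ∘ J) ∧ Re Υ the terms in τ5(v_q)
  -- cancel, and τ5(w_q) appears with cos²θ + sin²θ.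
  fin_cases q
  · simp [Matrix.det_fin_three]
    linear_combination τ.τ5 (wVec θ 0) * hcs
  · simp [Matrix.det_fin_three, s2, s2']
    linear_combination τ.τ5 (wVec θ 1) * hcs
  · simp [Matrix.det_fin_three]
    linear_combination τ.τ5 (wVec θ 2) * hcs

/-- The right-hand side of the mean curvature formula in the frame `w_1(θ), w_2(θ), w_3(θ)`. -/
theorem meanCurvature_terms_eq_sum {β β' : ModelV [⋀^Fin 2]→ₗ[ℝ] ℝ} (hβ : IsModelTwoEight β)
    (hβ' : IsModelTwoEight β') (α : ModelV →L[ℝ] ℝ) :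
    -(1 / Real.sqrt 2 * Real.cos θ) • naturalMap θ (partOne β) -
      (1 / Real.sqrt 2 * Real.sin θ) • naturalMap θ (partOne β') +
      Real.sin (θ / 3) • sectionMap θ (partT α) -
      Real.cos (θ / 3) • sectionMap θ ((partN α).comp modelJ) =
    ∑ q, (Real.cos θ * β ![basisVec (Sum.inl (q + 1)), basisVec (Sum.inl (q + 2))] +
      Real.sin θ * β' ![basisVec (Sum.inl (q + 1)), basisVec (Sum.inl (q + 2))] -
      α (wVec θ q)) • wVec θ q := by
  have hs : Real.sqrt 2 ≠ 0 := by positivity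
  have hN : ∀ p, ((partN α).comp modelJ) (basisVec (Sum.inr p)) = 0 := by
    intro p
    rw [ContinuousLinearMap.comp_apply, modelJ_basisVec_inr, map_neg, partN_inl, neg_zero]
  rw [naturalMap_partOne θ hβ, naturalMap_partOne θ hβ', sectionMap_eq_sum θ (partT_inr α),
    sectionMap_eq_sum θ hN, Finset.smul_sum, Finset.smul_sum, Finset.smul_sum, Finset.smul_sum,
    ← Finset.sum_sub_distrib, ← Finset.sum_add_distrib, ← Finset.sum_sub_distrib]
  refine Finset.sum_congr rfl fun q _ => ?_
  rw [partT_inl, ContinuousLinearMap.comp_apply, modelJ_basisVec_inl, partN_inr]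
  -- The two § terms have coefficients sin(θ/3) α(e_q) and -cos(θ/3) α(e_{q+3}), whose sum is
  -- -α(w_q).
  have hw : α (wVec θ q) = -Real.sin (θ / 3) * α (basisVec (Sum.inl q)) +
      Real.cos (θ / 3) * α (basisVec (Sum.inr q)) := by
    simp [wVec]
  rw [hw]
  simp only [smul_smul, ← sub_smul, ← add_smul]
  congr 1
  field_simp
  ring

end RotatedEvaluation

/-! ### The mean curvature formula in an adapted coframe. -/

namespace SU3Structure

variable {M : Type*} [TopologicalSpace M] [ChartedSpace (EuclideanSpace ℝ (Fin 6)) M]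
  {S : SU3Structure M}
  {L : Type*} [TopologicalSpace L] [ChartedSpace (EuclideanSpace ℝ (Fin 3)) L]

/-- Top-degree forms on ℝ³ span a line. This replaces the coordinate frame, in which ⟨H, X⟩ is
known, by the frame that the coframe takes to the v_a. -/
theorem alternating_three_proportional (α β : EuclideanSpace ℝ (Fin 3) [⋀^Fin 3]→ₗ[ℝ] ℝ)
    (Y : Fin 3 → EuclideanSpace ℝ (Fin 3)) : α Y * β stdVec = α stdVec * β Y := by
  let e := (EuclideanSpace.basisFun (Fin 3) ℝ).toBasis
  have he : ⇑e = stdVec := by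
    funext i
    simp [e, stdVec]
  have h1 := DFunLike.congr_fun (AlternatingMap.eq_smul_basis_det e α) Y
  have h2 := DFunLike.congr_fun (AlternatingMap.eq_smul_basis_det e β) Y
  rw [AlternatingMap.smul_apply, smul_eq_mul, he] at h1 h2
  rw [h1, h2]
  ring

theorem phaseCLM_formD [IsManifold (𝓡 6) ∞ M] (S : SU3Structure M) (θ : ℝ) (x : M)
    (X : Fin 4 → TangentSpace (𝓡 6) x) : phaseCLM θ (formD S.Upsilon x X) =
      Real.cos θ * formD S.reUpsilon x X + Real.sin θ * formD S.imUpsilon x X := by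
  rw [formD_reUpsilon, formD_imUpsilon]
  simp [phaseCLM]

/-- The mean curvature formula, in the frame `w_1(θ), w_2(θ), w_3(θ)`. -/
theorem IsSpecialLagrangian.meanCurvature_eq_sum [IsManifold (𝓡 6) ∞ M] [IsManifold (𝓡 3) ∞ L]
    {θ : ℝ} {f : L → M} (hf : S.IsSpecialLagrangian θ f) (p : L)
    {c : TangentSpace (𝓡 6) (f p) ≃L[ℝ] ModelV} (hc : S.IsAdaptedCoframe θ f p c)
    {τ : TorsionForms (TangentSpace (𝓡 6) (f p))} (hτ : S.IsTorsion (f p) τ) :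
    c (meanCurvature 3 S.metric f p) = ∑ q, (Real.cos θ * (τ.push c).τ2
        ![basisVec (Sum.inl (q + 1)), basisVec (Sum.inl (q + 2))] +
      Real.sin θ * (τ.push c).τ2' ![basisVec (Sum.inl (q + 1)), basisVec (Sum.inl (q + 2))] -
      (τ.push c).τ5 (wVec θ q)) • wVec θ q := by
  obtain ⟨hH, hne, hX⟩ := hf.inner_meanCurvature p
  let e : EuclideanSpace ℝ (Fin 6) ≃L[ℝ] ModelV := c
  let H : EuclideanSpace ℝ (Fin 6) := meanCurvature 3 S.metric f p
  have hin : ∀ X Y : EuclideanSpace ℝ (Fin 6),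
      inner ℝ (S.euclCoframe (f p) X) (S.euclCoframe (f p) Y) = (inner ℝ (e X) (e Y) : ℝ) :=
    fun X Y => metric_eq_of_isCoframe hc.1 X Y
  have hH' : ∀ a, inner ℝ (e H) (e (tangentFrame f p a)) = 0 := fun a =>
    (hin H _).symm.trans (hH a)
  have hX' : ∀ X : EuclideanSpace ℝ (Fin 6), (∀ a, inner ℝ (e (tangentFrame f p a)) (e X) = 0) →
      inner ℝ (e H) (e X) * phaseCLM θ (S.Upsilon (f p) (tangentFrame f p)) =
      -phaseCLM θ (formD S.Upsilon (f p)
        ![X, tangentFrame f p 0, tangentFrame f p 1, tangentFrame f p 2]) := fun X h => by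
    rw [← hin H X]
    exact hX X fun a => (hin _ _).trans (h a)
  have hmem : ∀ Y : EuclideanSpace ℝ (Fin 3), e (euclDeriv f p Y) ∈ Submodule.span ℝ (Set.range (vVec θ)) := by
    intro Y
    have : e (euclDeriv f p Y) ∈ (Submodule.span ℝ (Set.range (vVec θ)) : Set ModelV) := by
      rw [← hc.2]
      exact ⟨Y, rfl⟩
    exact this
  have hY : ∀ a, ∃ Y : EuclideanSpace ℝ (Fin 3), e (euclDeriv f p Y) = vVec θ a := by
    intro a
    have : vVec θ a ∈ (Submodule.span ℝ (Set.range (vVec θ)) : Set ModelV) :=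
      Submodule.subset_span ⟨a, rfl⟩
    rw [← hc.2] at this
    exact this
  choose Y hY using hY
  have hvw : ∀ Z ∈ Submodule.span ℝ (Set.range (vVec θ)), ∀ q, inner ℝ Z (wVec θ q) = 0 := by
    intro Z hZ q
    obtain ⟨a, rfl⟩ := (Submodule.mem_span_range_iff_exists_fun ℝ).mp hZ
    rw [sum_inner]
    refine Finset.sum_eq_zero fun r _ => ?_
    rw [inner_smul_left, inner_vVec, wVec_apply, wVec_apply, Sum.elim_inl, Sum.elim_inr]
    split_ifs
    · ring
    · simp
  have hHv : ∀ a, inner ℝ (vVec θ a) (e H) = 0 := by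
    intro a
    have h1 : Y a = ∑ i, Y a i • stdVec i := by
      ext l
      simp [stdVec, Pi.single_apply]
    rw [← hY a, h1, map_sum, map_sum, sum_inner]
    refine Finset.sum_eq_zero fun i _ => ?_
    rw [map_smul, map_smul, inner_smul_left, real_inner_comm]
    exact mul_eq_zero_of_right _ (hH' i)
  have hHw : ∀ q, inner ℝ (wVec θ q) (e H) =
      Real.cos θ * (τ.push c).τ2 ![basisVec (Sum.inl (q + 1)), basisVec (Sum.inl (q + 2))] +
      Real.sin θ * (τ.push c).τ2' ![basisVec (Sum.inl (q + 1)), basisVec (Sum.inl (q + 2))] -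
      (τ.push c).τ5 (wVec θ q) := by
    intro q
    have h1 := hX' (e.symm (wVec θ q)) fun a => by
      rw [ContinuousLinearEquiv.apply_symm_apply]
      exact hvw _ (hmem _) q
    rw [ContinuousLinearEquiv.apply_symm_apply] at h1
    let ηΥ : EuclideanSpace ℝ (Fin 6) [⋀^Fin 3]→L[ℝ] ℂ := S.Upsilon (f p)
    let ηd : EuclideanSpace ℝ (Fin 6) [⋀^Fin 4]→L[ℝ] ℂ := formD S.Upsilon (f p)
    let D : EuclideanSpace ℝ (Fin 3) →ₗ[ℝ] EuclideanSpace ℝ (Fin 6) :=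
      (euclDeriv f p : EuclideanSpace ℝ (Fin 3) →L[ℝ] EuclideanSpace ℝ (Fin 6))
    -- Both sides of the formula for ⟨H, w_q⟩ are values of top-degree forms on the tangent space: α
    -- is the pulled back calibration, and β the contraction of its exterior derivative with w_q. On
    -- Y the first is 1, since Υ₀(v_1, v_2, v_3) = e^{iθ}.
    let α : EuclideanSpace ℝ (Fin 3) [⋀^Fin 3]→ₗ[ℝ] ℝ :=
      ((phaseCLM θ).compContinuousAlternatingMap ηΥ).toAlternatingMap.compLinearMap
        D
    let β : EuclideanSpace ℝ (Fin 3) [⋀^Fin 3]→ₗ[ℝ] ℝ :=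
      (((phaseCLM θ).compContinuousAlternatingMap ηd).toAlternatingMap.curryLeft
        (e.symm (wVec θ q))).compLinearMap
        D
    have hα : α stdVec = phaseCLM θ (S.Upsilon (f p) (tangentFrame f p)) := rfl
    have hβ : β stdVec = phaseCLM θ (formD S.Upsilon (f p) ![e.symm (wVec θ q),
        tangentFrame f p 0, tangentFrame f p 1, tangentFrame f p 2]) := by
      change phaseCLM θ (ηd _) = phaseCLM θ (ηd _)
      congr 2
      funext i
      fin_cases i <;> rfl
    have hsymm : ∀ a, euclDeriv f p (Y a) = e.symm (vVec θ a) := fun a => by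
      rw [← hY, ContinuousLinearEquiv.symm_apply_apply]
    have hαY : α Y = 1 := by
      have h2 : α Y = phaseCLM θ (ηΥ fun a => e.symm (vVec θ a)) := by
        change phaseCLM θ (ηΥ fun a => euclDeriv f p (Y a)) = _
        simp only [hsymm]
      have h3 : ηΥ (fun a => e.symm (vVec θ a)) = modelUpsilon (vVec θ) := by
        have h4 : ηΥ = modelUpsilon.compContinuousLinearMap
          (e : EuclideanSpace ℝ (Fin 6) →L[ℝ] ModelV) := hc.1.2
        rw [h4]
        change modelUpsilon (fun a => e (e.symm (vVec θ a))) = _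
        simp only [ContinuousLinearEquiv.apply_symm_apply]
      have h5 : vVec θ = ![vVec θ 0, vVec θ 1, vVec θ 2] := by funext i; fin_cases i <;> rfl
      rw [h2, h3, h5, modelUpsilon_vVec, phaseCLM_apply, ← mul_assoc, ← Complex.exp_add]
      simp [Matrix.det_fin_three]
    have hβY : β Y = (τ.push c).τ5 (wVec θ q) -
        Real.cos θ * (τ.push c).τ2 ![basisVec (Sum.inl (q + 1)), basisVec (Sum.inl (q + 2))] -
        Real.sin θ * (τ.push c).τ2'
          ![basisVec (Sum.inl (q + 1)), basisVec (Sum.inl (q + 2))] := by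
      rw [← ((hc.1.isTorsion_iff τ).mp hτ).apply_wVec_vVec q]
      have h2 : β Y = phaseCLM θ (ηd fun i =>
          e.symm (![wVec θ q, vVec θ 0, vVec θ 1, vVec θ 2] i)) := by
        change phaseCLM θ (ηd _) = phaseCLM θ (ηd _)
        congr 2
        funext i
        fin_cases i
        · rfl
        · exact hsymm 0
        · exact hsymm 1
        · exact hsymm 2
      rw [h2]
      exact S.phaseCLM_formD θ (f p) _
    have h6 := alternating_three_proportional α β Y
    rw [hαY, one_mul] at h6
    rw [← hα, ← hβ, h6] at h1
    rw [← hα] at hne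
    have h7 : inner ℝ (e H) (wVec θ q) = -β Y :=
      mul_right_cancel₀ hne (h1.trans (by ring))
    rw [real_inner_comm, h7, hβY]
    ring
  have := eq_sum_wVec_of_inner θ hHv
  simp only [hHw] at this
  exact this

end SU3Structure

/-! ### SU(3) moves any special Lagrangian plane to the standard one. -/

section AdaptedCoframe

theorem complexCoord_add (X Y : ModelV) (p : Fin 3) :
    complexCoord (X + Y) p = complexCoord X p + complexCoord Y p := by
  simp only [complexCoord, PiLp.add_apply]
  push_cast
  ring

theorem complexCoord_smul (a : ℝ) (X : ModelV) (p : Fin 3) :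
    complexCoord (a • X) p = a * complexCoord X p := by
  simp only [complexCoord, PiLp.smul_apply, smul_eq_mul]
  push_cast
  ring

theorem complexCoord_sum {ι : Type*} (s : Finset ι) (X : ι → ModelV) (p : Fin 3) :
    complexCoord (∑ i ∈ s, X i) p = ∑ i ∈ s, complexCoord (X i) p := by
  classical
  induction s using Finset.induction_on with
  | empty => simp [complexCoord]
  | insert a s ha ih => rw [Finset.sum_insert ha, Finset.sum_insert ha, complexCoord_add, ih]

/-- The complex linear map taking `v_p(θ)` to `x p`. -/
def frameMap (θ : ℝ) (x : Fin 3 → ModelV) : ModelV →L[ℝ] ModelV :=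
  ∑ p, ((innerSL ℝ (vVec θ p)).smulRight (x p) + (innerSL ℝ (wVec θ p)).smulRight (modelJ (x p)))

theorem frameMap_apply (θ : ℝ) (x : Fin 3 → ModelV) (X : ModelV) : frameMap θ x X =
    ∑ p, ((inner ℝ (vVec θ p) X : ℝ) • x p + (inner ℝ (wVec θ p) X : ℝ) • modelJ (x p)) := by
  simp [frameMap, sum_apply]

theorem frameMap_vVec (θ : ℝ) (x : Fin 3 → ModelV) (p : Fin 3) :
    frameMap θ x (vVec θ p) = x p := by
  have h1 : ∀ q, (inner ℝ (vVec θ q) (vVec θ p) : ℝ) = if q = p then 1 else 0 := by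
    intro q
    rw [inner_vVec, vVec_apply, vVec_apply, Sum.elim_inl, Sum.elim_inr]
    split_ifs
    · linear_combination Real.sin_sq_add_cos_sq (θ / 3)
    · ring
  have h2 : ∀ q, (inner ℝ (wVec θ q) (vVec θ p) : ℝ) = 0 := by
    intro q
    rw [inner_wVec, vVec_apply, vVec_apply, Sum.elim_inl, Sum.elim_inr]
    split_ifs <;> ring
  rw [frameMap_apply]
  simp [h1, h2]

/-- The number ⟨v_p, X⟩ + i⟨w_p, X⟩ is e^{-iθ/3} times the p-th complex coordinate of X, so the map
is complex linear with matrix e^{-iθ/3} times the coordinates of the x_p. -/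
theorem complexCoord_frameMap (θ : ℝ) (x : Fin 3 → ModelV) (X : ModelV) (k : Fin 3) :
    complexCoord (frameMap θ x X) k = ∑ p,
      Complex.exp (-((θ / 3 : ℝ) * Complex.I)) * complexCoord X p * complexCoord (x p) k := by
  have h : Complex.exp (-((θ / 3 : ℝ) * Complex.I)) =
      Real.cos (θ / 3) - Complex.I * Real.sin (θ / 3) := by
    rw [← neg_mul, ← Complex.ofReal_neg, Complex.exp_mul_I, ← Complex.ofReal_cos,
      ← Complex.ofReal_sin, Real.cos_neg, Real.sin_neg]
    push_cast
    ring
  rw [frameMap_apply, complexCoord_sum]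
  refine Finset.sum_congr rfl fun p _ => ?_
  rw [complexCoord_add, complexCoord_smul, complexCoord_smul, complexCoord_modelJ, inner_vVec,
    inner_wVec, h]
  simp only [complexCoord]
  push_cast
  ring_nf
  simp only [Complex.I_sq, Complex.I_pow_three]
  ring

variable {θ : ℝ} {x : Fin 3 → ModelV}

/-- An orthonormal basis of a Lagrangian plane is a unitary basis, since the imaginary parts of its
Hermitian products are values of Ω₀. So the map is unitary. -/
theorem hermitian_frameMap (hx : ∀ p q, (inner ℝ (x p) (x q) : ℝ) = if p = q then 1 else 0)
    (hΩ : ∀ p q, modelOmega ![x p, x q] = 0) (X Y : ModelV) :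
    ∑ k, complexCoord (frameMap θ x X) k * (starRingEnd ℂ) (complexCoord (frameMap θ x Y) k) =
      ∑ k, complexCoord X k * (starRingEnd ℂ) (complexCoord Y k) := by
  set ε := Complex.exp (-((θ / 3 : ℝ) * Complex.I)) with hε
  have hε1 : ε * (starRingEnd ℂ) ε = 1 := by
    rw [Complex.mul_conj, Complex.normSq_eq_norm_sq, hε, ← neg_mul, ← Complex.ofReal_neg,
      Complex.norm_exp_ofReal_mul_I]
    simp
  have hU : ∀ p q, ∑ k, complexCoord (x p) k * (starRingEnd ℂ) (complexCoord (x q) k) =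
      if p = q then 1 else 0 := by
    intro p q
    rw [complexCoord_hermitian, hx, hΩ]
    split_ifs <;> simp
  have h1 : ∀ k, complexCoord (frameMap θ x X) k *
      (starRingEnd ℂ) (complexCoord (frameMap θ x Y) k) = ∑ p, ∑ q,
      (complexCoord X p * (starRingEnd ℂ) (complexCoord Y q)) *
        (complexCoord (x p) k * (starRingEnd ℂ) (complexCoord (x q) k)) := by
    intro k
    rw [complexCoord_frameMap, complexCoord_frameMap, map_sum, Finset.sum_mul_sum]
    refine Finset.sum_congr rfl fun p _ => Finset.sum_congr rfl fun q _ => ?_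
    rw [map_mul, map_mul]
    linear_combination (complexCoord X p * (starRingEnd ℂ) (complexCoord Y q)) *
        (complexCoord (x p) k * (starRingEnd ℂ) (complexCoord (x q) k)) * hε1
  simp only [h1]
  rw [Finset.sum_comm]
  refine Finset.sum_congr rfl fun p _ => ?_
  rw [Finset.sum_comm]
  simp only [← Finset.mul_sum, hU]
  simp

theorem omega_frameMap (hx : ∀ p q, (inner ℝ (x p) (x q) : ℝ) = if p = q then 1 else 0)
    (hΩ : ∀ p q, modelOmega ![x p, x q] = 0) (X Y : ModelV) :
    modelOmega ![frameMap θ x X, frameMap θ x Y] = modelOmega ![X, Y] := by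
  have h := hermitian_frameMap (θ := θ) hx hΩ X Y
  rw [complexCoord_hermitian, complexCoord_hermitian] at h
  simpa using congrArg Complex.im h

theorem inner_frameMap (hx : ∀ p q, (inner ℝ (x p) (x q) : ℝ) = if p = q then 1 else 0)
    (hΩ : ∀ p q, modelOmega ![x p, x q] = 0) (X Y : ModelV) :
    (inner ℝ (frameMap θ x X) (frameMap θ x Y) : ℝ) = inner ℝ X Y := by
  have h := hermitian_frameMap (θ := θ) hx hΩ X Y
  rw [complexCoord_hermitian, complexCoord_hermitian] at h
  have h1 := congrArg Complex.re h
  simp only [Complex.sub_re, Complex.ofReal_re, Complex.mul_re, Complex.I_re, Complex.I_im,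
    Complex.ofReal_im, zero_mul, mul_zero, sub_zero] at h1
  exact h1

/-- The complex determinant of the map is (e^{-iθ/3})³ e^{iθ} = 1; this is where the phase is used.
-/
theorem upsilon_frameMap (hΥ : modelUpsilon x = Complex.exp (θ * Complex.I))
    (X : Fin 3 → ModelV) : modelUpsilon (fun i => frameMap θ x (X i)) = modelUpsilon X := by
  set ε := Complex.exp (-((θ / 3 : ℝ) * Complex.I)) with hε
  have h1 : (Matrix.of fun a b => complexCoord (frameMap θ x (X a)) b) =
      (Matrix.of fun a b => complexCoord (X a) b) *
        (ε • Matrix.of fun a b => complexCoord (x a) b) := by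
    ext a b
    rw [Matrix.of_apply, complexCoord_frameMap, Matrix.mul_apply]
    refine Finset.sum_congr rfl fun p _ => ?_
    rw [Matrix.smul_apply, Matrix.of_apply, Matrix.of_apply, smul_eq_mul]
    ring
  have h2 : ε ^ 3 * Complex.exp (θ * Complex.I) = 1 := by
    rw [hε, ← Complex.exp_nat_mul, ← Complex.exp_add]
    have : ((3 : ℕ) : ℂ) * -(((θ / 3 : ℝ) : ℂ) * Complex.I) + θ * Complex.I = 0 := by
      push_cast
      ring
    rw [this, Complex.exp_zero]
  rw [modelUpsilon_eq_det, h1, Matrix.det_mul, Matrix.det_smul, ← modelUpsilon_eq_det,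
    ← modelUpsilon_eq_det, hΥ]
  simp only [Fintype.card_fin]
  rw [h2, mul_one]

/-- A positively oriented orthonormal basis of a special Lagrangian plane extends to a frame that
identifies the model structure with itself. -/
theorem exists_frameEquiv (hx : ∀ p q, (inner ℝ (x p) (x q) : ℝ) = if p = q then 1 else 0)
    (hΩ : ∀ p q, modelOmega ![x p, x q] = 0) (hΥ : modelUpsilon x = Complex.exp (θ * Complex.I)) :
    ∃ B : ModelV ≃L[ℝ] ModelV, (∀ p, B (vVec θ p) = x p) ∧
      (∀ X Y, modelOmega ![B X, B Y] = modelOmega ![X, Y]) ∧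
      ∀ X : Fin 3 → ModelV, modelUpsilon (fun i => B (X i)) = modelUpsilon X := by
  have hinj : Function.Injective (frameMap θ x : ModelV →ₗ[ℝ] ModelV) := by
    rw [injective_iff_map_eq_zero]
    intro X hX
    have h := inner_frameMap (θ := θ) hx hΩ X X
    have h0 : frameMap θ x X = 0 := hX
    rw [h0, inner_zero_left] at h
    exact inner_self_eq_zero.mp h.symm
  exact ⟨(LinearEquiv.ofInjectiveEndo _ hinj).toContinuousLinearEquiv, frameMap_vVec θ x,
    omega_frameMap hx hΩ, upsilon_frameMap hΥ⟩

/-- Every special Lagrangian plane has an orthonormal basis with `Υ₀ = e^{iθ}`. -/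
theorem exists_orthonormal_basis_of_calibrated (T : Submodule ℝ ModelV)
    (hT : Module.finrank ℝ T = 3) (hΩ : ∀ X ∈ T, ∀ Y ∈ T, modelOmega ![X, Y] = 0)
    (hΥ : ∀ X : Fin 3 → ModelV, (∀ i, X i ∈ T) →
      (Complex.exp (-(θ * Complex.I)) * modelUpsilon X).im = 0) :
    ∃ x : Fin 3 → ModelV, (∀ p q, (inner ℝ (x p) (x q) : ℝ) = if p = q then 1 else 0) ∧
      (∀ p, x p ∈ T) ∧ Submodule.span ℝ (Set.range x) = T ∧
      modelUpsilon x = Complex.exp (θ * Complex.I) := by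
  let b := (stdOrthonormalBasis ℝ T).reindex (finCongr hT)
  set x : Fin 3 → ModelV := fun p => b p with hxdef
  have hx : ∀ p q, (inner ℝ (x p) (x q) : ℝ) = if p = q then 1 else 0 := fun p q =>
    orthonormal_iff_ite.mp b.orthonormal p q
  have hxT : ∀ p, x p ∈ T := fun p => (b p).2
  have hspan : ∀ y : Fin 3 → ModelV, (∀ p q, (inner ℝ (y p) (y q) : ℝ) = if p = q then 1 else 0) →
      (∀ p, y p ∈ T) → Submodule.span ℝ (Set.range y) = T := by
    intro y hy hyT
    have hli : LinearIndependent ℝ y := (orthonormal_iff_ite.mpr hy).linearIndependent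
    refine Submodule.eq_of_le_of_finrank_eq (Submodule.span_le.mpr ?_) ?_
    · rintro _ ⟨p, rfl⟩
      exact hyT p
    · rw [finrank_span_eq_card hli, hT]
      simp
  have hphase : ∀ X : Fin 3 → ModelV, (∀ i, X i ∈ T) →
      modelUpsilon X = Complex.exp (θ * Complex.I) * (modelPhase θ X : ℝ) := by
    intro X hX
    have h1 : Complex.exp (-(θ * Complex.I)) * modelUpsilon X = (modelPhase θ X : ℝ) := by
      apply Complex.ext
      · simp [modelPhase]
      · rw [hΥ X hX]; simp
    rw [← h1, ← mul_assoc, ← Complex.exp_add]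
    simp
  -- The equality case of the calibration inequality with X = x_0: the Gram matrix of an orthonormal
  -- basis has determinant 1.
  have hsq : modelPhase θ x * modelPhase θ x = 1 := by
    have h := det_inner_eq_of_calibrated θ (Y := x) (fun a b => hΩ _ (hxT a) _ (hxT b))
      (hΥ x hxT) 0 (x 0)
    rw [Function.update_eq_self] at h
    rw [← h]
    have h1 : (Matrix.of fun a b => (inner ℝ (x a) (x b) : ℝ)) = 1 := by
      ext a b
      rw [Matrix.of_apply, hx, Matrix.one_apply]
    rw [h1, Matrix.det_one]
  rcases mul_self_eq_one_iff.mp hsq with h1 | h1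
  · exact ⟨x, hx, hxT, hspan x hx hxT, by rw [hphase x hxT, h1]; simp⟩
  -- If the basis has the wrong orientation, negating all three vectors corrects it, the degree
  -- being odd.
  · have hneg : modelUpsilon (fun p => -x p) = -modelUpsilon x := by
      have h := modelUpsilon.toMultilinearMap.map_smul_univ (fun _ => (-1 : ℝ)) x
      simp only [neg_smul, one_smul, Finset.prod_const, Finset.card_univ, Fintype.card_fin] at h
      refine Eq.trans h ?_
      norm_num
    have hx' : ∀ p q, (inner ℝ (-x p) (-x q) : ℝ) = if p = q then 1 else 0 := fun p q => by
      rw [inner_neg_neg, hx]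
    have hxT' : ∀ p, -x p ∈ T := fun p => T.neg_mem (hxT p)
    refine ⟨fun p => -x p, hx', hxT', hspan _ hx' hxT', ?_⟩
    rw [hneg, hphase x hxT, h1]
    simp

end AdaptedCoframe

namespace SU3Structure

variable {M : Type*} [TopologicalSpace M] [ChartedSpace (EuclideanSpace ℝ (Fin 6)) M]
  {S : SU3Structure M}
  {L : Type*} [TopologicalSpace L] [ChartedSpace (EuclideanSpace ℝ (Fin 3)) L]

/-- Any coframe takes the tangent space to a special Lagrangian plane of phase θ. Composing with the
inverse of a model automorphism that takes the v_p to an oriented orthonormal basis of this plane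
makes the coframe adapted. -/
theorem IsSpecialLagrangian.exists_adaptedCoframe {θ : ℝ} {f : L → M}
    (hf : S.IsSpecialLagrangian θ f) (p : L) :
    ∃ c : TangentSpace (𝓡 6) (f p) ≃L[ℝ] ModelV, S.IsAdaptedCoframe θ f p c := by
  let D : EuclideanSpace ℝ (Fin 3) →ₗ[ℝ] EuclideanSpace ℝ (Fin 6) :=
    (euclDeriv f p : EuclideanSpace ℝ (Fin 3) →L[ℝ] EuclideanSpace ℝ (Fin 6))
  let e : EuclideanSpace ℝ (Fin 6) →ₗ[ℝ] ModelV :=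
    ((S.euclCoframe (f p) : EuclideanSpace ℝ (Fin 6) →L[ℝ] ModelV))
  have hinj : Function.Injective (e ∘ₗ D) :=
    (S.euclCoframe (f p)).injective.comp (hf.immersion p)
  set T := LinearMap.range (e ∘ₗ D) with hT
  have hdim : Module.finrank ℝ T = 3 := by
    rw [hT, LinearMap.finrank_range_of_inj hinj]
    simp
  obtain ⟨x, hx, hxT, hspan, hxΥ⟩ := exists_orthonormal_basis_of_calibrated (θ := θ) T hdim
    (by
      rintro _ ⟨X, rfl⟩ _ ⟨Y, rfl⟩
      exact (S.modelOmega_euclCoframe (f p) _ _).trans (hf.omega_euclDeriv p X Y))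
    (by
      intro X hX
      choose Y hY using hX
      have : X = fun i => S.euclCoframe (f p) (D (Y i)) := funext fun i => (hY i).symm
      rw [this, modelUpsilon_euclCoframe]
      exact hf.phase p Y)
  have hΩx : ∀ p q, modelOmega ![x p, x q] = 0 := by
    intro a b
    obtain ⟨X, hX⟩ := hxT a
    obtain ⟨Y, hY⟩ := hxT b
    rw [← hX, ← hY]
    exact (S.modelOmega_euclCoframe (f p) _ _).trans (hf.omega_euclDeriv p X Y)
  obtain ⟨B, hBv, hBΩ, hBΥ⟩ := exists_frameEquiv hx hΩx hxΥ
  refine ⟨(S.coframe (f p)).trans B.symm, ⟨?_, ?_⟩, ?_⟩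
  · rw [(S.isCoframe_coframe (f p)).1]
    ext X
    change modelOmega (fun i => S.coframe (f p) (X i)) =
      modelOmega (fun i => B.symm (S.coframe (f p) (X i)))
    have h1 : ∀ Y : Fin 2 → ModelV, Y = ![Y 0, Y 1] := fun Y => by
      funext i; fin_cases i <;> rfl
    rw [h1 fun i => S.coframe (f p) (X i), h1 fun i => B.symm (S.coframe (f p) (X i))]
    refine Eq.trans ?_ (hBΩ _ _)
    simp only [ContinuousLinearEquiv.apply_symm_apply]
  · rw [(S.isCoframe_coframe (f p)).2]
    ext X
    change modelUpsilon (fun i => S.coframe (f p) (X i)) =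
      modelUpsilon (fun i => B.symm (S.coframe (f p) (X i)))
    refine Eq.trans ?_ (hBΥ _)
    simp only [ContinuousLinearEquiv.apply_symm_apply]
  · have h1 : Set.range (fun X : TangentSpace (𝓡 3) p =>
        ((S.coframe (f p)).trans B.symm) (mfderiv (𝓡 3) (𝓡 6) f p X)) =
        B.symm '' (T : Set ModelV) := by
      ext Z
      constructor
      · rintro ⟨X, rfl⟩
        exact ⟨_, ⟨X, rfl⟩, rfl⟩
      · rintro ⟨_, ⟨X, rfl⟩, rfl⟩
        exact ⟨X, rfl⟩
    have h2 : vVec θ = fun p => B.symm (x p) := by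
      funext p
      rw [← hBv, ContinuousLinearEquiv.symm_apply_apply]
    have h3 : Submodule.span ℝ (Set.range (vVec θ)) =
        T.map (B.symm : ModelV →ₗ[ℝ] ModelV) := by
      rw [← hspan, Submodule.map_span, h2, ← Set.range_comp]
      rfl
    rw [h1, h3]
    rfl

end SU3Structure

/-! ### Structures on ℝ⁶ with constant Ω and varying Υ. -/

section FlatSpace

variable {n : ℕ} {F : Type*} [NormedAddCommGroup F] [NormedSpace ℝ F] {k : ℕ}

theorem formInChart_euclidean (η : RoughForm n (EuclideanSpace ℝ (Fin n)) F k)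
    (x y : EuclideanSpace ℝ (Fin n)) : formInChart η x y = η y := by
  have h : ((extChartAt (𝓡 n) x).symm : EuclideanSpace ℝ (Fin n) → EuclideanSpace ℝ (Fin n)) =
      id := by
    rw [extChartAt_model_space_eq_id]
    rfl
  unfold formInChart
  rw [h]
  ext v
  change η y (fun i => mfderiv (𝓡 n) (𝓡 n) id y (v i)) = η y v
  rw [mfderiv_id]
  rfl

theorem formD_euclidean (η : RoughForm n (EuclideanSpace ℝ (Fin n)) F k)
    (x : EuclideanSpace ℝ (Fin n)) :
    formD η x = extDeriv (fun y => (η y : EuclideanSpace ℝ (Fin n) [⋀^Fin k]→L[ℝ] F)) x := by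
  rw [formD_eq]
  have h : formInChart η x = fun y => η y := funext fun y => formInChart_euclidean η x y
  rw [h, extChartAt_model_space_eq_id]
  rfl

/-- The identification of `ℝ⁶` with the model space. -/
def flatChart : EuclideanSpace ℝ (Fin 6) ≃L[ℝ] ModelV :=
  (LinearIsometryEquiv.piLpCongrLeft 2 ℝ ℝ
    (finSumFinEquiv (m := 3) (n := 3)).symm).toContinuousLinearEquiv

end FlatSpace

/-- A one-parameter family `A t` of symplectic automorphisms of the model space, to be evaluated at
`t = lam z`, with the resulting family `h t` of three-forms and its logarithmic derivative `D`. -/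
structure ShearData where
  A : ℝ → ModelV ≃L[ℝ] ModelV
  lam : ModelV →L[ℝ] ℝ
  h : ℝ → ModelV [⋀^Fin 3]→L[ℝ] ℂ
  D : ModelV [⋀^Fin 3]→L[ℝ] ℂ
  omega : ∀ t X Y, modelOmega ![A t X, A t Y] = modelOmega ![X, Y]
  upsilon : ∀ t X Y Z, h t ![X, Y, Z] = modelUpsilon ![A t X, A t Y, A t Z]
  smooth : ContDiff ℝ ∞ h
  hasDerivAt : ∀ t, HasDerivAt h
    (D.compContinuousLinearMap (A t : ModelV →L[ℝ] ModelV)) t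

namespace ShearData

variable (d : ShearData)

theorem vec_two {V : Type*} (v : Fin 2 → V) : v = ![v 0, v 1] := by
  funext i; fin_cases i <;> rfl

theorem vec_three {V : Type*} (v : Fin 3 → V) : v = ![v 0, v 1, v 2] := by
  funext i; fin_cases i <;> rfl

theorem vec_four {V : Type*} (v : Fin 4 → V) : v = ![v 0, v 1, v 2, v 3] := by
  funext i; fin_cases i <;> rfl

/-- The three-form `h (lam z)` on `ℝ⁶`. -/
def form (x : EuclideanSpace ℝ (Fin 6)) : EuclideanSpace ℝ (Fin 6) [⋀^Fin 3]→L[ℝ] ℂ :=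
  (d.h (d.lam (flatChart x))).compContinuousLinearMap
    (flatChart : EuclideanSpace ℝ (Fin 6) →L[ℝ] ModelV)

/-- The coframe of the `SU(3)`-structure attached to a shear. -/
def frame (x : EuclideanSpace ℝ (Fin 6)) : EuclideanSpace ℝ (Fin 6) ≃L[ℝ] ModelV :=
  flatChart.trans (d.A (d.lam (flatChart x)))

theorem omega_frame (x : EuclideanSpace ℝ (Fin 6)) :
    modelOmega.compContinuousLinearMap (flatChart : EuclideanSpace ℝ (Fin 6) →L[ℝ] ModelV) =
    modelOmega.compContinuousLinearMap
      (d.frame x : EuclideanSpace ℝ (Fin 6) →L[ℝ] ModelV) := by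
  ext v
  rw [vec_two v, compCLM_vec_two, compCLM_vec_two]
  exact (d.omega _ _ _).symm

theorem form_frame (x : EuclideanSpace ℝ (Fin 6)) : d.form x =
    modelUpsilon.compContinuousLinearMap
      (d.frame x : EuclideanSpace ℝ (Fin 6) →L[ℝ] ModelV) := by
  ext v
  rw [vec_three v, form, compCLM_vec_three, compCLM_vec_three]
  exact d.upsilon _ _ _ _

/-- The pullback of three-forms to `ℝ⁶`. -/
def pullbackCLM : (ModelV [⋀^Fin 3]→L[ℝ] ℂ) →L[ℝ] (EuclideanSpace ℝ (Fin 6) [⋀^Fin 3]→L[ℝ] ℂ) :=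
  ContinuousAlternatingMap.compContinuousLinearMapCLM
    (flatChart : EuclideanSpace ℝ (Fin 6) →L[ℝ] ModelV)

theorem contDiff_form : ContDiff ℝ ∞ d.form :=
  pullbackCLM.contDiff.comp (d.smooth.comp (d.lam.contDiff.comp flatChart.contDiff))

theorem smooth_omega : IsSmoothForm (M := EuclideanSpace ℝ (Fin 6)) fun _ =>
    modelOmega.compContinuousLinearMap
      (flatChart : EuclideanSpace ℝ (Fin 6) →L[ℝ] ModelV) := by
  intro x
  exact (contDiffOn_const (c := modelOmega.compContinuousLinearMap
    (flatChart : EuclideanSpace ℝ (Fin 6) →L[ℝ] ModelV))).congr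
    fun y _ => formInChart_euclidean (fun _ => modelOmega.compContinuousLinearMap
      (flatChart : EuclideanSpace ℝ (Fin 6) →L[ℝ] ModelV)) x y

/-- The `SU(3)`-structure on `ℝ⁶` attached to a shear. -/
def su3 : SU3Structure (EuclideanSpace ℝ (Fin 6)) where
  Omega := fun _ =>
    modelOmega.compContinuousLinearMap (flatChart : EuclideanSpace ℝ (Fin 6) →L[ℝ] ModelV)
  Upsilon := d.form
  smooth_Omega := smooth_omega
  smooth_Upsilon := fun x =>
    d.contDiff_form.contDiffOn.congr fun y _ => formInChart_euclidean _ x y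
  exists_coframe := fun x => ⟨d.frame x, d.omega_frame x, d.form_frame x⟩

theorem isCoframe_frame (x : EuclideanSpace ℝ (Fin 6)) : d.su3.IsCoframe x (d.frame x) :=
  ⟨d.omega_frame x, d.form_frame x⟩

/-- Since h'(t) is the pullback of the fixed form D by A t, differentiating Υ gives λ(X) times D
read in the moving coframe. Alternated, this is dΥ = λ ∧ D. -/
theorem fderiv_form (x X : EuclideanSpace ℝ (Fin 6)) (Y : Fin 3 → EuclideanSpace ℝ (Fin 6)) :
    fderiv ℝ d.form x X Y = d.lam (flatChart X) • d.D (fun i => d.frame x (Y i)) := by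
  let l : EuclideanSpace ℝ (Fin 6) →L[ℝ] ℝ :=
    d.lam.comp (flatChart : EuclideanSpace ℝ (Fin 6) →L[ℝ] ModelV)
  have h1 : HasFDerivAt (fun y => d.h (l y)) _ x :=
    (d.hasDerivAt (l x)).hasFDerivAt.comp x l.hasFDerivAt
  have h2 : HasFDerivAt d.form _ x := pullbackCLM.hasFDerivAt.comp x h1
  rw [h2.fderiv]
  rfl

theorem formD_Omega (x : EuclideanSpace ℝ (Fin 6)) : formD d.su3.Omega x = 0 := by
  refine (formD_euclidean _ x).trans ?_
  have h : fderiv ℝ (fun _ : EuclideanSpace ℝ (Fin 6) => modelOmega.compContinuousLinearMap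
      (flatChart : EuclideanSpace ℝ (Fin 6) →L[ℝ] ModelV)) x = 0 := (hasFDerivAt_const _ _).fderiv
  ext v
  rw [vec_three v]
  refine (extDeriv_two_apply (fun _ : EuclideanSpace ℝ (Fin 6) =>
    modelOmega.compContinuousLinearMap
      (flatChart : EuclideanSpace ℝ (Fin 6) →L[ℝ] ModelV)) x _ _ _).trans ?_
  rw [h]
  change (0 : ℝ) - 0 + 0 = 0
  norm_num

theorem formD_Upsilon (x X Y Z W : EuclideanSpace ℝ (Fin 6)) :
    formD d.su3.Upsilon x ![X, Y, Z, W] =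
      d.lam (flatChart X) • d.D ![d.frame x Y, d.frame x Z, d.frame x W] -
      d.lam (flatChart Y) • d.D ![d.frame x X, d.frame x Z, d.frame x W] +
      d.lam (flatChart Z) • d.D ![d.frame x X, d.frame x Y, d.frame x W] -
      d.lam (flatChart W) • d.D ![d.frame x X, d.frame x Y, d.frame x Z] := by
  rw [formD_euclidean]
  refine (extDeriv_three_apply d.form x X Y Z W).trans ?_
  simp only [fderiv_form, comp_vec_three]

/-- The one-form `lam`, read in the coframe at a point where it takes the value `t`. -/
def covec (t : ℝ) : ModelV →L[ℝ] ℝ := d.lam.comp ((d.A t).symm : ModelV →L[ℝ] ModelV)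

theorem clm_formD_Upsilon (L : ℂ →L[ℝ] ℝ) (x : EuclideanSpace ℝ (Fin 6)) :
    AlternatingMap.compLinearMap (ι := Fin 4)
      (L.compContinuousAlternatingMap (formD d.su3.Upsilon x)).toAlternatingMap
      ((d.frame x).symm : ModelV →ₗ[ℝ] EuclideanSpace ℝ (Fin 6)) =
    wedge (oneForm (d.covec (d.lam (flatChart x))))
      (L.compContinuousAlternatingMap d.D).toAlternatingMap := by
  ext v
  have e : ∀ i, d.lam (flatChart ((d.frame x).symm (v i))) = d.covec (d.lam (flatChart x)) (v i) := by
    intro i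
    simp [frame, covec]
  rw [wedge_one_three]
  change L (formD d.su3.Upsilon x (fun i => (d.frame x).symm (v i))) = _
  rw [vec_four v, comp_vec_four]
  refine (congrArg L (d.formD_Upsilon x _ _ _ _)).trans ?_
  simp only [e, ContinuousLinearEquiv.apply_symm_apply, map_add, map_sub, map_smul, oneForm_apply,
    smul_eq_mul]
  rfl

/-- In the moving coframe dΩ is 0 and dΥ is λ ∧ D, with λ carried by A t, so the torsion at a point
depends only on the value t of λ there. -/
theorem inClass {C : Set TorsionLabel} (hC : ∀ t, ∃ τ, IsModelTorsion 0
      (wedge (oneForm (d.covec t)) (Complex.reCLM.compContinuousAlternatingMap d.D).toAlternatingMap)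
      (wedge (oneForm (d.covec t)) (Complex.imCLM.compContinuousAlternatingMap d.D).toAlternatingMap)
      τ ∧ ∀ l ∉ C, τ.Vanishes l) : d.su3.InClass C := by
  intro x
  obtain ⟨τ, h1, h2⟩ := hC (d.lam (flatChart x))
  refine ⟨τ.pull (d.frame x), ?_, fun l hl => ?_⟩
  · rw [(d.isCoframe_frame x).isTorsion_iff]
    have h3 := TorsionForms.push_pull τ (d.frame x)
    have h4 := d.clm_formD_Upsilon Complex.reCLM x
    have h5 := d.clm_formD_Upsilon Complex.imCLM x
    rw [d.su3.formD_reUpsilon, d.su3.formD_imUpsilon, d.formD_Omega]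
    erw [h3, h4, h5]
    exact h1
  · have := h2 l hl
    cases l <;> simp only [TorsionForms.Vanishes] at this ⊢ <;>
      simp only [TorsionForms.pull, this] <;> rfl

/-- Linear special Lagrangian three-folds in the fibre `lam = 0` are not minimal, if `D` has a
component along them. -/
theorem not_isMinimalClass {C : Set TorsionLabel} (hC : d.su3.InClass C)
    (hA : ∀ X, d.A 0 X = X) (θ : ℝ) (B : EuclideanSpace ℝ (Fin 3) →L[ℝ] ModelV)
    (hB : Function.Injective B) (hlam : ∀ X, d.lam (B X) = 0)
    (hω : ∀ X Y, modelOmega ![B X, B Y] = 0)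
    (hθ : ∀ X Y Z, (Complex.exp (-(θ * Complex.I)) * modelUpsilon ![B X, B Y, B Z]).im = 0)
    (hne : ∃ X, d.lam X ≠ 0)
    (hD : phaseCLM θ (d.D ![B (stdVec 0), B (stdVec 1), B (stdVec 2)]) ≠ 0) :
    ¬ IsMinimalClass C := by
  intro hmin
  let f : EuclideanSpace ℝ (Fin 3) →L[ℝ] EuclideanSpace ℝ (Fin 6) :=
    (flatChart.symm : ModelV →L[ℝ] EuclideanSpace ℝ (Fin 6)).comp B
  have hf : ∀ p, (mfderiv (𝓡 3) (𝓡 6) f p :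
      EuclideanSpace ℝ (Fin 3) →L[ℝ] EuclideanSpace ℝ (Fin 6)) = f := fun p => by
    rw [mfderiv_eq_fderiv]
    exact f.fderiv
  have hι : ∀ X, flatChart (f X) = B X := fun X => flatChart.apply_symm_apply _
  -- Along the plane λ = 0, so the structure there is the flat one; only its transverse derivative
  -- differs.
  have hframe : ∀ p X, d.frame (f p) X = flatChart X := fun p X => by
    simp [frame, hι, hlam, hA]
  have hlag : ∀ Y : Fin 2 → EuclideanSpace ℝ (Fin 3),
      modelOmega (fun i => flatChart (f (Y i))) = 0 := fun Y => by
    simp only [hι]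
    rw [vec_two (fun i => B (Y i))]
    exact hω _ _
  have hphase : ∀ p (Y : Fin 3 → EuclideanSpace ℝ (Fin 3)), (Complex.exp (-(θ * Complex.I)) *
      modelUpsilon (fun i => d.frame (f p) (f (Y i)))).im = 0 := fun p Y => by
    simp only [hframe, hι]
    rw [vec_three (fun i => B (Y i))]
    exact hθ _ _ _
  have hSL : d.su3.IsSpecialLagrangian θ f := by
    refine ⟨f.contDiff.contMDiff, fun p => ?_, fun p X => ?_, fun p X => ?_⟩
    · rw [show mfderiv (𝓡 3) (𝓡 6) f p = f from hf p]
      exact flatChart.symm.injective.comp hB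
    · rw [show mfderiv (𝓡 3) (𝓡 6) f p = f from hf p]
      exact hlag X
    · rw [show mfderiv (𝓡 3) (𝓡 6) f p = f from hf p, (d.isCoframe_frame (f p)).2]
      exact hphase p X
  have hH := hmin _ _ d.su3 θ f hC hSL 0
  obtain ⟨-, -, h⟩ := hSL.inner_meanCurvature 0
  rw [hH] at h
  have htan : ∀ a, SU3Structure.tangentFrame f 0 a = f (stdVec a) := fun a => by
    exact congrArg (fun l : EuclideanSpace ℝ (Fin 3) →L[ℝ] EuclideanSpace ℝ (Fin 6) =>
      l (stdVec a)) (hf 0)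
  -- The gradient of λ is normal to the plane, and in dφ(Z, ·, ·, ·) = (λ ∧ Re(e^{-iθ}D))(Z, ·, ·,
  -- ·) only the term λ(Z) = |Z|² survives on the plane. H = 0 would make this product vanish.
  let Z : ModelV := (InnerProductSpace.toDual ℝ ModelV).symm d.lam
  have hZ : ∀ X, inner ℝ Z X = d.lam X := fun X => InnerProductSpace.toDual_symm_apply
  have hin : ∀ X Y : EuclideanSpace ℝ (Fin 6),
      inner ℝ (d.su3.euclCoframe (f 0) X) (d.su3.euclCoframe (f 0) Y) =
        (inner ℝ (flatChart X) (flatChart Y) : ℝ) := fun X Y => by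
    refine (SU3Structure.metric_eq_of_isCoframe (d.isCoframe_frame (f 0)) X Y).trans ?_
    exact congrArg₂ (fun v w : ModelV => (inner ℝ v w : ℝ)) (hframe 0 X) (hframe 0 Y)
  have h1 := h (flatChart.symm Z) fun a => by
    rw [hin, htan, hι, ContinuousLinearEquiv.apply_symm_apply, real_inner_comm, hZ, hlam]
  have h2 : phaseCLM θ (formD d.su3.Upsilon (f 0) ![flatChart.symm Z,
      SU3Structure.tangentFrame f 0 0, SU3Structure.tangentFrame f 0 1,
      SU3Structure.tangentFrame f 0 2]) = 0 := by
    have : d.su3.euclCoframe (f 0) 0 = 0 := map_zero _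
    have h3 := h1.symm.trans (by erw [this, inner_zero_left, zero_mul])
    exact neg_eq_zero.mp h3
  have h4 := (congrArg (phaseCLM θ) (d.formD_Upsilon (f 0) (flatChart.symm Z)
      (SU3Structure.tangentFrame f 0 0) (SU3Structure.tangentFrame f 0 1)
      (SU3Structure.tangentFrame f 0 2))).symm.trans h2
  simp only [htan, hframe, hι, hlam, zero_smul, sub_zero, add_zero,
    ContinuousLinearEquiv.apply_symm_apply, map_smul, smul_eq_mul, ← hZ Z,
    real_inner_self_eq_norm_sq] at h4
  rcases mul_eq_zero.mp h4 with h5 | h5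
  · obtain ⟨X, hX⟩ := hne
    apply hX
    rw [← hZ, norm_eq_zero.mp (pow_eq_zero_iff (two_ne_zero) |>.mp h5), inner_zero_left]
  · exact hD h5

end ShearData

/-! ### Two families of symplectic maps: shears and stretches. -/

namespace ShearData

/-- The nilpotent symplectic map `e_2 ↦ e_6`, `e_3 ↦ e_5`. -/
def shearN : ModelV →L[ℝ] ModelV :=
  (dualVec (Sum.inl 2)).smulRight (basisVec (Sum.inr 1)) +
    (dualVec (Sum.inl 1)).smulRight (basisVec (Sum.inr 2))

theorem shearN_apply (X : ModelV) (i : Fin 3 ⊕ Fin 3) : shearN X i =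
    Sum.elim (fun _ => 0) ![0, X (Sum.inl 2), X (Sum.inl 1)] i := by
  rcases i with p | p <;> fin_cases p <;> simp [shearN, dualVec, basisVec]

theorem shearN_shearN (X : ModelV) : shearN (shearN X) = 0 := by
  ext i
  rw [shearN_apply]
  rcases i with p | p <;> fin_cases p <;> simp [shearN_apply]

/-- The shears `exp (t N) = 1 + t N`. -/
def shear (t : ℝ) : ModelV ≃L[ℝ] ModelV :=
  ContinuousLinearEquiv.equivOfInverse (ContinuousLinearMap.id ℝ ModelV + t • shearN)
    (ContinuousLinearMap.id ℝ ModelV - t • shearN)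
    (fun X => by simp [shearN_shearN]) (fun X => by simp [shearN_shearN])

theorem shear_apply (t : ℝ) (X : ModelV) (i : Fin 3 ⊕ Fin 3) : shear t X i = X i +
    t * Sum.elim (fun _ => 0) ![0, X (Sum.inl 2), X (Sum.inl 1)] i := by
  rw [← shearN_apply]
  rfl

/-- The coefficient of `t` in the pullback of `Υ₀` by the shear. -/
def shearD : ModelV [⋀^Fin 3]→L[ℝ] ℂ :=
  (1 / 2 : ℝ) • (modelUpsilon.compContinuousLinearMap (shear 1 : ModelV →L[ℝ] ModelV) -
    modelUpsilon.compContinuousLinearMap (shear (-1) : ModelV →L[ℝ] ModelV))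

/-- The coefficient of `t²` in the pullback of `Υ₀` by the shear. -/
def shearD' : ModelV [⋀^Fin 3]→L[ℝ] ℂ :=
  (1 / 2 : ℝ) • (modelUpsilon.compContinuousLinearMap (shear 1 : ModelV →L[ℝ] ModelV) +
    modelUpsilon.compContinuousLinearMap (shear (-1) : ModelV →L[ℝ] ModelV)) - modelUpsilon

theorem shearD_apply (X Y Z : ModelV) : shearD ![X, Y, Z] = (1 / 2 : ℝ) •
    (modelUpsilon ![shear 1 X, shear 1 Y, shear 1 Z] -
      modelUpsilon ![shear (-1) X, shear (-1) Y, shear (-1) Z]) := by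
  rw [shearD, ContinuousAlternatingMap.smul_apply, ContinuousAlternatingMap.sub_apply,
    compCLM_vec_three, compCLM_vec_three]
  rfl

theorem shearD'_apply (X Y Z : ModelV) : shearD' ![X, Y, Z] = (1 / 2 : ℝ) •
    (modelUpsilon ![shear 1 X, shear 1 Y, shear 1 Z] +
      modelUpsilon ![shear (-1) X, shear (-1) Y, shear (-1) Z]) - modelUpsilon ![X, Y, Z] := by
  rw [shearD', ContinuousAlternatingMap.sub_apply, ContinuousAlternatingMap.smul_apply,
    ContinuousAlternatingMap.add_apply, compCLM_vec_three, compCLM_vec_three]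
  rfl

/-- There is no cubic term because N has rank two. The coefficients of t and t² are thus the odd and
even parts at t = ±1, the even part corrected by the value at 0. -/
theorem modelUpsilon_shear (t : ℝ) (X Y Z : ModelV) :
    modelUpsilon ![shear t X, shear t Y, shear t Z] =
      modelUpsilon ![X, Y, Z] + t • shearD ![X, Y, Z] + t ^ 2 • shearD' ![X, Y, Z] := by
  rw [shearD_apply, shearD'_apply]
  simp only [modelUpsilon_apply, Matrix.det_fin_three, Matrix.of_apply, Matrix.cons_val_zero,
    Matrix.cons_val_one, Matrix.cons_val, shear_apply, Sum.elim_inl, Sum.elim_inr,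
    Complex.real_smul]
  push_cast
  ring

/-- The right side is the derivative in t of the quadratic polynomial above, so `shearD` is the
logarithmic derivative of the family of pulled back forms. -/
theorem shearD_shear (t : ℝ) (X Y Z : ModelV) :
    shearD ![shear t X, shear t Y, shear t Z] =
      shearD ![X, Y, Z] + (2 * t) • shearD' ![X, Y, Z] := by
  simp only [shearD_apply, shearD'_apply]
  simp only [modelUpsilon_apply, Matrix.det_fin_three, Matrix.of_apply, Matrix.cons_val_zero,
    Matrix.cons_val_one, Matrix.cons_val, shear_apply, Sum.elim_inl, Sum.elim_inr,
    Complex.real_smul]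
  push_cast
  ring

/-- N maps ⟨e_2, e_3⟩ to ⟨e_5, e_6⟩ by a symmetric matrix, so it lies in the symplectic Lie algebra.
-/
theorem modelOmega_shear (t : ℝ) (X Y : ModelV) :
    modelOmega ![shear t X, shear t Y] = modelOmega ![X, Y] := by
  simp only [modelOmega_apply, Fin.sum_univ_three, shear_apply, Sum.elim_inl, Sum.elim_inr,
    Matrix.cons_val_zero, Matrix.cons_val_one, Matrix.cons_val]
  ring

theorem hasDerivAt_quadratic {V : Type*} [NormedAddCommGroup V] [NormedSpace ℝ V] (a b c : V)
    (t : ℝ) : HasDerivAt (fun t : ℝ => a + t • b + t ^ 2 • c) (b + (2 * t) • c) t := by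
  have e1 := (hasDerivAt_id t).smul_const b
  have e2 := ((hasDerivAt_id t).pow 2).smul_const c
  have e3 := (e1.const_add a).add e2
  exact e3.congr_deriv (by simp)

theorem hasDerivAt_exp_smul {V : Type*} [NormedAddCommGroup V] [NormedSpace ℝ V] (a b : V)
    (t : ℝ) : HasDerivAt (fun t : ℝ => Real.exp t • a + Real.exp (-t) • b)
      (Real.exp t • a + (-Real.exp (-t)) • b) t := by
  have e1 := (Real.hasDerivAt_exp t).smul_const a
  have e2 := (hasDerivAt_neg t).exp.smul_const b
  exact (e1.add e2).congr_deriv (by simp)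

theorem shearD_comp_shear (t : ℝ) :
    shearD.compContinuousLinearMap (shear t : ModelV →L[ℝ] ModelV) =
      shearD + (2 * t) • shearD' := by
  ext v
  rw [vec_three v, compCLM_vec_three, ContinuousAlternatingMap.add_apply,
    ContinuousAlternatingMap.smul_apply, ← shearD_shear]
  rfl

theorem hasDerivAt_shear (t : ℝ) :
    HasDerivAt (fun t : ℝ => modelUpsilon + t • shearD + t ^ 2 • shearD')
      (shearD.compContinuousLinearMap (shear t : ModelV →L[ℝ] ModelV)) t := by
  rw [shearD_comp_shear]
  exact hasDerivAt_quadratic modelUpsilon shearD shearD' t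

/-- The shears by `exp (λ N)`, for a covector `λ`. -/
def ofShear (lam : ModelV →L[ℝ] ℝ) : ShearData where
  A := shear
  lam := lam
  h := fun t => modelUpsilon + t • shearD + t ^ 2 • shearD'
  D := shearD
  omega := modelOmega_shear
  upsilon := fun t X Y Z => (modelUpsilon_shear t X Y Z).symm
  smooth := by fun_prop
  hasDerivAt := hasDerivAt_shear

/-- The symplectic diagonal maps `e_1 ↦ a e_1`, `e_4 ↦ b e_4`. -/
def stretchMap (a b : ℝ) : ModelV →L[ℝ] ModelV :=
  ContinuousLinearMap.id ℝ ModelV +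
    (a - 1) • (dualVec (Sum.inl 0)).smulRight (basisVec (Sum.inl 0)) +
    (b - 1) • (dualVec (Sum.inr 0)).smulRight (basisVec (Sum.inr 0))

theorem stretchMap_apply (a b : ℝ) (X : ModelV) (i : Fin 3 ⊕ Fin 3) : stretchMap a b X i =
    Sum.elim ![a * X (Sum.inl 0), X (Sum.inl 1), X (Sum.inl 2)]
      ![b * X (Sum.inr 0), X (Sum.inr 1), X (Sum.inr 2)] i := by
  rcases i with p | p <;> fin_cases p <;> simp [stretchMap, dualVec, basisVec] <;> ring

theorem stretchMap_stretchMap {a b c d : ℝ} (h : a * c = 1) (h' : b * d = 1) (X : ModelV) :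
    stretchMap a b (stretchMap c d X) = X := by
  ext i
  rw [stretchMap_apply]
  rcases i with p | p <;> fin_cases p <;> simp [stretchMap_apply, ← mul_assoc, h, h']

theorem exp_mul_exp_neg (t : ℝ) : Real.exp t * Real.exp (-t) = 1 := by
  rw [← Real.exp_add, add_neg_cancel, Real.exp_zero]

theorem exp_neg_mul_exp (t : ℝ) : Real.exp (-t) * Real.exp t = 1 := by
  rw [mul_comm, exp_mul_exp_neg]

/-- The symplectic stretching maps `e_1 ↦ exp(t) e_1`, `e_4 ↦ exp(-t) e_4`. -/
def stretch (t : ℝ) : ModelV ≃L[ℝ] ModelV :=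
  ContinuousLinearEquiv.equivOfInverse (stretchMap (Real.exp t) (Real.exp (-t)))
    (stretchMap (Real.exp (-t)) (Real.exp t))
    (stretchMap_stretchMap (exp_neg_mul_exp t) (exp_mul_exp_neg t))
    (stretchMap_stretchMap (exp_mul_exp_neg t) (exp_neg_mul_exp t))

/-- The part `(a e^1 + i b e^4) ∧ (e^2 + i e^5) ∧ (e^3 + i e^6)` of `Υ₀`. -/
def stretchForm (a b : ℝ) : ModelV [⋀^Fin 3]→L[ℝ] ℂ :=
  modelUpsilon.compContinuousLinearMap (stretchMap a b)

theorem stretchForm_apply (a b : ℝ) (X Y Z : ModelV) : stretchForm a b ![X, Y, Z] =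
    Matrix.det (Matrix.of fun p q : Fin 3 =>
      ((![a, 1, 1] q * (![X, Y, Z] p) (Sum.inl q) : ℝ) : ℂ) +
        Complex.I * ((![b, 1, 1] q * (![X, Y, Z] p) (Sum.inr q) : ℝ) : ℂ)) := by
  rw [stretchForm, compCLM_vec_three, modelUpsilon_apply]
  congr 1
  ext p q
  fin_cases p <;> fin_cases q <;> simp [stretchMap_apply]

/-- Only the first factor a e^1 + i b e^4 is affected, and it becomes a e^t e^1 + i b e^{-t} e^4.
Differentiating the case a = b = 1 flips the sign of e^4, whence D = `stretchForm 1 (-1)`. -/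
theorem stretchForm_stretch (a b t : ℝ) (X Y Z : ModelV) :
    stretchForm a b ![stretch t X, stretch t Y, stretch t Z] =
      Real.exp t • stretchForm a 0 ![X, Y, Z] + Real.exp (-t) • stretchForm 0 b ![X, Y, Z] := by
  have h : ∀ X, stretch t X = stretchMap (Real.exp t) (Real.exp (-t)) X := fun X => rfl
  simp only [stretchForm_apply, Matrix.det_fin_three, Matrix.of_apply, Matrix.cons_val_zero,
    Matrix.cons_val_one, Matrix.cons_val, h, stretchMap_apply, Sum.elim_inl, Sum.elim_inr,
    Complex.real_smul]
  push_cast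
  ring

theorem stretchForm_one_one (X Y Z : ModelV) : stretchForm 1 1 ![X, Y, Z] =
    modelUpsilon ![X, Y, Z] := by
  have h : ∀ X, stretchMap 1 1 X = X := fun X => by simp [stretchMap]
  rw [stretchForm, compCLM_vec_three, h, h, h]

theorem stretchForm_comp_stretch (t : ℝ) :
    (stretchForm 1 (-1)).compContinuousLinearMap (stretch t : ModelV →L[ℝ] ModelV) =
      Real.exp t • stretchForm 1 0 + (-Real.exp (-t)) • stretchForm 0 1 := by
  have h : ∀ X Y Z, stretchForm 0 (-1) ![X, Y, Z] = -stretchForm 0 1 ![X, Y, Z] := by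
    intro X Y Z
    simp only [stretchForm_apply, Matrix.det_fin_three, Matrix.of_apply, Matrix.cons_val_zero,
      Matrix.cons_val_one, Matrix.cons_val]
    push_cast
    ring
  ext v
  rw [vec_three v, compCLM_vec_three, ContinuousAlternatingMap.add_apply,
    ContinuousAlternatingMap.smul_apply, ContinuousAlternatingMap.smul_apply]
  refine (stretchForm_stretch _ _ _ _ _ _).trans ?_
  rw [h, smul_neg, ← neg_smul]

theorem hasDerivAt_stretch (t : ℝ) :
    HasDerivAt (fun t : ℝ => Real.exp t • stretchForm 1 0 + Real.exp (-t) • stretchForm 0 1)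
      ((stretchForm 1 (-1)).compContinuousLinearMap (stretch t : ModelV →L[ℝ] ModelV)) t := by
  rw [stretchForm_comp_stretch]
  exact hasDerivAt_exp_smul (stretchForm 1 0) (stretchForm 0 1) t

/-- The stretching maps with parameter `λ = e^4`. -/
def ofStretch : ShearData where
  A := stretch
  lam := dualVec (Sum.inr 0)
  h := fun t => Real.exp t • stretchForm 1 0 + Real.exp (-t) • stretchForm 0 1
  D := stretchForm 1 (-1)
  omega := fun t X Y => by
    have h : ∀ X, stretch t X = stretchMap (Real.exp t) (Real.exp (-t)) X := fun X => rfl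
    simp only [modelOmega_apply, Fin.sum_univ_three, h, stretchMap_apply, Sum.elim_inl,
      Sum.elim_inr, Matrix.cons_val_zero, Matrix.cons_val_one, Matrix.cons_val]
    linear_combination (X (Sum.inl 0) * Y (Sum.inr 0) - X (Sum.inr 0) * Y (Sum.inl 0)) *
      exp_mul_exp_neg t
  upsilon := fun t X Y Z => by
    rw [← stretchForm_one_one, stretchForm_stretch]
    rfl
  smooth := by fun_prop
  hasDerivAt := hasDerivAt_stretch

end ShearData

/-! ### Non-minimal special Lagrangians whose ambient torsion is τ2, τ̂2 or τ5 alone. -/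

namespace ShearData

/-- The linear map with given columns. -/
def ofColumns (b : Fin 3 → ModelV) : EuclideanSpace ℝ (Fin 3) →L[ℝ] ModelV :=
  ∑ a, (EuclideanSpace.proj a : EuclideanSpace ℝ (Fin 3) →L[ℝ] ℝ).smulRight (b a)

theorem ofColumns_apply (b : Fin 3 → ModelV) (X : EuclideanSpace ℝ (Fin 3)) (i : Fin 3 ⊕ Fin 3) :
    ofColumns b X i = X 0 * b 0 i + X 1 * b 1 i + X 2 * b 2 i := by
  simp [ofColumns, Fin.sum_univ_three]

theorem ofColumns_stdVec (b : Fin 3 → ModelV) (a : Fin 3) : ofColumns b (stdVec a) = b a := by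
  ext i
  rw [ofColumns_apply]
  fin_cases a <;> simp [stdVec]

theorem exp_neg_zero_mul_I : Complex.exp (-(((0 : ℝ) : ℂ) * Complex.I)) = 1 := by simp

theorem exp_neg_pi_div_two_mul_I :
    Complex.exp (-(((Real.pi / 2 : ℝ) : ℂ) * Complex.I)) = -Complex.I := by
  rw [Complex.exp_neg]
  push_cast
  rw [Complex.exp_pi_div_two_mul_I, Complex.inv_I]

/-- The torsion forms that vanish except for given values of `τ₂`, `τ̂₂` and `τ₅`. -/
def torsionOf (β β' : ModelV [⋀^Fin 2]→ₗ[ℝ] ℝ) (α : ModelV →L[ℝ] ℝ) : TorsionForms ModelV where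
  τ0 := 0
  τ0' := 0
  τ2 := β
  τ2' := β'
  τ3 := 0
  τ4 := 0
  τ5 := α

theorem isModelTwoEight_zero : IsModelTwoEight 0 := by
  rw [isModelTwoEight_iff]
  simp

theorem isModelTorsion_torsionOf {β β' : ModelV [⋀^Fin 2]→ₗ[ℝ] ℝ} {α : ModelV →L[ℝ] ℝ}
    {b c : ModelV [⋀^Fin 4]→ₗ[ℝ] ℝ} (hβ : IsModelTwoEight β) (hβ' : IsModelTwoEight β')
    (hb : b = wedge (oneForm α) reForm + wedge β omegaForm)
    (hc : c = wedge (oneForm (α.comp modelJ)) reForm + wedge β' omegaForm) :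
    IsModelTorsion 0 b c (torsionOf β β' α) where
  mem_τ2 := hβ
  mem_τ2' := hβ'
  mem_τ3 := by
    rw [isModelThreeTwelve_iff]
    simp [torsionOf]
  d_Omega := by
    apply ext_threeForm
    simp [torsionOf, wedge_one_two, oneForm_apply]
  d_re := by rw [hb]; simp [torsionOf]
  d_im := by rw [hc]; simp [torsionOf]

/-- The form `e^{36} - e^{25}`. -/
def shearTwoForm : ModelV [⋀^Fin 2]→ₗ[ℝ] ℝ :=
  (dualVec₂ (Sum.inl 2) (Sum.inr 2) - dualVec₂ (Sum.inl 1) (Sum.inr 1)).toAlternatingMap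

theorem shearTwoForm_apply (X Y : ModelV) : shearTwoForm ![X, Y] =
    X (Sum.inl 2) * Y (Sum.inr 2) - X (Sum.inr 2) * Y (Sum.inl 2) -
      (X (Sum.inl 1) * Y (Sum.inr 1) - X (Sum.inr 1) * Y (Sum.inl 1)) := by
  change (dualVec₂ (Sum.inl 2) (Sum.inr 2) - dualVec₂ (Sum.inl 1) (Sum.inr 1)) ![X, Y] = _
  rw [ContinuousAlternatingMap.sub_apply, dualVec₂_apply, dualVec₂_apply]

theorem shearTwoForm_stdFrame (i j : Fin 6) : shearTwoForm ![stdFrame i, stdFrame j] =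
    (if i = 2 ∧ j = 5 then 1 else if i = 5 ∧ j = 2 then -1 else
      if i = 1 ∧ j = 4 then -1 else if i = 4 ∧ j = 1 then 1 else 0) := by
  rw [shearTwoForm_apply]
  fin_cases i <;> fin_cases j <;> simp [stdFrame, basisVec]

theorem isModelTwoEight_shearTwoForm : IsModelTwoEight shearTwoForm := by
  rw [isModelTwoEight_iff]
  simp [shearTwoForm_stdFrame]

theorem isModelTwoEight_neg {β : ModelV [⋀^Fin 2]→ₗ[ℝ] ℝ} (h : IsModelTwoEight β) :
    IsModelTwoEight (-β) := by
  rw [isModelTwoEight_iff] at h ⊢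
  obtain ⟨h1, h2, h3, h4, h5, h6, h7⟩ := h
  simp only [AlternatingMap.neg_apply, h1, h2, h3, h4, h5, h6]
  refine ⟨trivial, trivial, trivial, trivial, trivial, trivial, ?_⟩
  linarith

/-- The formula `shearD = -(e^1 + i e^4) ∧ (e^{36} - e^{25})`. -/
theorem shearD_eq (X Y Z : ModelV) : shearD ![X, Y, Z] =
    -(complexCoord X 0 * shearTwoForm ![Y, Z] - complexCoord Y 0 * shearTwoForm ![X, Z] +
      complexCoord Z 0 * shearTwoForm ![X, Y]) := by
  rw [shearD_apply]
  simp only [modelUpsilon_apply, Matrix.det_fin_three, Matrix.of_apply, Matrix.cons_val_zero,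
    Matrix.cons_val_one, Matrix.cons_val, shear_apply, Sum.elim_inl, Sum.elim_inr,
    Complex.real_smul, shearTwoForm_apply, complexCoord]
  push_cast
  ring_nf
  simp only [Complex.I_sq, Complex.I_pow_three]
  ring

theorem re_shearD (X Y Z : ModelV) :
    (Complex.reCLM.compContinuousAlternatingMap shearD).toAlternatingMap ![X, Y, Z] =
    -(X (Sum.inl 0) * shearTwoForm ![Y, Z] - Y (Sum.inl 0) * shearTwoForm ![X, Z] +
      Z (Sum.inl 0) * shearTwoForm ![X, Y]) := by
  change (shearD ![X, Y, Z]).re = _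
  rw [shearD_eq]
  simp [complexCoord]

theorem im_shearD (X Y Z : ModelV) :
    (Complex.imCLM.compContinuousAlternatingMap shearD).toAlternatingMap ![X, Y, Z] =
    -(X (Sum.inr 0) * shearTwoForm ![Y, Z] - Y (Sum.inr 0) * shearTwoForm ![X, Z] +
      Z (Sum.inr 0) * shearTwoForm ![X, Y]) := by
  change (shearD ![X, Y, Z]).im = _
  rw [shearD_eq]
  simp [complexCoord]

theorem stdFrame_zero_coord (i : Fin 6) : stdFrame i (Sum.inl 0) = (if i = 0 then 1 else 0) ∧
    stdFrame i (Sum.inr 0) = (if i = 3 then 1 else 0) := by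
  fin_cases i <;> simp [stdFrame, basisVec]

/-- Let σ = e^{36} - e^{25}, so D = -(e^1 + i e^4) ∧ σ. As σ ∧ (e^{25} + e^{36}) = 0, one has σ ∧ Ω₀
= e^{14} ∧ σ, hence e^1 ∧ D = -i σ ∧ Ω₀ and e^4 ∧ D = σ ∧ Ω₀. So λ = e^1 produces only τ̂2 = -σ, and
λ = e^4 only τ2 = σ. -/
theorem wedge_shearD :
    wedge (oneForm (dualVec (Sum.inl 0)))
      (Complex.reCLM.compContinuousAlternatingMap shearD).toAlternatingMap = 0 ∧
    wedge (oneForm (dualVec (Sum.inl 0)))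
      (Complex.imCLM.compContinuousAlternatingMap shearD).toAlternatingMap =
        wedge (-shearTwoForm) omegaForm ∧
    wedge (oneForm (dualVec (Sum.inr 0)))
      (Complex.reCLM.compContinuousAlternatingMap shearD).toAlternatingMap =
        wedge shearTwoForm omegaForm ∧
    wedge (oneForm (dualVec (Sum.inr 0)))
      (Complex.imCLM.compContinuousAlternatingMap shearD).toAlternatingMap = 0 := by
  have h : ∀ i, dualVec (Sum.inl 0) (stdFrame i) = if i = 0 then 1 else 0 :=
    fun i => (stdFrame_zero_coord i).1
  have h' : ∀ i, dualVec (Sum.inr 0) (stdFrame i) = if i = 3 then 1 else 0 :=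
    fun i => (stdFrame_zero_coord i).2
  refine ⟨?_, ?_, ?_, ?_⟩ <;> apply ext_fourForm <;> simp only [List.forall_mem_cons] <;>
    refine ⟨?_, ?_, ?_, ?_, ?_, ?_, ?_, ?_, ?_, ?_, ?_, ?_, ?_, ?_, ?_, by simp⟩ <;>
    simp [wedge_one_three, wedge_two_two, oneForm_apply, h, h', re_shearD, im_shearD,
      (stdFrame_zero_coord _).1, (stdFrame_zero_coord _).2, shearTwoForm_stdFrame,
      omegaForm_stdFrame]

/-- If λ vanishes on the image of N, the shears preserve λ, and the torsion is constant in the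
moving coframe. -/
theorem covec_ofShear (lam : ModelV →L[ℝ] ℝ) (h : ∀ X, lam (shearN X) = 0) (t : ℝ) :
    (ofShear lam).covec t = lam := by
  ext X
  change lam (X - t • shearN X) = lam X
  rw [map_sub, map_smul, h, smul_zero, sub_zero]

theorem not_isMinimalClass_of_X2minus {C : Set TorsionLabel} (hC : TorsionLabel.X2minus ∈ C) :
    ¬ IsMinimalClass C := by
  obtain ⟨h1, h2, -, -⟩ := wedge_shearD
  -- The plane ⟨e_4, e_2 + e_6, e_3 + e_5⟩ lies in the kernel of e^1 and is Lagrangian with Υ₀ = 2i,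
  -- so its phase is π/2. Since σ(e_2 + e_6, e_3 + e_5) = -2, D takes the value 2i on it.
  refine (ofShear (dualVec (Sum.inl 0))).not_isMinimalClass (inClass _ fun t => ?_) ?_
    (Real.pi / 2) (ofColumns ![basisVec (Sum.inr 0), basisVec (Sum.inl 1) + basisVec (Sum.inr 2),
      basisVec (Sum.inl 2) + basisVec (Sum.inr 1)]) ?_ ?_ ?_ ?_ ?_ ?_
  · refine ⟨torsionOf 0 (-shearTwoForm) 0, ?_, ?_⟩
    · rw [covec_ofShear _ fun X => shearN_apply X _]
      refine isModelTorsion_torsionOf isModelTwoEight_zero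
        (isModelTwoEight_neg isModelTwoEight_shearTwoForm) (h1.trans ?_) (h2.trans ?_)
      · apply ext_fourForm
        simp [wedge_one_three, wedge_two_two, oneForm_apply]
      · apply ext_fourForm
        simp [wedge_one_three, oneForm_apply]
    · intro l hl
      cases l <;> first | rfl | exact absurd hC hl
  · intro X
    ext i
    exact (shear_apply 0 X i).trans (by simp)
  · intro X Y h
    have h := fun i => congrFun (congrArg WithLp.ofLp h) i
    have h3 := h (Sum.inr 0)
    have h4 := h (Sum.inr 1)
    have h5 := h (Sum.inr 2)
    simp [ofColumns_apply, basisVec] at h3 h4 h5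
    ext i
    fin_cases i
    · exact h3
    · exact h5
    · exact h4
  · intro X
    exact (ofColumns_apply _ X _).trans (by simp [basisVec])
  · intro X Y
    rw [modelOmega_apply, Fin.sum_univ_three]
    simp [ofColumns_apply, basisVec]
  · intro X Y Z
    rw [exp_neg_pi_div_two_mul_I]
    simp [modelUpsilon_apply, Matrix.det_fin_three, ofColumns_apply, basisVec]
    ring
  · exact ⟨basisVec (Sum.inl 0), by simp [ofShear, dualVec_basisVec]⟩
  · change phaseCLM _ (shearD _) ≠ 0
    simp only [ofColumns_stdVec]
    rw [shearD_eq, phaseCLM_apply, exp_neg_pi_div_two_mul_I]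
    simp [complexCoord, shearTwoForm_apply, basisVec]

theorem not_isMinimalClass_of_X2plus {C : Set TorsionLabel} (hC : TorsionLabel.X2plus ∈ C) :
    ¬ IsMinimalClass C := by
  obtain ⟨-, -, h1, h2⟩ := wedge_shearD
  -- The same plane with e_1 in place of e_4: it lies in the kernel of e^4, has Υ₀ = 2 and phase 0,
  -- and D = 2 on it.
  refine (ofShear (dualVec (Sum.inr 0))).not_isMinimalClass (inClass _ fun t => ?_) ?_
    0 (ofColumns ![basisVec (Sum.inl 0), basisVec (Sum.inl 1) + basisVec (Sum.inr 2),
      basisVec (Sum.inl 2) + basisVec (Sum.inr 1)]) ?_ ?_ ?_ ?_ ?_ ?_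
  · refine ⟨torsionOf shearTwoForm 0 0, ?_, ?_⟩
    · rw [covec_ofShear _ fun X => shearN_apply X _]
      refine isModelTorsion_torsionOf isModelTwoEight_shearTwoForm isModelTwoEight_zero
        (h1.trans ?_) (h2.trans ?_)
      · apply ext_fourForm
        simp [wedge_one_three, oneForm_apply]
      · apply ext_fourForm
        simp [wedge_one_three, wedge_two_two, oneForm_apply]
    · intro l hl
      cases l <;> first | rfl | exact absurd hC hl
  · intro X
    ext i
    exact (shear_apply 0 X i).trans (by simp)
  · intro X Y h
    have h := fun i => congrFun (congrArg WithLp.ofLp h) i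
    have h3 := h (Sum.inl 0)
    have h4 := h (Sum.inl 1)
    have h5 := h (Sum.inl 2)
    simp [ofColumns_apply, basisVec] at h3 h4 h5
    ext i
    fin_cases i
    · exact h3
    · exact h4
    · exact h5
  · intro X
    exact (ofColumns_apply _ X _).trans (by simp [basisVec])
  · intro X Y
    rw [modelOmega_apply, Fin.sum_univ_three]
    simp [ofColumns_apply, basisVec]
  · intro X Y Z
    rw [exp_neg_zero_mul_I]
    simp [modelUpsilon_apply, Matrix.det_fin_three, ofColumns_apply, basisVec]
    ring
  · exact ⟨basisVec (Sum.inr 0), by simp [ofShear, dualVec_basisVec]⟩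
  · change phaseCLM _ (shearD _) ≠ 0
    simp only [ofColumns_stdVec]
    rw [shearD_eq, phaseCLM_apply]
    simp [complexCoord, shearTwoForm_apply, basisVec]

/-- With ζ = (e^2 + i e^5) ∧ (e^3 + i e^6), both e^4 ∧ D and the pair of right-hand sides are the
real and imaginary parts of e^4 ∧ e^1 ∧ ζ, because e^4 ∘ J₀ = e^1. So λ = e^4 produces only τ5. -/
theorem wedge_stretchForm :
    wedge (oneForm (dualVec (Sum.inr 0)))
      (Complex.reCLM.compContinuousAlternatingMap (stretchForm 1 (-1))).toAlternatingMap =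
        wedge (oneForm (dualVec (Sum.inr 0))) reForm ∧
    wedge (oneForm (dualVec (Sum.inr 0)))
      (Complex.imCLM.compContinuousAlternatingMap (stretchForm 1 (-1))).toAlternatingMap =
        wedge (oneForm ((dualVec (Sum.inr 0)).comp modelJ)) reForm := by
  have h : ∀ i, dualVec (Sum.inl 0) (stdFrame i) = if i = 0 then 1 else 0 :=
    fun i => (stdFrame_zero_coord i).1
  have h' : ∀ i, dualVec (Sum.inr 0) (stdFrame i) = if i = 3 then 1 else 0 :=
    fun i => (stdFrame_zero_coord i).2
  have hJ : (dualVec (Sum.inr 0)).comp modelJ = dualVec (Sum.inl 0) := by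
    ext X
    exact modelJ_apply X _
  have hr : ∀ X Y Z, (Complex.reCLM.compContinuousAlternatingMap
      (stretchForm 1 (-1))).toAlternatingMap ![X, Y, Z] = (stretchForm 1 (-1) ![X, Y, Z]).re :=
    fun X Y Z => rfl
  have hi : ∀ X Y Z, (Complex.imCLM.compContinuousAlternatingMap
      (stretchForm 1 (-1))).toAlternatingMap ![X, Y, Z] = (stretchForm 1 (-1) ![X, Y, Z]).im :=
    fun X Y Z => rfl
  rw [hJ]
  constructor <;> apply ext_fourForm <;> simp only [List.forall_mem_cons] <;>
    refine ⟨?_, ?_, ?_, ?_, ?_, ?_, ?_, ?_, ?_, ?_, ?_, ?_, ?_, ?_, ?_, by simp⟩ <;>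
    simp [wedge_one_three, oneForm_apply, h, h', hr, hi, reForm_stdFrame] <;>
    simp [stretchForm_apply, Matrix.det_fin_three, stdFrame, basisVec]

theorem wedge_oneForm_smul (r : ℝ) (α : ModelV →L[ℝ] ℝ) (γ : ModelV [⋀^Fin 3]→ₗ[ℝ] ℝ) :
    wedge (oneForm (r • α)) γ = r • wedge (oneForm α) γ := by
  ext v
  simp only [wedge_one_three, AlternatingMap.smul_apply, oneForm_apply, smul_apply, smul_eq_mul]
  ring

theorem not_isMinimalClass_of_X5 {C : Set TorsionLabel} (hC : TorsionLabel.X5 ∈ C) :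
    ¬ IsMinimalClass C := by
  obtain ⟨h1, h2⟩ := wedge_stretchForm
  -- The plane ⟨e_1, e_2, e_3⟩ lies in the kernel of e^4, has phase 0, and D = 1 on it.
  refine ofStretch.not_isMinimalClass (inClass _ fun t => ?_) ?_
    0 (ofColumns fun p => basisVec (Sum.inl p)) ?_ ?_ ?_ ?_ ?_ ?_
  · refine ⟨torsionOf 0 0 (Real.exp t • dualVec (Sum.inr 0)), ?_, ?_⟩
    -- The inverse stretch multiplies e_4 by e^t, so τ5 is not constant in the moving coframe, but
    -- it stays a multiple of e^4.
    · have hcov : ofStretch.covec t = Real.exp t • dualVec (Sum.inr 0) := by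
        ext X
        exact stretchMap_apply _ _ X _
      have h0 : wedge 0 omegaForm = (0 : ModelV [⋀^Fin 4]→ₗ[ℝ] ℝ) := by
        apply ext_fourForm
        simp [wedge_two_two]
      rw [hcov, wedge_oneForm_smul, wedge_oneForm_smul]
      refine isModelTorsion_torsionOf isModelTwoEight_zero isModelTwoEight_zero ?_ ?_
      · rw [h0, add_zero, wedge_oneForm_smul]
        exact congrArg _ h1
      · rw [h0, add_zero, ContinuousLinearMap.smul_comp, wedge_oneForm_smul]
        exact congrArg _ h2
    · intro l hl
      cases l <;> first | rfl | exact absurd hC hl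
  · intro X
    ext i
    refine (stretchMap_apply _ _ X i).trans ?_
    rcases i with p | p <;> fin_cases p <;> simp
  · intro X Y h
    have h := fun i => congrFun (congrArg WithLp.ofLp h) i
    have h3 := h (Sum.inl 0)
    have h4 := h (Sum.inl 1)
    have h5 := h (Sum.inl 2)
    simp [ofColumns_apply, basisVec] at h3 h4 h5
    ext i
    fin_cases i
    · exact h3
    · exact h4
    · exact h5
  · intro X
    change ofColumns (fun p => basisVec (Sum.inl p)) X (Sum.inr 0) = 0
    rw [ofColumns_apply]
    simp [basisVec]
  · intro X Y
    rw [modelOmega_apply, Fin.sum_univ_three]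
    simp [ofColumns_apply, basisVec]
  · intro X Y Z
    rw [exp_neg_zero_mul_I]
    simp [modelUpsilon_apply, Matrix.det_fin_three, ofColumns_apply, basisVec]
  · exact ⟨basisVec (Sum.inr 0), by simp [ofStretch, dualVec_basisVec]⟩
  · change phaseCLM _ (stretchForm 1 (-1) _) ≠ 0
    simp only [ofColumns_stdVec]
    rw [stretchForm_apply, phaseCLM_apply]
    simp [Matrix.det_fin_three, basisVec]

end ShearData

/-! ### The minimal torsion classes and the theorem. -/

theorem isMinimalClass_of_subset {C : Set TorsionLabel} (h2 : TorsionLabel.X2plus ∉ C)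
    (h2' : TorsionLabel.X2minus ∉ C) (h5 : TorsionLabel.X5 ∉ C) : IsMinimalClass C := by
  intro M _ _ _ _ _ L _ _ _ _ _ S θ f hC hf p
  obtain ⟨c, hc⟩ := hf.exists_adaptedCoframe p
  obtain ⟨τ, hτ, hv⟩ := hC (f p)
  have e2 : τ.τ2 = 0 := hv _ h2
  have e2' : τ.τ2' = 0 := hv _ h2'
  have e5 : τ.τ5 = 0 := hv _ h5
  have h := hf.meanCurvature_eq_sum p hc hτ
  have h0 : c (meanCurvature 3 S.metric f p) = 0 := by
    rw [h]
    refine Finset.sum_eq_zero fun q _ => ?_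
    simp only [TorsionForms.push, e2, e2', e5]
    refine smul_eq_zero_of_left ?_ _
    change Real.cos θ * 0 + Real.sin θ * 0 - 0 = 0
    ring
  exact c.injective (h0.trans (map_zero c).symm)

theorem theorem2p11 :
    -- the torsion forms exist and are unique
    (∀ (M : Type u) [TopologicalSpace M] [ChartedSpace (EuclideanSpace ℝ (Fin 6)) M]
      [IsManifold (𝓡 6) ∞ M] (S : SU3Structure M) (x : M),
      ∃! τ : TorsionForms (TangentSpace (𝓡 6) x), S.IsTorsion x τ) ∧
    -- the maps `§` and `♮` are isometric isomorphisms
    (∀ θ : ℝ,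
      (Set.BijOn (sectionMap θ) covecT (rotatedNormal θ) ∧
        ∀ α ∈ covecT, ‖sectionMap θ α‖ = ‖α‖) ∧
      (Set.BijOn (naturalMap θ) lambdaEightOne (rotatedNormal θ) ∧
        ∀ β ∈ lambdaEightOne, ‖naturalMap θ β‖ ^ 2 = twoFormNormSq β)) ∧
    -- the mean curvature formula, read in an arbitrary adapted coframe
    (∀ (M : Type u) [TopologicalSpace M] [ChartedSpace (EuclideanSpace ℝ (Fin 6)) M]
      [IsManifold (𝓡 6) ∞ M]
      (L : Type v) [TopologicalSpace L] [ChartedSpace (EuclideanSpace ℝ (Fin 3)) L]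
      [IsManifold (𝓡 3) ∞ L]
      (S : SU3Structure M) (θ : ℝ) (f : L → M), S.IsSpecialLagrangian θ f → ∀ p : L,
      (∃ c : TangentSpace (𝓡 6) (f p) ≃L[ℝ] ModelV, S.IsAdaptedCoframe θ f p c) ∧
      ∀ c : TangentSpace (𝓡 6) (f p) ≃L[ℝ] ModelV, S.IsAdaptedCoframe θ f p c →
      ∀ τ : TorsionForms (TangentSpace (𝓡 6) (f p)), S.IsTorsion (f p) τ →
        c (meanCurvature 3 S.metric f p) =
          -(1 / Real.sqrt 2 * Real.cos θ) •
              naturalMap θ (partOne (τ.τ2.compLinearMap (c.symm : ModelV →ₗ[ℝ] _)))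
            - (1 / Real.sqrt 2 * Real.sin θ) •
              naturalMap θ (partOne (τ.τ2'.compLinearMap (c.symm : ModelV →ₗ[ℝ] _)))
            + Real.sin (θ / 3) • sectionMap θ (partT (τ.τ5.comp (c.symm : ModelV →L[ℝ] _)))
            - Real.cos (θ / 3) •
              sectionMap θ ((partN (τ.τ5.comp (c.symm : ModelV →L[ℝ] _))).comp modelJ)) ∧
    -- the largest torsion class all of whose special Lagrangian three-folds are minimal
    IsGreatest {C : Set TorsionLabel | IsMinimalClass C}
      {TorsionLabel.X0plus, TorsionLabel.X0minus, TorsionLabel.X3, TorsionLabel.X4} := by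
  refine ⟨fun M _ _ _ S x => S.existsUnique_isTorsion x, fun θ => ⟨⟨bijOn_sectionMap θ,
    fun α hα => norm_sectionMap θ hα⟩, bijOn_naturalMap θ, fun β hβ => norm_naturalMap θ hβ⟩, ?_, ?_⟩
  · intro M _ _ _ L _ _ _ S θ f hf p
    refine ⟨hf.exists_adaptedCoframe p, fun c hc τ hτ => ?_⟩
    have h := (hc.1.isTorsion_iff τ).mp hτ
    exact (hf.meanCurvature_eq_sum p hc hτ).trans
      (meanCurvature_terms_eq_sum h.mem_τ2 h.mem_τ2' (τ.push c).τ5).symm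
  -- For maximality, each example has a single nonzero summand, hence belongs to every class
  -- containing that summand; a minimal class can therefore contain none of the three labels.
  · refine ⟨isMinimalClass_of_subset (by simp) (by simp) (by simp), fun C hC l hl => ?_⟩
    cases l
    case X2plus => exact absurd hC (ShearData.not_isMinimalClass_of_X2plus hl)
    case X2minus => exact absurd hC (ShearData.not_isMinimalClass_of_X2minus hl)
    case X5 => exact absurd hC (ShearData.not_isMinimalClass_of_X5 hl)
    all_goals simp

end
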